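/- \textbf{Theorem.} Over constructive Zermelo--Fraenkel set theory $\mathbf{CZF}$ (based on intuitionistic first-order logic with equality) the following two statements are equivalent, i.e. $\mathbf{CZF}$ proves $(1)\leftrightarrow(2)$. (1) \emph{Full NID}: for every set $X$ and every set $\mathcal R$ of pairs $(a,b)$ of subsets of $X$, the class of $\mathcal R$-closed subsets of $X$ is set-generated. Here $Y\subseteq X$ is $\mathcal R$-closed if for all $(a,b)\in\mathcal R$, $a\subseteq Y$ implies that $b\cap Y$ is inhabited; and a class $\mathcal C$ of subsets of $X$ is set-generated if there is a set $G\subseteq\mathcal C$ such that for every $\alpha\in\mathcal C$ and $x\in\alpha$ there is a $\beta\in G$ with $x\in\beta\subseteq\alpha$. (2) Let $\Sigma$ be a first-order signature (function and relation symbols with finite arities), let $\mathcal N$ be a set of relation symbols not occurring in $\Sigma$, put $\Sigma'=\Sigma\cup\mathcal N$, let $M$ be a $\Sigma$-structure and let $T$ be a game theory over $\Sigma'$. Then there is a set $\mathcal M$ of $\Sigma'$-expansions of $M$ which are models of $T$, such that every $\Sigma'$-expansion of $M$ which is a model of $T$ is the union of a set of elements of $\mathcal M$. Here a \emph{game formula}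 over $\Sigma'$ is a formula built from atomic formulas $R(t_1,\dots,t_k)$, with $R$ a relation symbol of $\Sigma'$ (equality is not allowed), by means of conjunctions and disjunctions of arbitrary sets of formulas and of existential and universal quantification over single variables, without implications or negations; a \emph{game sequent} is a universal closure $\forall D\,(\varphi\to\psi)$ with $\varphi,\psi$ game formulas, where $D$ is a set of variables $x_n$ $(n\in\mathbb N)$ containing all free variables of $\varphi$ and $\psi$; and a \emph{game theory} is a set of game sequents. A \emph{$\Sigma'$-expansion} of $M$ is a $\Sigma'$-structure with the same underlying set as $M$ and the same interpretation of the symbols in $\Sigma$. A $\Sigma'$-expansion $M_0$ of $M$ is the \emph{union} of a set $\mathcal K$ of $\Sigma'$-expansions of $M$ if $R^{M_0}=\bigcup_{K\in\mathcal K}R^{K}$ for all $R\in\mathcal N$. -/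

import Mathlib

namespace CZF

/-! ## The first-order language of set theory and intuitionistic provability -/

/-- First-order formulas over `∈` and `=`, with de Bruijn indices: under a quantifier the index `0`
is the variable bound by it, and `n + 1` is the variable which was `n` outside. -/
inductive Fml : Type
  | bot : Fml
  | mem (x y : ℕ) : Fml
  | eq (x y : ℕ) : Fml
  | and (φ ψ : Fml) : Fml
  | or (φ ψ : Fml) : Fml
  | imp (φ ψ : Fml) : Fml
  | all (φ : Fml) : Fml
  | ex (φ : Fml) : Fml

/-- A renaming of variables, carried under a quantifier. -/
def under (ρ : ℕ → ℕ) : ℕ → ℕ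
  | 0 => 0
  | n + 1 => ρ n + 1

/-- Capture-avoiding renaming of the free variables. As variables are the only terms, this is also
the substitution of terms for free variables. -/
def Fml.rename : (ℕ → ℕ) → Fml → Fml
  | _, .bot => .bot
  | ρ, .mem x y => .mem (ρ x) (ρ y)
  | ρ, .eq x y => .eq (ρ x) (ρ y)
  | ρ, .and φ ψ => .and (φ.rename ρ) (ψ.rename ρ)
  | ρ, .or φ ψ => .or (φ.rename ρ) (ψ.rename ρ)
  | ρ, .imp φ ψ => .imp (φ.rename ρ) (ψ.rename ρ)
  | ρ, .all φ => .all (φ.rename (under ρ))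
  | ρ, .ex φ => .ex (φ.rename (under ρ))

/-- The formula `φ`, made independent of a new variable `0`. -/
def Fml.shift (φ : Fml) : Fml := φ.rename Nat.succ

/-- The renaming which sends the variable `0` to `y` and removes it from the context. -/
def instRen (y : ℕ) : ℕ → ℕ
  | 0 => y
  | n + 1 => n

/-- The result `φ[y/0]` of instantiating the variable `0` by `y`. -/
def Fml.inst (φ : Fml) (y : ℕ) : Fml := φ.rename (instRen y)

/-- Natural deduction for intuitionistic first-order logic with equality. `Prf T Γ φ`: the formula
`φ` is derivable from the assumptions `Γ` and the nonlogical axioms `T`. The axioms in `T` are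
read as universally closed (their free variables may be generalised), those in `Γ` are not. -/
inductive Prf (T : Fml → Prop) : List Fml → Fml → Prop
  | axm {Γ φ} : T φ → Prf T Γ φ
  | hyp {Γ φ} : φ ∈ Γ → Prf T Γ φ
  | botE {Γ φ} : Prf T Γ .bot → Prf T Γ φ
  | andI {Γ φ ψ} : Prf T Γ φ → Prf T Γ ψ → Prf T Γ (.and φ ψ)
  | andE₁ {Γ φ ψ} : Prf T Γ (.and φ ψ) → Prf T Γ φ
  | andE₂ {Γ φ ψ} : Prf T Γ (.and φ ψ) → Prf T Γ ψ
  | orI₁ {Γ φ ψ} : Prf T Γ φ → Prf T Γ (.or φ ψ)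
  | orI₂ {Γ φ ψ} : Prf T Γ ψ → Prf T Γ (.or φ ψ)
  | orE {Γ φ ψ χ} : Prf T Γ (.or φ ψ) → Prf T (φ :: Γ) χ → Prf T (ψ :: Γ) χ → Prf T Γ χ
  | impI {Γ φ ψ} : Prf T (φ :: Γ) ψ → Prf T Γ (.imp φ ψ)
  | impE {Γ φ ψ} : Prf T Γ (.imp φ ψ) → Prf T Γ φ → Prf T Γ ψ
  | allI {Γ φ} : Prf T (Γ.map Fml.shift) φ → Prf T Γ (.all φ)
  | allE {Γ φ} (y : ℕ) : Prf T Γ (.all φ) → Prf T Γ (φ.inst y)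
  | exI {Γ φ} (y : ℕ) : Prf T Γ (φ.inst y) → Prf T Γ (.ex φ)
  | exE {Γ φ ψ} : Prf T Γ (.ex φ) → Prf T (φ :: Γ.map Fml.shift) ψ.shift → Prf T Γ ψ
  | eqI {Γ} (x : ℕ) : Prf T Γ (.eq x x)
  | eqE {Γ x y} (φ : Fml) : Prf T Γ (.eq x y) → Prf T Γ (φ.inst x) → Prf T Γ (φ.inst y)

/-- Bounded (`Δ₀`) formulas: all quantifiers are of the form `∀ x ∈ y` or `∃ x ∈ y`. -/
inductive IsBounded : Fml → Prop
  | bot : IsBounded .bot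
  | mem (x y : ℕ) : IsBounded (.mem x y)
  | eq (x y : ℕ) : IsBounded (.eq x y)
  | and {φ ψ} : IsBounded φ → IsBounded ψ → IsBounded (.and φ ψ)
  | or {φ ψ} : IsBounded φ → IsBounded ψ → IsBounded (.or φ ψ)
  | imp {φ ψ} : IsBounded φ → IsBounded ψ → IsBounded (.imp φ ψ)
  | all {φ} (y : ℕ) : IsBounded φ → IsBounded (.all (.imp (.mem 0 (y + 1)) φ))
  | ex {φ} (y : ℕ) : IsBounded φ → IsBounded (.ex (.and (.mem 0 (y + 1)) φ))

/-! ## Writing formulas with named variables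

A term of type `Fm` is a formula given as a function of the number `d` of quantifiers above it. A
bound variable is named by its level, the number of quantifiers above its own quantifier, so that
at depth `d` the variable of level `x < d` has the index `d - 1 - x`; the indices from `d` on are
the parameters. This allows one to write `all fun x => ex fun y => x ∊ y` for `∀ x ∃ y, x ∈ y`. -/

abbrev Fm : Type := ℕ → Fml

def fal : Fm := fun _ => .bot
def mem (x y : ℕ) : Fm := fun d => .mem (d - 1 - x) (d - 1 - y)
def eq (x y : ℕ) : Fm := fun d => .eq (d - 1 - x) (d - 1 - y)
def conj (φ ψ : Fm) : Fm := fun d => .and (φ d) (ψ d)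
def disj (φ ψ : Fm) : Fm := fun d => .or (φ d) (ψ d)
def impl (φ ψ : Fm) : Fm := fun d => .imp (φ d) (ψ d)
def all (φ : ℕ → Fm) : Fm := fun d => .all (φ d (d + 1))
def ex (φ : ℕ → Fm) : Fm := fun d => .ex (φ d (d + 1))

scoped infix:50 " ∊ " => CZF.mem
scoped infix:50 " ≐ " => CZF.eq
scoped infixr:35 " ⋏ " => CZF.conj
scoped infixr:30 " ⋎ " => CZF.disj
scoped infixr:25 " ⇾ " => CZF.impl

def neg (φ : Fm) : Fm := φ ⇾ fal
def equi (φ ψ : Fm) : Fm := (φ ⇾ ψ) ⋏ (ψ ⇾ φ)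

scoped infix:20 " ⇿ " => CZF.equi

/-- `∀ x ∈ a, φ x`. -/
def allIn (a : ℕ) (φ : ℕ → Fm) : Fm := all fun x => x ∊ a ⇾ φ x

/-- `∃ x ∈ a, φ x`. -/
def exIn (a : ℕ) (φ : ℕ → Fm) : Fm := ex fun x => x ∊ a ⋏ φ x

/-- The formula `φ` with its variables `0, 1, …` replaced by the variables in the list `xs`; the
remaining free variables of `φ` become parameters. -/
def app (φ : Fml) (xs : List ℕ) : Fm := fun d =>
  φ.rename fun i => if i < xs.length then d - 1 - xs.getD i 0 else d + (i - xs.length)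

/-! ## Some set-theoretic vocabulary -/

/-- `x ⊆ y`. -/
def sub (x y : ℕ) : Fm := allIn x fun z => z ∊ y

/-- `x = ∅`. -/
def isEmpty (x : ℕ) : Fm := allIn x fun _ => fal

/-- `y = x ∪ {n}`. -/
def isAdjoin (y x n : ℕ) : Fm := all fun z => z ∊ y ⇿ z ∊ x ⋎ z ≐ n

/-- `z = x ∪ y`. -/
def isUnion (z x y : ℕ) : Fm := all fun u => u ∊ z ⇿ u ∊ x ⋎ u ∊ y

/-- `om` is the set of (von Neumann) natural numbers. -/
def isOmega (om : ℕ) : Fm :=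
  all fun u => u ∊ om ⇿ isEmpty u ⋎ exIn om fun v => isAdjoin u v v

/-- `u` is the von Neumann numeral of `k`. -/
def isNum : ℕ → ℕ → Fm
  | 0, u => isEmpty u
  | k + 1, u => ex fun v => isNum k v ⋏ isAdjoin u v v

/-- `z = ⟨x, y⟩ = {{x}, {x, y}}`. -/
def isPair (z x y : ℕ) : Fm :=
  all fun w => w ∊ z ⇿ (all fun u => u ∊ w ⇿ u ≐ x) ⋎ (all fun u => u ∊ w ⇿ u ≐ x ⋎ u ≐ y)

/-- `⟨x, y⟩ ∈ r`. -/
def pairMem (x y r : ℕ) : Fm := exIn r fun p => isPair p x y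

/-- `⟨x, y⟩ ∈ g` and `⟨x, y'⟩ ∈ g` imply `y = y'`. -/
def functional (g : ℕ) : Fm :=
  all fun x => all fun y => all fun y' => pairMem x y g ⇾ pairMem x y' g ⇾ y ≐ y'

/-- `g` is a function from `X` to `Y`. -/
def isFun (g X Y : ℕ) : Fm :=
  (allIn g fun p => exIn X fun x => exIn Y fun y => isPair p x y) ⋏
  (allIn X fun x => exIn Y fun y => pairMem x y g) ⋏
  functional g

/-- `z = ⟨k, y⟩`, with the numeral `k` serving as a tag. -/
def isTagged (k : ℕ) (z y : ℕ) : Fm := ex fun t => isNum k t ⋏ isPair z t y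

/-- `z = ⟨k, ⟨x, y⟩⟩`, with the numeral `k` serving as a tag. -/
def isTagged₂ (k : ℕ) (z x y : ℕ) : Fm := ex fun p => isTagged k z p ⋏ isPair p x y

/-! ## The axioms of constructive Zermelo-Fraenkel set theory -/

def extensionality : Fm := all fun x => all fun y => (all fun z => z ∊ x ⇿ z ∊ y) ⇾ x ≐ y

def pairing : Fm := all fun x => all fun y => ex fun z => all fun w => w ∊ z ⇿ w ≐ x ⋎ w ≐ y

def union : Fm := all fun x => ex fun y => all fun z => z ∊ y ⇿ exIn x fun w => z ∊ w

def infinity : Fm := ex fun om => isOmega om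

def setInduction (φ : Fml) : Fm :=
  (all fun a => (allIn a fun x => app φ [x]) ⇾ app φ [a]) ⇾ all fun a => app φ [a]

def separation (φ : Fml) : Fm :=
  all fun a => ex fun b => all fun x => x ∊ b ⇿ x ∊ a ⋏ app φ [x]

def strongCollection (φ : Fml) : Fm :=
  all fun a => (allIn a fun x => ex fun y => app φ [x, y]) ⇾
    ex fun b => (allIn a fun x => exIn b fun y => app φ [x, y]) ⋏
      (allIn b fun y => exIn a fun x => app φ [x, y])

def subsetCollection (φ : Fml) : Fm :=
  all fun a => all fun b => ex fun c => all fun u =>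
    (allIn a fun x => exIn b fun y => app φ [x, y, u]) ⇾
      exIn c fun d => (allIn a fun x => exIn d fun y => app φ [x, y, u]) ⋏
        (allIn d fun y => exIn a fun x => app φ [x, y, u])

/-- The axioms of CZF. In the schemes, `φ` is any formula (bounded, for separation), possibly with
further free variables as parameters. -/
inductive Axiom : Fml → Prop
  | extensionality : Axiom (extensionality 0)
  | pairing : Axiom (pairing 0)
  | union : Axiom (union 0)
  | infinity : Axiom (infinity 0)
  | setInduction (φ : Fml) : Axiom (setInduction φ 0)
  | separation (φ : Fml) : IsBounded φ → Axiom (separation φ 0)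
  | strongCollection (φ : Fml) : Axiom (strongCollection φ 0)
  | subsetCollection (φ : Fml) : Axiom (subsetCollection φ 0)

/-- CZF proves `φ`. -/
def Proves (φ : Fm) : Prop := Prf Axiom [] (φ 0)

/-! ## Non-deterministic inductive definitions -/

/-- `R` is a set of rules on `X`, that is, of pairs of subsets of `X`. -/
def isRuleSet (R X : ℕ) : Fm :=
  allIn R fun ρ => ex fun a => ex fun b => isPair ρ a b ⋏ sub a X ⋏ sub b X

/-- `Y` is an `R`-closed subset of `X`. -/
def isClosed (R X Y : ℕ) : Fm :=
  sub Y X ⋏ all fun a => all fun b => pairMem a b R ⇾ sub a Y ⇾ exIn b fun y => y ∊ Y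

/-- The principle of full NID: for every set `R` of rules on a set `X`, the class of `R`-closed
subsets of `X` is generated by a set `G` of `R`-closed subsets. -/
def fullNID : Fm :=
  all fun X => all fun R => isRuleSet R X ⇾
    ex fun G => (allIn G fun β => isClosed R X β) ⋏
      all fun α => isClosed R X α ⇾
        allIn α fun x => exIn G fun β => x ∊ β ⋏ sub β α

/-! ## Signatures, terms and game formulas

A signature is given by two sets of pairs `⟨symbol, arity⟩`: one, below called `f`, for the function
symbols (constants have arity `0`), and one, below called `r` or `q`, for the relation symbols.
Everything here happens inside set theory: the formulas are infinitary and are coded as sets. The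
variables are indexed by the set `om` of natural numbers, and tuples of length `k` are functions
with domain the natural number `k`. The codes are:
* `⟨0, n⟩` is the variable with index `n`, and `⟨1, ⟨h, g⟩⟩` is the function symbol `h` applied to
  the tuple `g` of terms;
* `⟨0, ⟨R, g⟩⟩` is the relation symbol `R` applied to the tuple `g` of terms;
* `⟨1, Φ⟩` and `⟨2, Φ⟩` are the conjunction and disjunction of the set `Φ` of formulas;
* `⟨3, ⟨n, ψ⟩⟩` and `⟨4, ⟨n, ψ⟩⟩` are `ψ` with `∃` and `∀` over the variable with index `n`.

Because of set induction, sets are well-founded. An inductively generated class of codes (of terms,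
or of formulas, or of true formulas) therefore consists of the elements of those sets all whose
elements are obtained from other elements of the same set by one of the generating clauses. -/

/-- `σ` assigns to each of a set of symbols an arity in `om`. -/
def isArity (om σ : ℕ) : Fm :=
  (allIn σ fun p => ex fun s => exIn om fun k => isPair p s k) ⋏ functional σ

/-- `σ` and `τ` have no symbol in common. -/
def noCommonSymbol (σ τ : ℕ) : Fm :=
  all fun s => all fun k => all fun l => pairMem s k σ ⇾ pairMem s l τ ⇾ fal

/-- `t` is a term over `f` with variables in `D`. -/
def isTerm (f D t : ℕ) : Fm :=
  ex fun S => t ∊ S ⋏ allIn S fun s =>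
    (exIn D fun n => isTagged 0 s n) ⋎
    (ex fun h => ex fun k => ex fun g => pairMem h k f ⋏ isFun g k S ⋏ isTagged₂ 1 s h g)

/-- `g` is a `k`-tuple of terms over `f` with variables in `D`. -/
def isTermTuple (f D k g : ℕ) : Fm :=
  ex fun Y => isFun g k Y ⋏ allIn Y fun t => isTerm f D t

/-- `φ` is a game formula, with function symbols in `f`, relation symbols in `q`, and free variables
in `D`. The set `S` consists of pairs `⟨E, χ⟩`, where `E` contains the free variables of `χ`. -/
def isGameFormula (om f q D φ : ℕ) : Fm :=
  ex fun S => pairMem D φ S ⋏ all fun E => all fun χ => pairMem E χ S ⇾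
    (ex fun R => ex fun k => ex fun g =>
      pairMem R k q ⋏ isTermTuple f E k g ⋏ isTagged₂ 0 χ R g) ⋎
    (ex fun Φ => isTagged 1 χ Φ ⋏ allIn Φ fun ψ => pairMem E ψ S) ⋎
    (ex fun Φ => isTagged 2 χ Φ ⋏ allIn Φ fun ψ => pairMem E ψ S) ⋎
    (exIn om fun n => ex fun ψ => ex fun E' =>
      isTagged₂ 3 χ n ψ ⋏ isAdjoin E' E n ⋏ pairMem E' ψ S) ⋎
    (exIn om fun n => ex fun ψ => ex fun E' =>
      isTagged₂ 4 χ n ψ ⋏ isAdjoin E' E n ⋏ pairMem E' ψ S)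

/-- `s` is the (code of the) sequent `∀ D, φ → ψ`. -/
def isSequent (s D φ ψ : ℕ) : Fm := ex fun p => isPair s D p ⋏ isPair p φ ψ

/-- `T` is a set of game sequents `∀ D, φ → ψ`, where `D` is a set of variables which contains all
free variables of `φ` and `ψ`. -/
def isGameTheory (om f q T : ℕ) : Fm :=
  allIn T fun s => ex fun D => ex fun φ => ex fun ψ => isSequent s D φ ψ ⋏
    sub D om ⋏ isGameFormula om f q D φ ⋏ isGameFormula om f q D ψ

/-! ## Structures and satisfaction

A structure has an underlying set `A`, a set `F` of pairs `⟨⟨h, b⟩, y⟩` such that `y` is the value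
of the function symbol `h` at the tuple `b`, and a set `J` of pairs `⟨R, a⟩` such that the relation
denoted by `R` holds of the tuple `a`. -/

/-- `⟨⟨h, b⟩, y⟩ ∈ F`. -/
def valueAt (F h b y : ℕ) : Fm := ex fun z => isPair z h b ⋏ pairMem z y F

/-- `F` interprets the function symbols in `f` by total functions on `A`. -/
def isFunInterp (f A F : ℕ) : Fm :=
  (allIn F fun p => ex fun h => ex fun k => ex fun b => ex fun z => exIn A fun y =>
    pairMem h k f ⋏ isFun b k A ⋏ isPair z h b ⋏ isPair p z y) ⋏
  (all fun h => all fun k => all fun b => pairMem h k f ⇾ isFun b k A ⇾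
    exIn A fun y => valueAt F h b y ⋏ all fun y' => valueAt F h b y' ⇾ y' ≐ y)

/-- `J` interprets the relation symbols in `q` by relations on `A`. -/
def isRelInterp (q A J : ℕ) : Fm :=
  allIn J fun p => ex fun R => ex fun k => ex fun a =>
    pairMem R k q ⋏ isFun a k A ⋏ isPair p R a

/-- The term `t` has the value `m` under the assignment `v`. -/
def hasValue (f A F v t m : ℕ) : Fm :=
  ex fun W => pairMem t m W ⋏ all fun s => all fun y => pairMem s y W ⇾
    (ex fun n => isTagged 0 s n ⋏ pairMem n y v) ⋎
    (ex fun h => ex fun k => ex fun g => ex fun b =>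
      pairMem h k f ⋏ isTagged₂ 1 s h g ⋏ isFun b k A ⋏
      (all fun i => all fun t' => all fun m' =>
        pairMem i t' g ⇾ pairMem i m' b ⇾ pairMem t' m' W) ⋏
      valueAt F h b y)

/-- `v'` is the assignment which sends `n` to `m` and agrees with `v` otherwise. -/
def isUpdate (v' v n m : ℕ) : Fm :=
  all fun p => p ∊ v' ⇿ (p ∊ v ⋏ neg (ex fun y => isPair p n y)) ⋎ isPair p n m

/-- The structure `(A, F, J)` satisfies the game formula `φ` under the assignment `v`. The set `W`
consists of pairs `⟨χ, w⟩` such that `χ` is satisfied under `w`. -/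
def satisfies (f q A F J φ v : ℕ) : Fm :=
  ex fun W => pairMem φ v W ⋏ all fun χ => all fun w => pairMem χ w W ⇾
    (ex fun R => ex fun k => ex fun g => ex fun a =>
      pairMem R k q ⋏ isTagged₂ 0 χ R g ⋏ isFun a k A ⋏
      (all fun i => all fun t => all fun m =>
        pairMem i t g ⇾ pairMem i m a ⇾ hasValue f A F w t m) ⋏
      pairMem R a J) ⋎
    (ex fun Φ => isTagged 1 χ Φ ⋏ allIn Φ fun ψ => pairMem ψ w W) ⋎
    (ex fun Φ => isTagged 2 χ Φ ⋏ exIn Φ fun ψ => pairMem ψ w W) ⋎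
    (ex fun n => ex fun ψ => isTagged₂ 3 χ n ψ ⋏
      exIn A fun m => ex fun w' => isUpdate w' w n m ⋏ pairMem ψ w' W) ⋎
    (ex fun n => ex fun ψ => isTagged₂ 4 χ n ψ ⋏
      allIn A fun m => ex fun w' => isUpdate w' w n m ⋏ pairMem ψ w' W)

/-- The structure `(A, F, J)` is a model of `T`. -/
def isModel (f q A F J T : ℕ) : Fm :=
  allIn T fun s => all fun D => all fun φ => all fun ψ => isSequent s D φ ψ ⇾
    all fun v => isFun v D A ⇾ satisfies f q A F J φ v ⇾ satisfies f q A F J ψ v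

/-! ## Expansions -/

/-- `(A, F, J)` is an expansion of `(A, F, I)` to a structure with relation symbols in `q`, where
`r` is the set of relation symbols of the old signature. -/
def isExpansion (r q A I J : ℕ) : Fm :=
  isRelInterp q A J ⋏
  all fun R => all fun k => all fun a => pairMem R k r ⇾ (pairMem R a J ⇿ pairMem R a I)

/-- The relations denoted in the expansion `J` by the new symbols, those in `n`, are the unions of
the relations denoted by these symbols in the elements of `N`. -/
def isUnionOf (n J N : ℕ) : Fm :=
  all fun R => all fun k => all fun a => pairMem R k n ⇾
    (pairMem R a J ⇿ exIn N fun K => pairMem R a K)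

/-- For every signature `Σ = (f, r)` and every set `n` of new relation symbols, every `Σ`-structure
`(A, F, I)` and every game theory `T` over the signature `Σ' = (f, q)`, where `q = r ∪ n`, there is
a set `M` of `Σ'`-expansions of `(A, F, I)` which are models of `T`, such that every
`Σ'`-expansion of `(A, F, I)` which is a model of `T` is the union of a set of elements of `M`. An
expansion is given by its interpretation of the relation symbols. -/
def expansionsGenerated : Fm :=
  all fun om => isOmega om ⇾
  all fun f => all fun r => all fun n => all fun q =>
    isArity om f ⇾ isArity om r ⇾ isArity om n ⇾
    noCommonSymbol f n ⇾ noCommonSymbol r n ⇾ isUnion q r n ⇾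
  all fun A => all fun F => all fun I => isFunInterp f A F ⇾ isRelInterp r A I ⇾
  all fun T => isGameTheory om f q T ⇾
  ex fun M =>
    (allIn M fun J => isExpansion r q A I J ⋏ isModel f q A F J T) ⋏
    (all fun J => isExpansion r q A I J ⇾ isModel f q A F J T ⇾
      ex fun N => sub N M ⋏ isUnionOf n J N)

end CZF

namespace CZF

/-! ## Renaming and derivability -/

/-! Derivability is replaced by truth in a Kripke model. The worlds are the prime theories over CZF,
the elements of a world are the variables modulo provable equality, and truth is membership in the
theory. By a Henkin construction (`exists_primeTheory`) truth obeys the Kripke clauses (`holds_imp`,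
`holds_all`), and a formula true in all worlds is derivable (`prf_of_holds`). It therefore suffices
to argue in an arbitrary world, where ∧, ∨ and ∃ have their usual meaning while →, ∀ and ¬ range
over all later worlds. Classical reasoning about worlds is harmless; inside a world only the axioms
are available, so that the schemes apply to definable classes (`Dfn`, `Dfn₂`) and separation to
propositions whose truth value is a set (`Small`).

Full NID is the propositional case of the generation of expansions: over the empty structure, let
the elements of X be nullary relation symbols and let a rule (a, b) be the sequent ⋀a → ⋁b. The
models are then the closed subsets (`fullNID_of_expansionsGenerated`).

Conversely, models are coded by closed sets of nodes. A node is a fact (a relation symbol with a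
tuple) or an instance (a formula from a set S closed under subformulas, with an assignment). As
there are no implications, each instance is the conjunction or the disjunction of a set of simpler
nodes (`exists_premises`). Now s ↔ ⋀z is expressed by the rules ({s}, {x}) for x ∈ z and (z, {s}),
and s ↔ ⋁z by the rules ({x}, {s}) and the non-deterministic rule ({s}, z). Agreement with the given
structure and validity of the sequents are given by rules as well. In a set closed under all of
these, the instances present are exactly those satisfied by the structure read off from its facts
(`Coherent.sat_iff`). The true nodes of any model form such a set; that they form a set at all uses
`small_sat`. A generating set of closed sets hence yields one of models
(`expansionsGenerated_of_fullNID`). -/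

/-- The environment `e` extended by a value `x` for the variable `0`. -/
def scons {D : Type*} (x : D) (e : ℕ → D) : ℕ → D
  | 0 => x
  | n + 1 => e n

infixr:67 " ∷ " => CZF.scons

theorem comp_scons {D D' : Type*} (f : D → D') (x : D) (e : ℕ → D) :
    f ∘ (x ∷ e) = f x ∷ f ∘ e := by
  funext n; cases n <;> rfl

theorem under_id : under id = id := by funext n; cases n <;> rfl

theorem under_comp (ρ σ : ℕ → ℕ) : under σ ∘ under ρ = under (σ ∘ ρ) := by
  funext n; cases n <;> rfl

theorem Fml.rename_id (φ : Fml) : φ.rename id = φ := by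
  induction φ <;> simp_all [Fml.rename, under_id]

theorem Fml.rename_rename (φ : Fml) (ρ σ : ℕ → ℕ) :
    (φ.rename ρ).rename σ = φ.rename (σ ∘ ρ) := by
  induction φ generalizing ρ σ <;> simp_all [Fml.rename, under_comp]

/-- Only finitely many variables occur in a formula. This provides fresh variables, and lets
finitely many equations justify a simultaneous replacement. -/
theorem Fml.exists_bound (φ : Fml) :
    ∃ N, ∀ ρ σ : ℕ → ℕ, (∀ n < N, ρ n = σ n) → φ.rename ρ = φ.rename σ := by
  have under_agree : ∀ {N} {ρ σ : ℕ → ℕ}, (∀ n < N, ρ n = σ n) →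
      ∀ n < N, under ρ n = under σ n := by
    intro N ρ σ h n hn
    cases n with
    | zero => rfl
    | succ n => simp [under, h n (by omega)]
  induction φ with
  | bot => exact ⟨0, fun _ _ _ => rfl⟩
  | mem x y | eq x y =>
    refine ⟨max x y + 1, fun ρ σ h => ?_⟩
    simp [Fml.rename, h x (by omega), h y (by omega)]
  | and φ ψ h₁ h₂ | or φ ψ h₁ h₂ | imp φ ψ h₁ h₂ =>
    obtain ⟨N, hN⟩ := h₁
    obtain ⟨K, hK⟩ := h₂
    refine ⟨max N K, fun ρ σ h => ?_⟩
    simp only [Fml.rename, hN ρ σ fun n hn => h n (by omega), hK ρ σ fun n hn => h n (by omega)]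
  | all φ h₁ | ex φ h₁ =>
    obtain ⟨N, hN⟩ := h₁
    exact ⟨N, fun ρ σ h => by simp only [Fml.rename, hN _ _ (under_agree h)]⟩

/-- The variable `y` does not occur freely in `φ`. -/
def Fresh (y : ℕ) (φ : Fml) : Prop :=
  ∀ ρ σ : ℕ → ℕ, (∀ n, n ≠ y → ρ n = σ n) → φ.rename ρ = φ.rename σ

theorem Fml.exists_fresh (φ : Fml) : ∃ N, ∀ y, N ≤ y → Fresh y φ := by
  obtain ⟨N, hN⟩ := φ.exists_bound
  exact ⟨N, fun y hy ρ σ h => hN ρ σ fun n hn => h n (by omega)⟩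

theorem shift_rename (φ : Fml) (ρ : ℕ → ℕ) :
    φ.shift.rename (under ρ) = (φ.rename ρ).shift := by
  simp only [Fml.shift, Fml.rename_rename]; rfl

theorem inst_rename (φ : Fml) (y : ℕ) (ρ : ℕ → ℕ) :
    (φ.inst y).rename ρ = (φ.rename (under ρ)).inst (ρ y) := by
  simp only [Fml.inst, Fml.rename_rename]
  congr 1; funext n; cases n <;> rfl

theorem IsBounded.rename {φ : Fml} (h : IsBounded φ) (ρ : ℕ → ℕ) : IsBounded (φ.rename ρ) := by
  induction h generalizing ρ with
  | bot => exact .bot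
  | mem x y => exact .mem _ _
  | eq x y => exact .eq _ _
  | and _ _ h₁ h₂ => exact .and (h₁ ρ) (h₂ ρ)
  | or _ _ h₁ h₂ => exact .or (h₁ ρ) (h₂ ρ)
  | imp _ _ h₁ h₂ => exact .imp (h₁ ρ) (h₂ ρ)
  | all y _ h => exact .all _ (h _)
  | ex y _ h => exact .ex _ (h _)

theorem under_iterate (k : ℕ) (ρ : ℕ → ℕ) (i : ℕ) :
    under^[k] ρ i = if i < k then i else ρ (i - k) + k := by
  induction k generalizing i with
  | zero => simp
  | succ k ih =>
    rw [Function.iterate_succ_apply']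
    cases i with
    | zero => simp [under]
    | succ i => simp only [under, ih]; split_ifs <;> first | omega | simp_all; omega

/-- The variables in `xs` are bound by the `d` quantifiers above, so only the parameters of `φ`
move. Hence renaming an instance of a scheme gives the instance for a renamed `φ`. -/
theorem app_rename (φ : Fml) (xs : List ℕ) (d : ℕ) (ρ : ℕ → ℕ) (h : ∀ x ∈ xs, x < d) :
    (app φ xs d).rename (under^[d] ρ) = app (φ.rename (under^[xs.length] ρ)) xs d := by
  simp only [app, Fml.rename_rename]
  congr 1
  funext i
  simp only [Function.comp, under_iterate]
  by_cases hi : i < xs.length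
  · have := h _ (List.getElem_mem hi)
    simp [hi]
    omega
  · simp [hi]
    omega

theorem Axiom.rename {φ : Fml} (h : Axiom φ) (ρ : ℕ → ℕ) : Axiom (φ.rename ρ) := by
  cases h with
  | extensionality => exact .extensionality
  | pairing => exact .pairing
  | union => exact .union
  | infinity => exact .infinity
  | setInduction φ =>
    have h₁ := app_rename φ [0] 1 ρ (by simp)
    have h₂ := app_rename φ [1] 2 ρ (by simp)
    have := Axiom.setInduction (φ.rename (under ρ))
    simp only [Function.iterate_succ_apply', Function.iterate_zero_apply, List.length] at h₁ h₂
    simp only [CZF.setInduction, impl, all, allIn, Fml.rename] at this ⊢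
    rw [h₁, h₂]
    exact this
  | separation φ hφ =>
    have h₁ := app_rename φ [2] 3 ρ (by simp)
    have := Axiom.separation (φ.rename (under ρ)) (hφ.rename _)
    simp only [Function.iterate_succ_apply', Function.iterate_zero_apply, List.length] at h₁
    simp only [CZF.separation, equi, conj, impl, ex, all, Fml.rename] at this ⊢
    rw [h₁]
    exact this
  | strongCollection φ =>
    have h₁ := app_rename φ [1, 2] 3 ρ (by simp)
    have h₂ := app_rename φ [2, 3] 4 ρ (by simp)
    have h₃ := app_rename φ [3, 2] 4 ρ (by simp)
    have := Axiom.strongCollection (φ.rename (under (under ρ)))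
    simp only [Function.iterate_succ_apply', Function.iterate_zero_apply, List.length] at h₁ h₂ h₃
    simp only [CZF.strongCollection, allIn, exIn, conj, impl, ex, all, Fml.rename] at this ⊢
    rw [h₁, h₂, h₃]
    exact this
  | subsetCollection φ =>
    have h₁ := app_rename φ [4, 5, 3] 6 ρ (by simp)
    have h₂ := app_rename φ [5, 6, 3] 7 ρ (by simp)
    have h₃ := app_rename φ [6, 5, 3] 7 ρ (by simp)
    have := Axiom.subsetCollection (φ.rename (under (under (under ρ))))
    simp only [Function.iterate_succ_apply', Function.iterate_zero_apply, List.length] at h₁ h₂ h₃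
    simp only [CZF.subsetCollection, allIn, exIn, conj, impl, ex, all, Fml.rename] at this ⊢
    rw [h₁, h₂, h₃]
    exact this

namespace Prf

theorem weaken {Γ Δ : List Fml} {φ : Fml} (h : Prf Axiom Γ φ) (hΓ : Γ ⊆ Δ) : Prf Axiom Δ φ := by
  induction h generalizing Δ with
  | axm h => exact .axm h
  | hyp h => exact .hyp (hΓ h)
  | botE _ ih => exact .botE (ih hΓ)
  | andI _ _ ih₁ ih₂ => exact .andI (ih₁ hΓ) (ih₂ hΓ)
  | andE₁ _ ih => exact .andE₁ (ih hΓ)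
  | andE₂ _ ih => exact .andE₂ (ih hΓ)
  | orI₁ _ ih => exact .orI₁ (ih hΓ)
  | orI₂ _ ih => exact .orI₂ (ih hΓ)
  | orE _ _ _ ih₁ ih₂ ih₃ =>
    exact .orE (ih₁ hΓ) (ih₂ (List.cons_subset_cons _ hΓ)) (ih₃ (List.cons_subset_cons _ hΓ))
  | impI _ ih => exact .impI (ih (List.cons_subset_cons _ hΓ))
  | impE _ _ ih₁ ih₂ => exact .impE (ih₁ hΓ) (ih₂ hΓ)
  | allI _ ih => exact .allI (ih (List.map_subset _ hΓ))
  | allE y _ ih => exact .allE y (ih hΓ)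
  | exI y _ ih => exact .exI y (ih hΓ)
  | exE _ _ ih₁ ih₂ => exact .exE (ih₁ hΓ) (ih₂ (List.cons_subset_cons _ (List.map_subset _ hΓ)))
  | eqI x => exact .eqI x
  | eqE φ _ _ ih₁ ih₂ => exact .eqE φ (ih₁ hΓ) (ih₂ hΓ)

theorem rename {Γ : List Fml} {φ : Fml} (h : Prf Axiom Γ φ) (ρ : ℕ → ℕ) :
    Prf Axiom (Γ.map (Fml.rename ρ)) (φ.rename ρ) := by
  have shift_map : ∀ (Γ : List Fml) (ρ : ℕ → ℕ), (Γ.map Fml.shift).map (Fml.rename (under ρ)) =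
      (Γ.map (Fml.rename ρ)).map Fml.shift := fun Γ ρ => by simp [shift_rename]
  induction h generalizing ρ with
  | axm h => exact .axm (h.rename ρ)
  | hyp h => exact .hyp (List.mem_map_of_mem h)
  | botE _ ih => exact .botE (ih ρ)
  | andI _ _ ih₁ ih₂ => exact .andI (ih₁ ρ) (ih₂ ρ)
  | andE₁ _ ih => exact .andE₁ (ih ρ)
  | andE₂ _ ih => exact .andE₂ (ih ρ)
  | orI₁ _ ih => exact .orI₁ (ih ρ)
  | orI₂ _ ih => exact .orI₂ (ih ρ)
  | orE _ _ _ ih₁ ih₂ ih₃ => exact .orE (ih₁ ρ) (ih₂ ρ) (ih₃ ρ)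
  | impI _ ih => exact .impI (ih ρ)
  | impE _ _ ih₁ ih₂ => exact .impE (ih₁ ρ) (ih₂ ρ)
  | allI _ ih =>
    have := ih (under ρ)
    rw [shift_map] at this
    exact .allI this
  | allE y _ ih => rw [inst_rename]; exact .allE (ρ y) (ih ρ)
  | exI y _ ih =>
    have := ih ρ
    rw [inst_rename] at this
    exact .exI (ρ y) this
  | exE _ _ ih₁ ih₂ =>
    have := ih₂ (under ρ)
    rw [List.map_cons, shift_map, shift_rename] at this
    exact .exE (ih₁ ρ) this
  | eqI x => exact .eqI _
  | eqE φ _ _ ih₁ ih₂ =>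
    have := ih₂ ρ
    rw [inst_rename] at this ⊢
    exact .eqE _ (ih₁ ρ) this

theorem cut {Γ : List Fml} {φ ψ : Fml} (h₁ : Prf Axiom Γ φ) (h₂ : Prf Axiom (φ :: Γ) ψ) :
    Prf Axiom Γ ψ :=
  .impE (.impI h₂) h₁

/-- Elimination with a named eigenvariable `y`: moving `y` to 0 and every other `n` to `n + 1` is an
ordinary shift on formulas in which `y` is not free, which brings the premise into the form required
by `exE`. -/
theorem exE_fresh {Γ : List Fml} {φ ψ : Fml} {y : ℕ} (hΓ : ∀ γ ∈ Γ, Fresh y γ)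
    (hφ : Fresh y (.ex φ)) (hψ : Fresh y ψ) (h₁ : Prf Axiom Γ (.ex φ))
    (h₂ : Prf Axiom (φ.inst y :: Γ) ψ) : Prf Axiom Γ ψ := by
  let ρ : ℕ → ℕ := fun n => if n = y then 0 else n + 1
  have hρ : ∀ n, n ≠ y → ρ n = n + 1 := fun n hn => if_neg hn
  have key : φ.rename (under (fun n => ρ n)) = φ.rename (under Nat.succ) := by
    simpa [Fml.rename] using hφ ρ Nat.succ hρ
  refine .exE h₁ ?_
  have := h₂.rename ρ
  rw [List.map_cons, inst_rename, key] at this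
  have e₁ : (φ.rename (under Nat.succ)).inst (ρ y) = φ := by
    simp only [Fml.inst, Fml.rename_rename]
    convert φ.rename_id using 2
    funext n
    cases n <;> simp [instRen, under, ρ]
  rw [e₁, hψ ρ Nat.succ hρ, List.map_congr_left fun γ hγ => hΓ γ hγ ρ Nat.succ hρ] at this
  exact this

/-- `eqE` replaces one variable at a time, so the variables are exchanged successively up to the
bound on those occurring in `φ`. -/
theorem eq_subst {Γ : List Fml} {φ : Fml} {σ τ : ℕ → ℕ}
    (h : ∀ n, Prf Axiom Γ (.eq (σ n) (τ n))) (hφ : Prf Axiom Γ (φ.rename σ)) :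
    Prf Axiom Γ (φ.rename τ) := by
  obtain ⟨N, hN⟩ := φ.exists_bound
  have : ∀ k, Prf Axiom Γ (φ.rename fun n => if n < k then τ n else σ n) := by
    intro k
    induction k with
    | zero => simpa using hφ
    | succ k ih =>
      -- `θ` reserves the index 0 for the variable `k`, at which the next replacement takes place;
      -- the variables below `k` already have their new values.
      let θ : ℕ → ℕ := fun n => if n = k then 0 else (if n < k then τ n else σ n) + 1
      have e : ∀ y, (φ.rename θ).inst y =
          φ.rename fun n => if n = k then y else if n < k then τ n else σ n := by
        intro y
        simp only [Fml.inst, Fml.rename_rename]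
        congr 1
        funext n
        simp only [Function.comp, θ]
        split_ifs <;> rfl
      have := Prf.eqE (φ.rename θ) (h k) (by
        rw [e]
        convert ih using 2
        funext n
        split_ifs <;> simp_all)
      rw [e] at this
      convert this using 2
      funext n
      split_ifs <;> first | rfl | omega | simp_all
  rw [hN τ (fun n => if n < N then τ n else σ n) fun n hn => by simp [hn]]
  exact this N

end Prf

/-! ## Prime theories -/

/-- `φ` is derivable from finitely many elements of `Δ`. -/
def Entails (Δ : Set Fml) (φ : Fml) : Prop := ∃ Γ : List Fml, (∀ γ ∈ Γ, γ ∈ Δ) ∧ Prf Axiom Γ φ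

theorem Entails.mono {Δ Δ' : Set Fml} {φ : Fml} (h : Entails Δ φ) (hΔ : Δ ⊆ Δ') :
    Entails Δ' φ :=
  let ⟨Γ, hΓ, p⟩ := h
  ⟨Γ, fun γ hγ => hΔ (hΓ γ hγ), p⟩

theorem entails_insert {Δ : Set Fml} {φ ψ : Fml} :
    Entails (insert φ Δ) ψ ↔ ∃ Γ : List Fml, (∀ γ ∈ Γ, γ ∈ Δ) ∧ Prf Axiom (φ :: Γ) ψ := by
  classical
  constructor
  · rintro ⟨Γ, hΓ, p⟩
    refine ⟨Γ.filter (· ≠ φ), fun γ hγ => ?_, p.weaken fun γ hγ => ?_⟩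
    · simp only [ne_eq, decide_not, List.mem_filter, Bool.not_eq_eq_eq_not, Bool.not_true,
        decide_eq_false_iff_not] at hγ
      exact (hΓ γ hγ.1).resolve_left hγ.2
    · by_cases h : γ = φ <;> simp [h, hγ]
  · rintro ⟨Γ, hΓ, p⟩
    refine ⟨φ :: Γ, fun γ hγ => ?_, p⟩
    rcases List.mem_cons.1 hγ with rfl | h
    · exact Or.inl rfl
    · exact Or.inr (hΓ γ h)

theorem Entails.cut {Δ : Set Fml} {φ ψ : Fml} (h₁ : Entails Δ φ) (h₂ : Entails (insert φ Δ) ψ) :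
    Entails Δ ψ := by
  obtain ⟨Γ₁, hΓ₁, p₁⟩ := h₁
  obtain ⟨Γ₂, hΓ₂, p₂⟩ := entails_insert.1 h₂
  refine ⟨Γ₁ ++ Γ₂, fun γ hγ => (List.mem_append.1 hγ).elim (hΓ₁ γ) (hΓ₂ γ), ?_⟩
  exact (p₁.weaken (List.subset_append_left _ _)).cut
    (p₂.weaken (List.cons_subset_cons _ (List.subset_append_right _ _)))

/-- A numbering of the formulas. -/
def Fml.code : Fml → ℕ
  | .bot => Nat.pair 0 0
  | .mem x y => Nat.pair 1 (Nat.pair x y)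
  | .eq x y => Nat.pair 2 (Nat.pair x y)
  | .and φ ψ => Nat.pair 3 (Nat.pair φ.code ψ.code)
  | .or φ ψ => Nat.pair 4 (Nat.pair φ.code ψ.code)
  | .imp φ ψ => Nat.pair 5 (Nat.pair φ.code ψ.code)
  | .all φ => Nat.pair 6 φ.code
  | .ex φ => Nat.pair 7 φ.code

theorem Fml.code_injective : Function.Injective Fml.code := by
  intro φ
  induction φ <;> intro ψ h <;> cases ψ <;> simp_all [Fml.code, Nat.pair_eq_pair] <;> tauto

/-- A prime theory: a set of formulas closed under derivability, which does not contain `⊥`, and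
has the disjunction property and a witness for each of its existential statements. -/
structure PrimeTheory where
  thy : Set Fml
  closed : ∀ {φ}, Entails thy φ → φ ∈ thy
  bot : .bot ∉ thy
  or : ∀ {φ ψ}, .or φ ψ ∈ thy → φ ∈ thy ∨ ψ ∈ thy
  ex : ∀ {φ}, .ex φ ∈ thy → ∃ y, φ.inst y ∈ thy

/-- A Lindenbaum–Henkin construction: run through all formulas and add each one that keeps `χ`
underivable, an existential formula together with a witness. The hypothesis on `Δ` supplies the
unused variables needed as witnesses. -/
theorem exists_primeTheory {Δ : Set Fml} {χ : Fml} (hχ : ¬ Entails Δ χ)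
    (hΔ : ∀ N, ∃ y, N ≤ y ∧ ∀ δ ∈ Δ, Fresh y δ) : ∃ P : PrimeTheory, Δ ⊆ P.thy ∧ χ ∉ P.thy := by
  classical
  have step : ∀ (L : List Fml) (θ : Fml), ∃ K : List Fml, ¬ Entails (Δ ∪ {γ | γ ∈ L}) χ →
      (¬ Entails (Δ ∪ {γ | γ ∈ K}) χ) ∧ L ⊆ K ∧
      ((¬ Entails (insert θ (Δ ∪ {γ | γ ∈ L})) χ) → θ ∈ K ∧
        ∀ φ, θ = .ex φ → ∃ y, φ.inst y ∈ K) := by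
    intro L θ
    by_cases hL : Entails (insert θ (Δ ∪ {γ | γ ∈ L})) χ
    · exact ⟨L, fun h => ⟨h, fun _ h => h, fun h => absurd hL h⟩⟩
    have ins : ∀ (α : Fml) (L : List Fml), Δ ∪ {γ | γ ∈ α :: L} = insert α (Δ ∪ {γ | γ ∈ L}) := by
      intro α L; ext γ; simp; tauto
    by_cases hθ : ∃ φ, θ = .ex φ
    · obtain ⟨φ, rfl⟩ := hθ
      have bound : ∀ L : List Fml, ∃ N, ∀ y, N ≤ y → ∀ γ ∈ L, Fresh y γ := by
        intro L
        induction L with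
        | nil => exact ⟨0, by simp⟩
        | cons α L ih =>
          obtain ⟨N, hN⟩ := ih
          obtain ⟨K, hK⟩ := α.exists_fresh
          refine ⟨max N K, fun y hy γ hγ => ?_⟩
          rcases List.mem_cons.1 hγ with rfl | h
          · exact hK y (by omega)
          · exact hN y (by omega) γ h
      obtain ⟨N, hN⟩ := bound (χ :: .ex φ :: L)
      obtain ⟨y, hy, hyΔ⟩ := hΔ N
      have hyL := hN y hy
      refine ⟨φ.inst y :: .ex φ :: L, fun _ => ⟨?_, fun γ hγ => by simp [hγ], fun _ =>
        ⟨by simp, fun ψ h => ⟨y, by cases h; simp⟩⟩⟩⟩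
      intro h
      rw [ins, entails_insert] at h
      obtain ⟨Γ, hΓ, p⟩ := h
      apply hL
      rw [← ins]
      refine ⟨.ex φ :: Γ, ?_, ?_⟩
      · intro γ hγ
        rcases List.mem_cons.1 hγ with rfl | h
        · simp
        · exact hΓ γ h
      -- The witness `y` avoids `Δ`, `L`, `χ` and the existential formula itself, so a derivation of
      -- `χ` from the instance gives one from the existential formula.
      · refine Prf.exE_fresh (y := y) ?_ (hyL _ (by simp)) (hyL _ (by simp))
          (.hyp (φ := .ex φ) (by simp))
          (p.weaken (List.cons_subset_cons _ (List.subset_cons_self _ _)))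
        intro γ hγ
        rcases List.mem_cons.1 hγ with rfl | h
        · exact hyL _ (by simp)
        · rcases hΓ γ h with h | h
          · exact hyΔ γ h
          · exact hyL γ (List.mem_cons_of_mem _ h)
    · refine ⟨θ :: L, fun _ => ⟨by rwa [ins], List.subset_cons_self _ _, fun _ =>
        ⟨by simp, fun φ h => absurd ⟨φ, h⟩ hθ⟩⟩⟩
  choose next hnext using step
  have : Countable Fml := Fml.code_injective.countable
  have : Nonempty Fml := ⟨.bot⟩
  obtain ⟨θ, hθ⟩ := exists_surjective_nat Fml
  let L : ℕ → List Fml := fun n => Nat.rec [] (fun n K => next K (θ n)) n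
  have hL : ∀ n, ¬ Entails (Δ ∪ {γ | γ ∈ L n}) χ := by
    intro n
    induction n with
    | zero => simpa [L] using hχ
    | succ n ih => exact (hnext _ _ ih).1
  have mono : ∀ {m n}, m ≤ n → L m ⊆ L n := by
    intro m n h
    induction h with
    | refl => exact fun _ h => h
    | step _ ih => exact fun γ hγ => (hnext _ _ (hL _)).2.1 (ih hγ)
  let P : Set Fml := Δ ∪ {γ | ∃ n, γ ∈ L n}
  have fin : ∀ Γ : List Fml, (∀ γ ∈ Γ, γ ∈ P) → ∃ n, ∀ γ ∈ Γ, γ ∈ Δ ∪ {γ | γ ∈ L n} := by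
    intro Γ
    induction Γ with
    | nil => simp
    | cons α Γ ih =>
      intro h
      obtain ⟨n, hn⟩ := ih fun γ hγ => h γ (List.mem_cons_of_mem _ hγ)
      rcases h α (by simp) with hα | ⟨m, hm⟩
      · refine ⟨n, fun γ hγ => ?_⟩
        rcases List.mem_cons.1 hγ with rfl | h
        · exact Or.inl hα
        · exact hn γ h
      · refine ⟨max m n, fun γ hγ => ?_⟩
        rcases List.mem_cons.1 hγ with rfl | h
        · exact Or.inr (mono (le_max_left _ _) hm)
        · exact (hn γ h).imp_right fun h => mono (le_max_right _ _) h
  have hP : ¬ Entails P χ := by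
    rintro ⟨Γ, hΓ, p⟩
    obtain ⟨n, hn⟩ := fin Γ hΓ
    exact hL n ⟨Γ, hn, p⟩
  have sub : ∀ n, Δ ∪ {γ | γ ∈ L n} ⊆ P := fun n => by
    rintro γ (h | h)
    · exact Or.inl h
    · exact Or.inr ⟨n, h⟩
  -- One visit to each formula suffices: the stage at which `φ` is treated lies inside `P`, so if
  -- `φ` does not yield `χ` over `P`, it does not at that stage either.
  have dec : ∀ φ, ¬ Entails (insert φ P) χ →
      φ ∈ P ∧ ∀ ψ, φ = .ex ψ → ∃ y, ψ.inst y ∈ P := by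
    intro φ h
    obtain ⟨n, rfl⟩ := hθ φ
    obtain ⟨h₁, h₂⟩ := (hnext (L n) (θ n) (hL n)).2.2 fun h' =>
      h (h'.mono (Set.insert_subset_insert (sub n)))
    refine ⟨Or.inr ⟨n + 1, h₁⟩, fun ψ hψ => ?_⟩
    obtain ⟨y, hy⟩ := h₂ ψ hψ
    exact ⟨y, Or.inr ⟨n + 1, hy⟩⟩
  have clo : ∀ {φ}, Entails P φ → φ ∈ P := fun h => (dec _ fun h' => hP (h.cut h')).1
  have self : ∀ {φ}, φ ∈ P → Entails P φ := fun {φ} h => ⟨[φ], by simpa using h, .hyp (by simp)⟩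
  refine ⟨⟨P, clo, fun h => ?_, fun {φ ψ} h => ?_, fun {φ} h => ?_⟩, Set.subset_union_left,
    fun h => hP (self h)⟩
  · obtain ⟨Γ, hΓ, p⟩ := self h
    exact hP ⟨Γ, hΓ, .botE p⟩
  -- A disjunct outside `P` derives `χ` over `P`. If both are outside, the disjunction derives `χ`
  -- too.
  · by_contra! hcon
    have h₁ : Entails (insert φ P) χ := by
      by_contra h
      exact hcon.1 (dec _ h).1
    have h₂ : Entails (insert ψ P) χ := by
      by_contra h
      exact hcon.2 (dec _ h).1
    obtain ⟨Γ₁, hΓ₁, p₁⟩ := entails_insert.1 h₁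
    obtain ⟨Γ₂, hΓ₂, p₂⟩ := entails_insert.1 h₂
    refine hP ⟨.or φ ψ :: (Γ₁ ++ Γ₂), ?_, .orE (φ := φ) (ψ := ψ) (.hyp (by simp))
      (p₁.weaken ?_) (p₂.weaken ?_)⟩
    · intro γ hγ
      rcases List.mem_cons.1 hγ with rfl | hγ
      · exact h
      · exact (List.mem_append.1 hγ).elim (hΓ₁ γ) (hΓ₂ γ)
    · intro γ; simp; tauto
    · intro γ; simp; tauto
  · refine (dec _ fun h' => hP ((self h).cut h')).2 φ rfl

end CZF

namespace CZF

/-! ## The Kripke model of prime theories -/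

namespace PrimeTheory

variable (P : PrimeTheory)

theorem mem_of_prf {P : PrimeTheory} {Γ : List Fml} {φ : Fml} (h : Prf Axiom Γ φ)
    (hΓ : ∀ γ ∈ Γ, γ ∈ P.thy) : φ ∈ P.thy :=
  P.closed ⟨Γ, hΓ, h⟩

theorem eq_refl (x : ℕ) : .eq x x ∈ P.thy := mem_of_prf (.eqI (Γ := []) x) (by simp)

theorem eq_symm {P : PrimeTheory} {x y : ℕ} (h : .eq x y ∈ P.thy) : .eq y x ∈ P.thy :=
  mem_of_prf (Γ := [.eq x y]) (.eqE (x := x) (y := y) (.eq 0 (x + 1)) (.hyp (by simp)) (.eqI x))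
    (by simpa using h)

theorem eq_trans {P : PrimeTheory} {x y z : ℕ} (h₁ : .eq x y ∈ P.thy) (h₂ : .eq y z ∈ P.thy) :
    .eq x z ∈ P.thy :=
  mem_of_prf (Γ := [.eq x y, .eq y z])
    (.eqE (x := y) (y := z) (.eq (x + 1) 0) (.hyp (by simp))
      (.hyp (by simp [Fml.inst, Fml.rename, instRen])))
    (by simpa using ⟨h₁, h₂⟩)

/-- Provable equality of variables in a prime theory. -/
def setoid : Setoid ℕ where
  r x y := .eq x y ∈ P.thy
  iseqv := ⟨P.eq_refl, eq_symm, eq_trans⟩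

end PrimeTheory

/-- The sets which exist in the prime theory `P`. -/
def Carrier (P : PrimeTheory) : Type := Quotient P.setoid

instance : CoeSort PrimeTheory Type := ⟨Carrier⟩

section Forcing

variable {P Q R : PrimeTheory}

/-- The set denoted by a variable. -/
def Carrier.mk (x : ℕ) : P := Quotient.mk P.setoid x

theorem Carrier.mk_eq {x y : ℕ} : (Carrier.mk x : P) = Carrier.mk y ↔ .eq x y ∈ P.thy :=
  Quotient.eq

theorem Carrier.mk_out (x : P) : Carrier.mk (Quotient.out x) = x := Quotient.out_eq _

/-- `φ` is true in `P` if its variables have the values `e`. -/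
def Holds (P : PrimeTheory) (φ : Fml) (e : ℕ → P) : Prop :=
  φ.rename (fun n => Quotient.out (e n)) ∈ P.thy

/-- Truth does not depend on the variables chosen to represent the values, since provably equal
variables are interchangeable. -/
theorem holds_iff {φ : Fml} {e : ℕ → P} {σ : ℕ → ℕ} (h : ∀ n, Carrier.mk (σ n) = e n) :
    Holds P φ e ↔ φ.rename σ ∈ P.thy := by
  have key : ∀ {σ τ : ℕ → ℕ}, (∀ n, (Carrier.mk (σ n) : P) = Carrier.mk (τ n)) →
      φ.rename σ ∈ P.thy → φ.rename τ ∈ P.thy := by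
    intro σ τ h hφ
    obtain ⟨N, hN⟩ := φ.exists_bound
    let τ' : ℕ → ℕ := fun n => if n < N then τ n else σ n
    have e₁ : φ.rename τ = φ.rename τ' := hN _ _ fun n hn => by simp [τ', hn]
    let Γ : List Fml := φ.rename σ :: (List.range N).map fun n => .eq (σ n) (τ n)
    have : Prf Axiom Γ (φ.rename τ') := by
      refine Prf.eq_subst (σ := σ) (fun n => ?_) (.hyp (by simp [Γ]))
      by_cases hn : n < N
      · simp only [τ', hn, Γ, if_true]
        exact .hyp (List.mem_cons_of_mem _ (List.mem_map.2 ⟨n, by simpa using hn, rfl⟩))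
      · simpa [τ', hn] using Prf.eqI _
    rw [e₁]
    refine PrimeTheory.mem_of_prf this fun γ hγ => ?_
    simp only [List.mem_cons, List.mem_map, Γ] at hγ
    rcases hγ with rfl | ⟨n, -, rfl⟩
    · exact hφ
    · exact Carrier.mk_eq.1 (h n)
  exact ⟨key fun n => by rw [Carrier.mk_out, h], key fun n => by rw [Carrier.mk_out, h]⟩

theorem holds_rename {φ : Fml} {ρ : ℕ → ℕ} {e : ℕ → P} :
    Holds P (φ.rename ρ) e ↔ Holds P φ (e ∘ ρ) := by
  simp only [Holds, Fml.rename_rename]; rfl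

theorem holds_mk {φ : Fml} : Holds P φ Carrier.mk ↔ φ ∈ P.thy := by
  exact (holds_iff (σ := id) fun _ => rfl).trans (by rw [φ.rename_id])

theorem holds_of_prf {Γ : List Fml} {φ : Fml} (h : Prf Axiom Γ φ) {e : ℕ → P}
    (hΓ : ∀ γ ∈ Γ, Holds P γ e) : Holds P φ e :=
  PrimeTheory.mem_of_prf (h.rename _) fun γ hγ => by
    obtain ⟨δ, hδ, rfl⟩ := List.mem_map.1 hγ
    exact hΓ δ hδ

theorem holds_axiom {φ : Fml} (h : Axiom φ) (e : ℕ → P) : Holds P φ e :=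
  holds_of_prf (Γ := []) (.axm h) (by simp)

/-- A map between the sets of two prime theories which preserves truth. -/
structure Hom (P Q : PrimeTheory) where
  toFun : P → Q
  map : ∀ {φ e}, Holds P φ e → Holds Q φ (toFun ∘ e)

infixr:10 " ⇛ " => CZF.Hom

instance : CoeFun (P ⇛ Q) fun _ => P → Q := ⟨Hom.toFun⟩

/-- The identity. -/
def Hom.refl (P : PrimeTheory) : P ⇛ P := ⟨id, id⟩

/-- The composition of two truth-preserving maps, the first one written first. -/
def Hom.trans (f : P ⇛ Q) (g : Q ⇛ R) : P ⇛ R := ⟨g ∘ f, fun h => g.map (f.map h)⟩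

/-- Later worlds arise along renamings and not only inclusions: the old variables have to make room
for new ones. -/
theorem exists_hom {ρ : ℕ → ℕ} (h : ∀ γ ∈ P.thy, γ.rename ρ ∈ Q.thy) :
    ∃ f : P ⇛ Q, ∀ x, f (Carrier.mk x) = Carrier.mk (ρ x) := by
  let f : P → Q := Quotient.lift (fun x => Carrier.mk (ρ x)) fun x y hxy =>
    Carrier.mk_eq.2 (h _ hxy)
  refine ⟨⟨f, fun {φ e} hφ => ?_⟩, fun x => rfl⟩
  have := h _ hφ
  rw [Fml.rename_rename] at this
  refine (holds_iff fun n => ?_).2 this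
  simp only [Function.comp]
  conv_rhs => rw [← Carrier.mk_out (e n)]
  rfl

/-- A prime theory may use all variables. Doubling them leaves the odd ones free as witnesses in an
extension. -/
theorem fresh_odd (φ : Fml) (k : ℕ) : Fresh (2 * k + 1) (φ.rename (2 * ·)) := by
  intro ρ σ h
  simp only [Fml.rename_rename]
  congr 1
  funext n
  exact h _ (by simp only []; omega)

theorem holds_bot {e : ℕ → P} : ¬ Holds P .bot e := P.bot

instance : Membership P P := ⟨fun y x => .mem (Quotient.out x) (Quotient.out y) ∈ P.thy⟩

theorem holds_mem {x y : ℕ} {e : ℕ → P} : Holds P (.mem x y) e ↔ e x ∈ e y := Iff.rfl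

theorem holds_eq {x y : ℕ} {e : ℕ → P} : Holds P (.eq x y) e ↔ e x = e y := by
  conv_rhs => rw [← Carrier.mk_out (e x), ← Carrier.mk_out (e y), Carrier.mk_eq]
  rfl

theorem holds_and {φ ψ : Fml} {e : ℕ → P} :
    Holds P (.and φ ψ) e ↔ Holds P φ e ∧ Holds P ψ e := by
  refine ⟨fun h => ⟨?_, ?_⟩, fun h => ?_⟩
  · exact holds_of_prf (Γ := [.and φ ψ]) (.andE₁ (ψ := ψ) (.hyp (by simp))) (by simpa using h)
  · exact holds_of_prf (Γ := [.and φ ψ]) (.andE₂ (φ := φ) (.hyp (by simp))) (by simpa using h)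
  · exact holds_of_prf (Γ := [φ, ψ]) (.andI (.hyp (by simp)) (.hyp (by simp))) (by simpa using h)

theorem holds_or {φ ψ : Fml} {e : ℕ → P} :
    Holds P (.or φ ψ) e ↔ Holds P φ e ∨ Holds P ψ e := by
  refine ⟨P.or, fun h => ?_⟩
  rcases h with h | h
  · exact holds_of_prf (Γ := [φ]) (.orI₁ (.hyp (by simp))) (by simpa using h)
  · exact holds_of_prf (Γ := [ψ]) (.orI₂ (.hyp (by simp))) (by simpa using h)

theorem holds_inst {φ : Fml} {y : ℕ} {ρ : ℕ → ℕ} {e : ℕ → P} (h : ∀ n, Carrier.mk (ρ n) = e n) :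
    (φ.rename (under ρ)).inst y ∈ P.thy ↔ Holds P φ (Carrier.mk y ∷ e) := by
  rw [Fml.inst, Fml.rename_rename]
  refine (holds_iff fun n => ?_).symm
  cases n with
  | zero => rfl
  | succ n => exact h n

theorem holds_ex {φ : Fml} {e : ℕ → P} : Holds P (.ex φ) e ↔ ∃ x : P, Holds P φ (x ∷ e) := by
  constructor
  · intro h
    obtain ⟨y, hy⟩ := P.ex h
    exact ⟨_, (holds_inst fun n => Carrier.mk_out _).1 hy⟩
  · rintro ⟨x, hx⟩
    rw [← Carrier.mk_out x] at hx
    have := (holds_inst fun n => Carrier.mk_out _).2 hx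
    exact PrimeTheory.mem_of_prf (Γ := [_]) (.exI _ (.hyp List.mem_cons_self))
      (List.forall_mem_singleton.2 this)

/-- If the implication fails, then the theory with `φ` added does not derive `ψ`; a prime extension
of a renamed copy that avoids `ψ` is the refuting later world. -/
theorem holds_imp {φ ψ : Fml} {e : ℕ → P} :
    Holds P (.imp φ ψ) e ↔ ∀ Q (f : P ⇛ Q), Holds Q φ (f ∘ e) → Holds Q ψ (f ∘ e) := by
  constructor
  · intro h Q f hφ
    refine holds_of_prf (Γ := [.imp φ ψ, φ]) (.impE (φ := φ) (.hyp (by simp)) (.hyp (by simp))) ?_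
    simpa using ⟨f.map h, hφ⟩
  · intro h
    by_contra hcon
    let ρ : ℕ → ℕ := fun n => Quotient.out (e n)
    let Δ : Set Fml := Fml.rename (2 * ·) '' insert (φ.rename ρ) P.thy
    have hχ : ¬ Entails Δ ((ψ.rename ρ).rename (2 * ·)) := by
      rintro ⟨Γ, hΓ, p⟩
      have back : ∀ φ : Fml, (φ.rename (2 * ·)).rename (· / 2) = φ := fun φ => by
        rw [Fml.rename_rename]
        convert φ.rename_id using 2
        funext n
        simp
      have := p.rename (· / 2)
      rw [back] at this
      refine hcon ?_
      have ent : Entails (insert (φ.rename ρ) P.thy) (ψ.rename ρ) := by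
        refine ⟨_, fun γ hγ => ?_, this⟩
        obtain ⟨δ, hδ, rfl⟩ := List.mem_map.1 hγ
        obtain ⟨ε, hε, rfl⟩ := hΓ δ hδ
        rwa [back]
      obtain ⟨Γ', hΓ', p'⟩ := entails_insert.1 ent
      exact PrimeTheory.mem_of_prf (.impI p') hΓ'
    obtain ⟨Q, hQ, hψ⟩ := exists_primeTheory hχ fun N =>
      ⟨2 * N + 1, by omega, by rintro _ ⟨δ, -, rfl⟩; exact fresh_odd _ _⟩
    obtain ⟨f, hf⟩ := exists_hom (P := P) (Q := Q) (ρ := (2 * ·)) fun γ hγ =>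
      hQ ⟨γ, Or.inr hγ, rfl⟩
    have hval : ∀ n, Carrier.mk (2 * ρ n) = f (e n) := fun n => by rw [← hf, Carrier.mk_out]
    rw [Fml.rename_rename] at hψ
    refine hψ ((holds_iff hval).1 (h Q f ((holds_iff hval).2 ?_)))
    have := hQ ⟨_, Or.inl rfl, rfl⟩
    rwa [Fml.rename_rename] at this

/-- If the universal statement fails, an unused variable is a generic counterexample: a derivation
for it could be generalised. -/
theorem holds_all {φ : Fml} {e : ℕ → P} :
    Holds P (.all φ) e ↔ ∀ Q (f : P ⇛ Q) (x : Q), Holds Q φ (x ∷ f ∘ e) := by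
  constructor
  · intro h Q f x
    have := f.map h
    rw [← Carrier.mk_out x]
    refine (holds_inst fun n => Carrier.mk_out _).1 ?_
    exact PrimeTheory.mem_of_prf (Γ := [_]) (.allE _ (.hyp List.mem_cons_self))
      (List.forall_mem_singleton.2 this)
  · intro h
    by_contra hcon
    let ρ : ℕ → ℕ := fun n => Quotient.out (e n)
    let Δ : Set Fml := Fml.rename (2 * ·) '' P.thy
    -- After doubling, the odd variable 1 is unused and serves as the generic element.
    have hχ : ¬ Entails Δ (φ.rename (1 ∷ fun n => 2 * ρ n)) := by
      rintro ⟨Γ, hΓ, p⟩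
      -- `τ` undoes the doubling up to a shift and sends the generic variable to 0, which is the
      -- form needed for `allI`.
      let τ : ℕ → ℕ := fun n => if n % 2 = 0 then n / 2 + 1 else 0
      have back : ∀ φ : Fml, (φ.rename (2 * ·)).rename τ = φ.shift := fun φ => by
        rw [Fml.rename_rename]
        refine congrArg (fun ρ => φ.rename ρ) (funext fun n => ?_)
        simp [τ]
      have := p.rename τ
      refine hcon (P.closed (φ := .all _) ?_)
      refine ⟨Γ.map (Fml.rename (· / 2)), fun γ hγ => ?_, .allI ?_⟩
      · obtain ⟨δ, hδ, rfl⟩ := List.mem_map.1 hγ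
        obtain ⟨ε, hε, rfl⟩ := hΓ δ hδ
        rw [Fml.rename_rename]
        convert hε
        convert ε.rename_id using 2
        funext n
        simp
      · convert this using 1
        · rw [List.map_map]
          refine List.map_congr_left fun γ hγ => ?_
          obtain ⟨ε, hε, rfl⟩ := hΓ γ hγ
          rw [back]
          simp only [Function.comp, Fml.rename_rename, Fml.shift]
          congr 1
          funext n
          simp
        · rw [Fml.rename_rename]
          congr 1
          funext n
          cases n with
          | zero => rfl
          | succ n => simp [τ, scons, under, ρ]
    obtain ⟨Q, hQ, hψ⟩ := exists_primeTheory hχ fun N =>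
      ⟨2 * N + 1, by omega, by rintro _ ⟨δ, -, rfl⟩; exact fresh_odd _ _⟩
    obtain ⟨f, hf⟩ := exists_hom (P := P) (Q := Q) (ρ := (2 * ·)) fun γ hγ =>
      hQ ⟨γ, hγ, rfl⟩
    refine hψ ((holds_iff fun n => ?_).1 (h Q f (Carrier.mk 1)))
    cases n with
    | zero => rfl
    | succ n => exact (hf _).symm.trans (congrArg f (Carrier.mk_out _))

/-- Completeness: an underivable formula is avoided by some prime theory, in which it fails when
each variable denotes itself. -/
theorem prf_of_holds {φ : Fml} (h : ∀ P (e : ℕ → Carrier P), Holds P φ e) : Prf Axiom [] φ := by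
  by_contra hcon
  obtain ⟨P, -, hP⟩ := exists_primeTheory (Δ := ∅) (χ := φ)
    (by
      rintro ⟨Γ, hΓ, p⟩
      obtain rfl : Γ = [] := List.eq_nil_iff_forall_not_mem.2 hΓ
      exact hcon p)
    fun N => ⟨N, le_rfl, by simp⟩
  exact hP (holds_mk.1 (h P _))

end Forcing

end CZF

namespace CZF

/-! ### Kripke truth of formulas with named variables -/

section Evaluation

variable {P Q R : PrimeTheory}

theorem Hom.mem (f : P ⇛ Q) {x y : P} (h : x ∈ y) : f x ∈ f y :=
  f.map (φ := .mem 0 1) (e := x ∷ fun _ => y) h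

/-- The truth of a formula with named variables at depth `d`. -/
def Ev (φ : Fm) (d : ℕ) (e : ℕ → P) : Prop := Holds P (φ d) e

/-- The value of the variable of level `x` at depth `d`. -/
def lk (d : ℕ) (e : ℕ → P) (x : ℕ) : P := e (d - 1 - x)

@[simp] theorem lk_old {d x : ℕ} {e : ℕ → P} {a : P} (h : x < d) :
    lk (d + 1) (a ∷ e) x = lk d e x := by
  have : d + 1 - 1 - x = (d - 1 - x) + 1 := by omega
  simp only [lk, this]; rfl

@[simp] theorem lk_new {d : ℕ} {e : ℕ → P} {a : P} : lk (d + 1) (a ∷ e) d = a := by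
  have : d + 1 - 1 - d = 0 := by omega
  simp only [lk, this]; rfl

@[simp] theorem lk_comp {d x : ℕ} {e : ℕ → P} {f : P ⇛ Q} : lk d (f ∘ e) x = f (lk d e x) := rfl

theorem Ev.up {φ : Fm} {d : ℕ} {e : ℕ → P} (h : Ev φ d e) (f : P ⇛ Q) : Ev φ d (f ∘ e) := f.map h

variable {φ ψ χ : Fm} {d x y a : ℕ} {e : ℕ → P}

@[simp] theorem ev_fal : ¬ Ev fal d e := holds_bot

@[simp] theorem ev_mem : Ev (x ∊ y) d e ↔ lk d e x ∈ lk d e y := Iff.rfl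

@[simp] theorem ev_eq : Ev (x ≐ y) d e ↔ lk d e x = lk d e y := holds_eq

@[simp] theorem ev_conj : Ev (φ ⋏ ψ) d e ↔ Ev φ d e ∧ Ev ψ d e := holds_and

@[simp] theorem ev_disj : Ev (φ ⋎ ψ) d e ↔ Ev φ d e ∨ Ev ψ d e := holds_or

@[simp] theorem ev_impl :
    Ev (φ ⇾ ψ) d e ↔ ∀ Q (f : P ⇛ Q), Ev φ d (f ∘ e) → Ev ψ d (f ∘ e) := holds_imp

@[simp] theorem ev_ex {φ : ℕ → Fm} : Ev (ex φ) d e ↔ ∃ x : P, Ev (φ d) (d + 1) (x ∷ e) := holds_ex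

theorem ev_all {φ : ℕ → Fm} :
    Ev (all φ) d e ↔ ∀ Q (f : P ⇛ Q) (x : Q), Ev (φ d) (d + 1) (x ∷ f ∘ e) := holds_all

@[simp] theorem ev_equi :
    Ev (φ ⇿ ψ) d e ↔ ∀ Q (f : P ⇛ Q), (Ev φ d (f ∘ e) ↔ Ev ψ d (f ∘ e)) := by
  simp only [equi, ev_conj, ev_impl]
  exact ⟨fun h Q f => ⟨h.1 Q f, h.2 Q f⟩, fun h => ⟨fun Q f => (h Q f).1, fun Q f => (h Q f).2⟩⟩

/-- Read literally, the clauses move to a later world twice, for the quantifier and for the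
implication. Composing the two moves, or taking the second to be the identity, leaves one. The
variants below serve the other prefixes in the same way. -/
theorem ev_all_imp {φ ψ : ℕ → Fm} : Ev (all fun x => φ x ⇾ ψ x) d e ↔
    ∀ Q (f : P ⇛ Q) (x : Q), Ev (φ d) (d + 1) (x ∷ f ∘ e) → Ev (ψ d) (d + 1) (x ∷ f ∘ e) := by
  simp only [ev_all, ev_impl]
  refine ⟨fun h Q f x hx => h Q f x Q (.refl Q) hx, fun h Q f x R g hx => ?_⟩
  rw [comp_scons] at hx ⊢
  exact h R (f.trans g) (g x) hx

theorem ev_all_iff {φ ψ : ℕ → Fm} : Ev (all fun x => φ x ⇿ ψ x) d e ↔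
    ∀ Q (f : P ⇛ Q) (x : Q), (Ev (φ d) (d + 1) (x ∷ f ∘ e) ↔ Ev (ψ d) (d + 1) (x ∷ f ∘ e)) := by
  simp only [ev_all, ev_equi]
  refine ⟨fun h Q f x => h Q f x Q (.refl Q), fun h Q f x R g => ?_⟩
  rw [comp_scons]
  exact h R (f.trans g) (g x)

theorem ev_all₂ {φ : ℕ → ℕ → Fm} : Ev (all fun x => all fun y => φ x y) d e ↔
    ∀ Q (f : P ⇛ Q) (x y : Q), Ev (φ d (d + 1)) (d + 2) (y ∷ x ∷ f ∘ e) := by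
  simp only [ev_all]
  refine ⟨fun h Q f x y => h Q f x Q (.refl Q) y, fun h Q f x R g y => ?_⟩
  rw [comp_scons]
  exact h R (f.trans g) (g x) y

theorem ev_all₃ {φ : ℕ → ℕ → ℕ → Fm} :
    Ev (all fun x => all fun y => all fun z => φ x y z) d e ↔
    ∀ Q (f : P ⇛ Q) (x y z : Q), Ev (φ d (d + 1) (d + 2)) (d + 3) (z ∷ y ∷ x ∷ f ∘ e) := by
  rw [ev_all₂]
  simp only [ev_all]
  refine ⟨fun h Q f x y z => h Q f x y Q (.refl Q) z, fun h Q f x y R g z => ?_⟩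
  rw [comp_scons, comp_scons]
  exact h R (f.trans g) (g x) (g y) z

theorem ev_imp₂ : Ev (φ ⇾ ψ ⇾ χ) d e ↔
    ∀ Q (f : P ⇛ Q), Ev φ d (f ∘ e) → Ev ψ d (f ∘ e) → Ev χ d (f ∘ e) := by
  simp only [ev_impl]
  exact ⟨fun h Q f h₁ h₂ => h Q f h₁ Q (.refl Q) h₂,
    fun h Q f h₁ R g h₂ => h R (f.trans g) (h₁.up g) h₂⟩

theorem ev_all₂_imp {φ ψ : ℕ → ℕ → Fm} : Ev (all fun x => all fun y => φ x y ⇾ ψ x y) d e ↔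
    ∀ Q (f : P ⇛ Q) (x y : Q), Ev (φ d (d + 1)) (d + 2) (y ∷ x ∷ f ∘ e) →
      Ev (ψ d (d + 1)) (d + 2) (y ∷ x ∷ f ∘ e) := by
  simp only [ev_all₂, ev_impl]
  refine ⟨fun h Q f x y hx => h Q f x y Q (.refl Q) hx, fun h Q f x y R g hx => ?_⟩
  rw [comp_scons, comp_scons] at hx ⊢
  exact h R (f.trans g) (g x) (g y) hx

theorem ev_all₃_imp {φ ψ : ℕ → ℕ → ℕ → Fm} :
    Ev (all fun x => all fun y => all fun z => φ x y z ⇾ ψ x y z) d e ↔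
    ∀ Q (f : P ⇛ Q) (x y z : Q), Ev (φ d (d + 1) (d + 2)) (d + 3) (z ∷ y ∷ x ∷ f ∘ e) →
      Ev (ψ d (d + 1) (d + 2)) (d + 3) (z ∷ y ∷ x ∷ f ∘ e) := by
  simp only [ev_all₃, ev_impl]
  refine ⟨fun h Q f x y z hx => h Q f x y z Q (.refl Q) hx, fun h Q f x y z R g hx => ?_⟩
  rw [comp_scons, comp_scons, comp_scons] at hx ⊢
  exact h R (f.trans g) (g x) (g y) (g z) hx

theorem ev_all₂_imp₂ {φ ψ χ : ℕ → ℕ → Fm} :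
    Ev (all fun x => all fun y => φ x y ⇾ ψ x y ⇾ χ x y) d e ↔
    ∀ Q (f : P ⇛ Q) (x y : Q), Ev (φ d (d + 1)) (d + 2) (y ∷ x ∷ f ∘ e) →
      Ev (ψ d (d + 1)) (d + 2) (y ∷ x ∷ f ∘ e) → Ev (χ d (d + 1)) (d + 2) (y ∷ x ∷ f ∘ e) := by
  simp only [ev_all₂, ev_imp₂]
  refine ⟨fun h Q f x y => h Q f x y Q (.refl Q), fun h Q f x y R g => ?_⟩
  rw [comp_scons, comp_scons]
  exact h R (f.trans g) (g x) (g y)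

theorem ev_all₃_imp₂ {φ ψ χ : ℕ → ℕ → ℕ → Fm} :
    Ev (all fun x => all fun y => all fun z => φ x y z ⇾ ψ x y z ⇾ χ x y z) d e ↔
    ∀ Q (f : P ⇛ Q) (x y z : Q), Ev (φ d (d + 1) (d + 2)) (d + 3) (z ∷ y ∷ x ∷ f ∘ e) →
      Ev (ψ d (d + 1) (d + 2)) (d + 3) (z ∷ y ∷ x ∷ f ∘ e) →
      Ev (χ d (d + 1) (d + 2)) (d + 3) (z ∷ y ∷ x ∷ f ∘ e) := by
  simp only [ev_all₃, ev_imp₂]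
  refine ⟨fun h Q f x y z => h Q f x y z Q (.refl Q), fun h Q f x y z R g => ?_⟩
  rw [comp_scons, comp_scons, comp_scons]
  exact h R (f.trans g) (g x) (g y) (g z)

@[simp] theorem ev_exIn {φ : ℕ → Fm} (ha : a < d) : Ev (exIn a φ) d e ↔
    ∃ x ∈ lk d e a, Ev (φ d) (d + 1) (x ∷ e) := by
  simp [exIn, ha]

theorem ev_allIn {φ : ℕ → Fm} (ha : a < d) : Ev (allIn a φ) d e ↔
    ∀ Q (f : P ⇛ Q) (x : Q), x ∈ f (lk d e a) → Ev (φ d) (d + 1) (x ∷ f ∘ e) := by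
  simp [allIn, ha, ev_all_imp]

@[simp] theorem ev_neg : Ev (neg φ) d e ↔ ∀ Q (f : P ⇛ Q), ¬ Ev φ d (f ∘ e) := by
  simp only [neg, ev_impl, ev_fal, imp_false]

/-! ## Definable classes and the axioms -/

/-- A class of sets in the worlds above `P`. -/
abbrev Cls (P : PrimeTheory) := ∀ ⦃Q : PrimeTheory⦄, (P ⇛ Q) → Q → Prop

/-- A binary relation between sets in the worlds above `P`. -/
abbrev Rel (P : PrimeTheory) := ∀ ⦃Q : PrimeTheory⦄, (P ⇛ Q) → Q → Q → Prop

/-- A class which is defined by a formula with parameters in `P`. -/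
def Dfn (p : Cls P) : Prop :=
  ∃ (φ : Fml) (e : ℕ → P), ∀ ⦃Q⦄ (f : P ⇛ Q) (x : Q), p f x ↔ Holds Q φ (x ∷ f ∘ e)

/-- A relation which is defined by a formula with parameters in `P`. -/
def Dfn₂ (p : Rel P) : Prop :=
  ∃ (φ : Fml) (e : ℕ → P), ∀ ⦃Q⦄ (f : P ⇛ Q) (x y : Q), p f x y ↔ Holds Q φ (x ∷ y ∷ f ∘ e)

theorem Dfn.of (φ : Fm) (d : ℕ) (e : ℕ → P) {p : Cls P}
    (h : ∀ ⦃Q⦄ (f : P ⇛ Q) (x : Q), p f x ↔ Ev φ (d + 1) (x ∷ f ∘ e)) : Dfn p :=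
  ⟨φ (d + 1), e, h⟩

/-- The order of the first two values of an environment is exchanged. -/
def swap : ℕ → ℕ
  | 0 => 1
  | 1 => 0
  | n + 2 => n + 2

/-- The variable bound last stands first in the environment, whereas `Dfn₂` puts `x` before `y`;
hence the swap. -/
theorem Dfn₂.of (φ : Fm) (d : ℕ) (e : ℕ → P) {p : Rel P}
    (h : ∀ ⦃Q⦄ (f : P ⇛ Q) (x y : Q), p f x y ↔ Ev φ (d + 2) (y ∷ x ∷ f ∘ e)) : Dfn₂ p := by
  refine ⟨(φ (d + 2)).rename swap, e, fun Q f x y => (h f x y).trans ?_⟩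
  rw [holds_rename]
  have : (x ∷ y ∷ f ∘ e) ∘ swap = y ∷ x ∷ f ∘ e := by
    funext n
    match n with
    | 0 | 1 | n + 2 => rfl
  rw [this]
  rfl

/-- The class `p` is a set. -/
def IsSet (p : Cls P) : Prop := ∃ b : P, ∀ ⦃Q⦄ (f : P ⇛ Q) (x : Q), x ∈ f b ↔ p f x

theorem ext {a b : P} (h : ∀ ⦃Q⦄ (f : P ⇛ Q) (x : Q), x ∈ f a ↔ x ∈ f b) : a = b := by
  have := holds_axiom .extensionality (fun _ => a)
  change Ev extensionality 0 _ at this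
  rw [extensionality, ev_all₂_imp] at this
  simpa using this P (.refl P) a b (by simpa [ev_all_iff] using h)

theorem isSet_upair (a b : P) : IsSet fun _ f x => x = f a ∨ x = f b := by
  have := holds_axiom .pairing (fun _ => a)
  change Ev pairing 0 _ at this
  rw [pairing, ev_all₂] at this
  simpa [IsSet, ev_all_iff] using this P (.refl P) a b

theorem isSet_sUnion (a : P) : IsSet fun _ f x => ∃ y ∈ f a, x ∈ y := by
  have := holds_axiom .union (fun _ => a)
  change Ev union 0 _ at this
  rw [union, ev_all] at this
  simpa [IsSet, ev_all_iff] using this P (.refl P) a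

theorem ev_app {φ : Fml} {xs : List ℕ} : Ev (app φ xs) d e ↔
    Holds P φ (fun i => if i < xs.length then lk d e (xs.getD i 0) else e (i - xs.length + d)) := by
  simp only [Ev, app, holds_rename]
  refine iff_of_eq (congrArg _ (funext fun i => ?_))
  simp only [Function.comp, lk]
  split_ifs
  · rfl
  · rw [add_comm]

theorem ev_app₁ {φ : Fml} : Ev (app φ [x]) d e ↔
    Holds P φ (lk d e x ∷ fun i => e (i + d)) := by
  rw [ev_app]
  refine iff_of_eq (congrArg _ (funext fun i => ?_))
  match i with
  | 0 | i + 1 => simp [scons]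

theorem ev_app₂ {φ : Fml} : Ev (app φ [x, y]) d e ↔
    Holds P φ (lk d e x ∷ lk d e y ∷ fun i => e (i + d)) := by
  rw [ev_app]
  refine iff_of_eq (congrArg _ (funext fun i => ?_))
  match i with
  | 0 | 1 | i + 2 => simp [scons]

theorem ev_app₃ {φ : Fml} {z : ℕ} : Ev (app φ [x, y, z]) d e ↔
    Holds P φ (lk d e x ∷ lk d e y ∷ lk d e z ∷ fun i => e (i + d)) := by
  rw [ev_app]
  refine iff_of_eq (congrArg _ (funext fun i => ?_))
  match i with
  | 0 | 1 | 2 | i + 3 => simp [scons]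

theorem set_induction {p : Cls P} (hp : Dfn p)
    (h : ∀ ⦃Q⦄ (f : P ⇛ Q) (a : Q), (∀ ⦃R⦄ (g : Q ⇛ R) (x : R), x ∈ g a → p (f.trans g) x) →
      p f a) (a : P) : p (.refl P) a := by
  obtain ⟨φ, e, hφ⟩ := hp
  have := holds_axiom (.setInduction φ) e
  change Ev (setInduction φ) 0 _ at this
  simp only [setInduction, ev_impl] at this
  have := this P (.refl P) (by
    rw [ev_all_imp]
    intro Q f a ha
    rw [ev_app₁]
    refine (hφ f a).1 (h f a fun R g x hx => ?_)
    rw [ev_allIn (by omega)] at ha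
    have := ha R g x hx
    rw [ev_app₁] at this
    exact (hφ _ _).2 this)
  rw [ev_all] at this
  have := this P (.refl P) a
  rw [ev_app₁] at this
  exact (hφ _ _).2 this

theorem bounded_separation {φ : Fml} (hφ : IsBounded φ) (a : P) (e : ℕ → P) :
    IsSet fun Q f x => x ∈ f a ∧ Holds Q φ (x ∷ f ∘ e) := by
  have := holds_axiom (.separation φ hφ) e
  change Ev (separation φ) 0 _ at this
  rw [separation, ev_all] at this
  obtain ⟨b, hb⟩ := ev_ex.1 (this P (.refl P) a)
  rw [ev_all_iff] at hb
  refine ⟨b, fun Q f x => (hb Q f x).trans ?_⟩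
  rw [ev_conj, ev_app₁]
  rfl

theorem collection {p : Rel P} (hp : Dfn₂ p) {a : P}
    (h : ∀ ⦃Q⦄ (f : P ⇛ Q), ∀ x ∈ f a, ∃ y, p f x y) :
    ∃ b : P, (∀ ⦃Q⦄ (f : P ⇛ Q), ∀ x ∈ f a, ∃ y ∈ f b, p f x y) ∧
      ∀ ⦃Q⦄ (f : P ⇛ Q), ∀ y ∈ f b, ∃ x ∈ f a, p f x y := by
  obtain ⟨φ, e, hφ⟩ := hp
  have := holds_axiom (.strongCollection φ) e
  change Ev (strongCollection φ) 0 _ at this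
  rw [strongCollection, ev_all_imp] at this
  have := this P (.refl P) a (by
    rw [ev_allIn (by omega)]
    intro Q f x hx
    obtain ⟨y, hy⟩ := h f x hx
    refine ev_ex.2 ⟨y, ?_⟩
    rw [ev_app₂]
    exact (hφ f x y).1 hy)
  obtain ⟨b, hb⟩ := ev_ex.1 this
  rw [ev_conj, ev_allIn (by omega), ev_allIn (by omega)] at hb
  refine ⟨b, fun Q f x hx => ?_, fun Q f y hy => ?_⟩
  · have := hb.1 Q f x hx
    rw [ev_exIn (by omega)] at this
    obtain ⟨y, hy, h⟩ := this
    rw [ev_app₂] at h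
    exact ⟨y, hy, (hφ f x y).2 h⟩
  · have := hb.2 Q f y hy
    rw [ev_exIn (by omega)] at this
    obtain ⟨x, hx, h⟩ := this
    rw [ev_app₂] at h
    exact ⟨x, hx, (hφ f x y).2 h⟩

theorem subset_collection (φ : Fml) (e : ℕ → P) (a b : P) : ∃ c : P,
    ∀ ⦃Q⦄ (f : P ⇛ Q) (u : Q),
      (∀ ⦃R⦄ (g : Q ⇛ R), ∀ x ∈ g (f a), ∃ y ∈ g (f b), Holds R φ (x ∷ y ∷ g u ∷ g ∘ f ∘ e)) →
      ∃ d ∈ f c,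
        (∀ ⦃R⦄ (g : Q ⇛ R), ∀ x ∈ g (f a), ∃ y ∈ g d, Holds R φ (x ∷ y ∷ g u ∷ g ∘ f ∘ e)) ∧
        ∀ ⦃R⦄ (g : Q ⇛ R), ∀ y ∈ g d, ∃ x ∈ g (f a), Holds R φ (x ∷ y ∷ g u ∷ g ∘ f ∘ e) := by
  have := holds_axiom (.subsetCollection φ) e
  change Ev (subsetCollection φ) 0 _ at this
  rw [subsetCollection, ev_all₂] at this
  obtain ⟨c, hc⟩ := ev_ex.1 (this P (.refl P) a b)
  rw [ev_all_imp] at hc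
  refine ⟨c, fun Q f u h => ?_⟩
  have := hc Q f u (by
    rw [ev_allIn (by omega)]
    intro R g x hx
    rw [ev_exIn (by omega)]
    obtain ⟨y, hy, h⟩ := h g x hx
    exact ⟨y, hy, ev_app₃.2 h⟩)
  rw [ev_exIn (by omega)] at this
  obtain ⟨v, hv, h⟩ := this
  rw [ev_conj, ev_allIn (by omega), ev_allIn (by omega)] at h
  refine ⟨v, hv, fun R g x hx => ?_, fun R g y hy => ?_⟩
  · have := h.1 R g x hx
    rw [ev_exIn (by omega)] at this
    obtain ⟨y, hy, h⟩ := this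
    rw [ev_app₃] at h
    exact ⟨y, hy, h⟩
  · have := h.2 R g y hy
    rw [ev_exIn (by omega)] at this
    obtain ⟨x, hx, h⟩ := this
    rw [ev_app₃] at h
    exact ⟨x, hx, h⟩

end Evaluation

end CZF

namespace CZF

section SetTheory

variable {P Q R : PrimeTheory}

/-! ## Elementary operations on sets -/

/-- The set with the elements given by a class. -/
noncomputable def IsSet.set {p : Cls P} (h : IsSet p) : P := h.choose

theorem IsSet.mem_map {p : Cls P} (h : IsSet p) (f : P ⇛ Q) {x : Q} : x ∈ f h.set ↔ p f x :=
  h.choose_spec f x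

theorem IsSet.mem {p : Cls P} (h : IsSet p) {x : P} : x ∈ h.set ↔ p (.refl P) x :=
  h.choose_spec (.refl P) x

theorem IsSet.congr {p q : Cls P} (h : IsSet p) (hpq : ∀ ⦃Q⦄ (f : P ⇛ Q) (x : Q), q f x ↔ p f x) :
    IsSet q :=
  ⟨h.set, fun _ f x => (h.mem_map f).trans (hpq f x).symm⟩

theorem isSet_false : IsSet (P := P) fun _ _ _ => False :=
  (bounded_separation .bot (Carrier.mk 0 : P) fun _ => Carrier.mk 0).congr fun _ _ _ =>
    ⟨False.elim, fun h => (holds_bot h.2).elim⟩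

noncomputable instance : EmptyCollection P := ⟨(isSet_false (P := P)).set⟩

@[simp] theorem not_mem_empty (x : P) : x ∉ (∅ : P) := (isSet_false (P := P)).mem.1

@[simp] theorem map_empty (f : P ⇛ Q) : f ∅ = ∅ :=
  ext fun _ g _ => iff_of_false ((isSet_false (P := P)).mem_map (f.trans g)).1
    ((isSet_false (P := Q)).mem_map g).1

noncomputable def upair (a b : P) : P := (isSet_upair a b).set

@[simp] theorem mem_upair {a b x : P} : x ∈ upair a b ↔ x = a ∨ x = b := (isSet_upair a b).mem

@[simp] theorem map_upair (f : P ⇛ Q) (a b : P) : f (upair a b) = upair (f a) (f b) :=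
  ext fun _ g _ => ((isSet_upair a b).mem_map (f.trans g)).trans
    ((isSet_upair (f a) (f b)).mem_map g).symm

noncomputable def single (a : P) : P := upair a a

@[simp] theorem mem_single {a x : P} : x ∈ single a ↔ x = a := by simp [single]

@[simp] theorem map_single (f : P ⇛ Q) (a : P) : f (single a) = single (f a) := by simp [single]

noncomputable def sUnion (a : P) : P := (isSet_sUnion a).set

@[simp] theorem mem_sUnion {a x : P} : x ∈ sUnion a ↔ ∃ y ∈ a, x ∈ y := (isSet_sUnion a).mem

@[simp] theorem map_sUnion (f : P ⇛ Q) (a : P) : f (sUnion a) = sUnion (f a) :=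
  ext fun _ g _ => ((isSet_sUnion a).mem_map (f.trans g)).trans
    ((isSet_sUnion (f a)).mem_map g).symm

/-- `a ∪ b`. -/
noncomputable def cup (a b : P) : P := sUnion (upair a b)

@[simp] theorem mem_cup {a b x : P} : x ∈ cup a b ↔ x ∈ a ∨ x ∈ b := by
  simp [cup, or_and_right, exists_or]

@[simp] theorem map_cup (f : P ⇛ Q) (a b : P) : f (cup a b) = cup (f a) (f b) := by simp [cup]

/-- `a ∪ {b}`. -/
noncomputable def adjoin (a b : P) : P := cup a (single b)

@[simp] theorem mem_adjoin {a b x : P} : x ∈ adjoin a b ↔ x ∈ a ∨ x = b := by simp [adjoin]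

@[simp] theorem map_adjoin (f : P ⇛ Q) (a b : P) : f (adjoin a b) = adjoin (f a) (f b) := by
  simp [adjoin]

/-- The ordered pair. -/
noncomputable def pr (a b : P) : P := upair (single a) (upair a b)

@[simp] theorem map_pr (f : P ⇛ Q) (a b : P) : f (pr a b) = pr (f a) (f b) := by simp [pr]

theorem upair_inj {a b c : P} (h : upair a b = upair a c) : b = c := by
  have h₁ : b ∈ upair a c := by rw [← h]; simp
  have h₂ : c ∈ upair a b := by rw [h]; simp
  rw [mem_upair] at h₁ h₂
  rcases h₁ with rfl | h₁
  · rcases h₂ with h₂ | h₂ <;> exact h₂.symm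
  · exact h₁

theorem single_eq_upair {a b c : P} (h : single a = upair b c) : a = b ∧ a = c := by
  have h₁ : b ∈ single a := by rw [h]; simp
  have h₂ : c ∈ single a := by rw [h]; simp
  rw [mem_single] at h₁ h₂
  exact ⟨h₁.symm, h₂.symm⟩

theorem single_mem_pr (a b : P) : single a ∈ pr a b := by simp [pr]

theorem upair_mem_pr (a b : P) : upair a b ∈ pr a b := by simp [pr]

@[simp] theorem pr_inj {a b c d : P} : pr a b = pr c d ↔ a = c ∧ b = d := by
  refine ⟨fun h => ?_, fun h => by rw [h.1, h.2]⟩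
  have h₁ : single a ∈ pr c d := h ▸ single_mem_pr a b
  have hac : a = c := by
    rw [pr, mem_upair] at h₁
    exact h₁.elim (fun h => (single_eq_upair h).1) (fun h => (single_eq_upair h).1)
  subst hac
  exact ⟨rfl, upair_inj (upair_inj h)⟩

/-- The von Neumann numeral of `k`. -/
noncomputable def num : ℕ → P
  | 0 => ∅
  | k + 1 => adjoin (num k) (num k)

@[simp] theorem map_num (f : P ⇛ Q) (k : ℕ) : f (num k) = num k := by
  induction k <;> simp_all [num]

theorem mem_num {k : ℕ} {x : P} : x ∈ (num k : P) ↔ ∃ j < k, x = num j := by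
  induction k with
  | zero => simp [num]
  | succ k ih =>
    simp only [num, mem_adjoin, ih, Nat.lt_succ_iff_lt_or_eq]
    constructor
    · rintro (⟨j, h, rfl⟩ | rfl)
      · exact ⟨j, Or.inl h, rfl⟩
      · exact ⟨k, Or.inr rfl, rfl⟩
    · rintro ⟨j, h | rfl, rfl⟩
      · exact Or.inl ⟨j, h, rfl⟩
      · exact Or.inr rfl

@[simp] theorem num_inj {k l : ℕ} : (num k : P) = num l ↔ k = l := by
  refine ⟨fun h => ?_, fun h => by rw [h]⟩
  have key : ∀ k l : ℕ, k < l → (num k : P) ≠ num l := by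
    intro k
    induction k using Nat.strong_induction_on with
    | _ k ih =>
      intro l hl h
      have : (num k : P) ∈ (num l : P) := mem_num.2 ⟨k, hl, rfl⟩
      rw [← h] at this
      obtain ⟨j, hj, e⟩ := mem_num.1 this
      exact ih j hj k hj e.symm
  rcases lt_trichotomy k l with hlt | rfl | hlt
  · exact (key k l hlt h).elim
  · rfl
  · exact (key l k hlt h.symm).elim

/-- The pair `⟨k, x⟩`, with the numeral `k` serving as a tag. -/
noncomputable def tag (k : ℕ) (x : P) : P := pr (num k) x

@[simp] theorem map_tag (f : P ⇛ Q) (k : ℕ) (x : P) : f (tag k x) = tag k (f x) := by simp [tag]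

@[simp] theorem tag_inj {k l : ℕ} {x y : P} : tag k x = tag l y ↔ k = l ∧ x = y := by simp [tag]

variable {d x y z n r : ℕ} {e : ℕ → P}

@[simp] theorem ev_isEmpty (hx : x < d) : Ev (isEmpty x) d e ↔ lk d e x = ∅ := by
  rw [isEmpty, ev_allIn hx]
  simp only [ev_fal, imp_false]
  refine ⟨fun h => ext fun Q f y => iff_of_false (h Q f y) (by simp), fun h Q f y => by simp [h]⟩

@[simp] theorem ev_isAdjoin (hy : y < d) (hx : x < d) (hn : n < d) :
    Ev (isAdjoin y x n) d e ↔ lk d e y = adjoin (lk d e x) (lk d e n) := by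
  rw [isAdjoin, ev_all_iff]
  simp (disch := omega) only [ev_mem, ev_disj, ev_eq, lk_old, lk_new, lk_comp]
  exact ⟨fun h => ext fun Q f u => by simpa using h Q f u, fun h Q f u => by simp [h]⟩

@[simp] theorem ev_isUnion (hz : z < d) (hx : x < d) (hy : y < d) :
    Ev (isUnion z x y) d e ↔ lk d e z = cup (lk d e x) (lk d e y) := by
  rw [isUnion, ev_all_iff]
  simp (disch := omega) only [ev_mem, ev_disj, lk_old, lk_new, lk_comp]
  exact ⟨fun h => ext fun Q f u => by simpa using h Q f u, fun h Q f u => by simp [h]⟩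

@[simp] theorem ev_isNum {k : ℕ} (hx : x < d) : Ev (isNum k x) d e ↔ lk d e x = num k := by
  induction k generalizing d x e with
  | zero => exact ev_isEmpty hx
  | succ k ih => simp (disch := omega) [isNum, ih, num]

@[simp] theorem ev_isPair (hz : z < d) (hx : x < d) (hy : y < d) :
    Ev (isPair z x y) d e ↔ lk d e z = pr (lk d e x) (lk d e y) := by
  rw [isPair, ev_all_iff]
  simp (disch := omega) only [ev_mem, ev_disj, ev_eq, ev_all_iff, lk_old, lk_new, lk_comp]
  have h₁ : ∀ {Q} (w a : Carrier Q),
      (∀ R (g : Q ⇛ R) u, u ∈ g w ↔ u = g a) ↔ w = single a := fun w a =>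
    ⟨fun h => ext fun R g u => by simpa using h R g u, fun h R g u => by simp [h]⟩
  have h₂ : ∀ {Q} (w a b : Carrier Q),
      (∀ R (g : Q ⇛ R) u, u ∈ g w ↔ u = g a ∨ u = g b) ↔ w = upair a b := fun w a b =>
    ⟨fun h => ext fun R g u => by simpa using h R g u, fun h R g u => by simp [h]⟩
  simp only [h₁, h₂]
  exact ⟨fun h => ext fun Q f u => by simpa [pr] using h Q f u, fun h Q f u => by simp [h, pr]⟩

@[simp] theorem ev_pairMem (hx : x < d) (hy : y < d) (hr : r < d) :
    Ev (pairMem x y r) d e ↔ pr (lk d e x) (lk d e y) ∈ lk d e r := by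
  simp (disch := omega) [pairMem]

@[simp] theorem ev_isTagged {k : ℕ} (hz : z < d) (hx : x < d) :
    Ev (isTagged k z x) d e ↔ lk d e z = tag k (lk d e x) := by
  simp (disch := omega) [isTagged, tag]

@[simp] theorem ev_isTagged₂ {k : ℕ} (hz : z < d) (hx : x < d) (hy : y < d) :
    Ev (isTagged₂ k z x y) d e ↔ lk d e z = tag k (pr (lk d e x) (lk d e y)) := by
  simp (disch := omega) [isTagged₂]

/-! ## Small propositions, separation and replacement -/

/-- A proposition in the worlds above `P`. -/
abbrev Prps (P : PrimeTheory) := ∀ ⦃Q : PrimeTheory⦄, (P ⇛ Q) → Prop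

/-- A proposition which is equivalent to `∅ ∈ s` for a set `s`. -/
def Small (p : Prps P) : Prop := ∃ s : P, ∀ ⦃Q⦄ (f : P ⇛ Q), p f ↔ ∅ ∈ f s

theorem Small.congr {p q : Prps P} (h : Small p) (hpq : ∀ ⦃Q⦄ (f : P ⇛ Q), q f ↔ p f) : Small q :=
  let ⟨s, hs⟩ := h
  ⟨s, fun _ f => (hpq f).trans (hs f)⟩

/-- The truth value is the subset of {∅} separated by the formula. -/
theorem small_bounded {φ : Fml} (hφ : IsBounded φ) (e : ℕ → P) :
    Small fun Q f => Holds Q φ (f ∘ e) := by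
  have h := bounded_separation (hφ.rename Nat.succ) (single ∅) e
  refine ⟨h.set, fun Q f => ?_⟩
  rw [h.mem_map f, holds_rename]
  simp only [map_single, map_empty, mem_single, true_and]
  rfl

theorem small_mem (a b : P) : Small fun _ f => f a ∈ f b :=
  small_bounded (.mem 0 1) (a ∷ b ∷ fun _ => a)

theorem small_eq (a b : P) : Small fun _ f => f a = f b :=
  (small_bounded (.eq 0 1) (a ∷ b ∷ fun _ => a)).congr fun _ f =>
    (holds_eq (x := 0) (y := 1) (e := f.toFun ∘ (a ∷ b ∷ fun _ => a))).symm

theorem Small.and {p q : Prps P} (hp : Small p) (hq : Small q) : Small fun _ f => p f ∧ q f := by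
  obtain ⟨s, hs⟩ := hp
  obtain ⟨t, ht⟩ := hq
  refine (small_bounded (.and (.mem 0 1) (.mem 0 2)) (∅ ∷ s ∷ t ∷ fun _ => s)).congr
    fun Q f => ?_
  rw [holds_and, holds_mem, holds_mem, hs, ht]
  simp [scons]

theorem Small.imp {p q : Prps P} (hp : Small p) (hq : Small q) :
    Small fun Q f => ∀ R (g : Q ⇛ R), p (f.trans g) → q (f.trans g) := by
  obtain ⟨s, hs⟩ := hp
  obtain ⟨t, ht⟩ := hq
  refine (small_bounded (.imp (.mem 0 1) (.mem 0 2)) (∅ ∷ s ∷ t ∷ fun _ => s)).congr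
    fun Q f => ?_
  simp only [holds_imp, holds_mem, hs, ht]
  simp [scons, Hom.trans]

theorem Small.restrict {p : Prps P} (hp : Small p) (a : P) : IsSet fun _ f x => x ∈ f a ∧ p f := by
  obtain ⟨s, hs⟩ := hp
  refine (bounded_separation (.mem 1 2) a (∅ ∷ s ∷ fun _ => s)).congr fun Q f x => ?_
  rw [holds_mem, hs]
  simp [scons]

/-- Strong Collection is applied to the relation "`b` is the set of all `z` related to `x`". Its
second half guarantees that nothing else is collected, so the union is exact. -/
theorem isSet_iUnion {r : Rel P} (hr : Dfn₂ r) {a : P}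
    (h : ∀ ⦃Q⦄ (f : P ⇛ Q), ∀ x ∈ f a, IsSet fun _ g y => r (f.trans g) (g x) y) :
    IsSet fun _ f y => ∃ x ∈ f a, r f x y := by
  obtain ⟨φ, e, hφ⟩ := hr
  obtain ⟨b, h₁, h₂⟩ := collection (a := a)
    (p := fun Q f x b => ∀ R (g : Q ⇛ R) z, z ∈ g b ↔ r (f.trans g) (g x) z)
    (.of (all fun z => z ∊ 1 ⇿ app φ [0, z]) 0 e fun Q f x b => by
      rw [ev_all_iff]
      refine forall₃_congr fun R g z => ?_
      rw [ev_app₂, ev_mem, hφ]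
      rfl)
    (fun Q f x hx => by
      obtain ⟨b, hb⟩ := h f x hx
      exact ⟨b, fun R g => hb g⟩)
  refine ⟨sUnion b, fun Q f y => ?_⟩
  rw [map_sUnion, mem_sUnion]
  constructor
  · rintro ⟨c, hc, hy⟩
    obtain ⟨x, hx, hxc⟩ := h₂ f c hc
    exact ⟨x, hx, (hxc Q (.refl Q) y).1 hy⟩
  · rintro ⟨x, hx, hxy⟩
    obtain ⟨c, hc, hxc⟩ := h₁ f x hx
    exact ⟨c, hc, (hxc Q (.refl Q) y).2 hxy⟩

theorem isSet_image {r : Rel P} (hr : Dfn₂ r) {a : P}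
    (h : ∀ ⦃Q⦄ (f : P ⇛ Q), ∀ x ∈ f a, ∃ y, ∀ ⦃R⦄ (g : Q ⇛ R) (z : R),
      r (f.trans g) (g x) z ↔ z = g y) :
    IsSet fun _ f y => ∃ x ∈ f a, r f x y :=
  isSet_iUnion hr fun _ f x hx => by
    obtain ⟨y, hy⟩ := h f x hx
    exact ⟨single y, fun R g z => by simp [hy g z]⟩

/-- Separation beyond bounded formulas: if each `p x` has a set as truth value, then {x | p x} is a
subset of {x} for each x ∈ a, and these sets are united. -/
theorem isSet_sep {p : Cls P} (hp : Dfn p) {a : P}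
    (h : ∀ ⦃Q⦄ (f : P ⇛ Q), ∀ x ∈ f a, Small fun _ g => p (f.trans g) (g x)) :
    IsSet fun _ f x => x ∈ f a ∧ p f x := by
  obtain ⟨φ, e, hφ⟩ := hp
  have : IsSet fun _ f y => ∃ x ∈ f a, y = x ∧ p f x := by
    refine isSet_iUnion (r := fun _ f x y => y = x ∧ p f x)
      (.of (1 ≐ 0 ⋏ app φ [0]) 0 e fun Q f x y => ?_) fun Q f x hx => ?_
    · rw [ev_conj, ev_eq, ev_app₁, hφ]
      rfl
    · refine ((h f x hx).restrict (single x)).congr fun R g y => ?_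
      simp
  exact this.congr fun Q f x => by simp

/-- Once {x ∈ a | p x} is a set, a quantifier over `a` becomes a bounded statement about this set:
it is inhabited, or, in the next lemma, it contains `a`. -/
theorem Small.exIn {p : Cls P} (hp : Dfn p) {a : P}
    (h : ∀ ⦃Q⦄ (f : P ⇛ Q), ∀ x ∈ f a, Small fun _ g => p (f.trans g) (g x)) :
    Small fun _ f => ∃ x ∈ f a, p f x := by
  have hs := isSet_sep hp h
  refine (small_bounded (.ex 0 (.eq 0 0)) (hs.set ∷ fun _ => a)).congr fun Q f => ?_
  simp only [holds_ex, holds_and, holds_mem, holds_eq, and_true]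
  exact exists_congr fun x => (hs.mem_map f).symm

theorem Small.allIn {p : Cls P} (hp : Dfn p) {a : P}
    (h : ∀ ⦃Q⦄ (f : P ⇛ Q), ∀ x ∈ f a, Small fun _ g => p (f.trans g) (g x)) :
    Small fun Q f => ∀ ⦃R⦄ (g : Q ⇛ R), ∀ x ∈ g (f a), p (f.trans g) x := by
  have hs := isSet_sep hp h
  refine (small_bounded (.all 0 (.mem 0 2)) (a ∷ hs.set ∷ fun _ => a)).congr fun Q f => ?_
  simp only [holds_all, holds_imp, holds_mem]
  constructor
  · intro h R g x S g' hx
    exact (hs.mem_map ((f.trans g).trans g')).2 ⟨hx, h (g.trans g') _ hx⟩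
  · intro h R g x hx
    exact ((hs.mem_map (f.trans g)).1 (h R g x R (.refl R) hx)).2

end SetTheory

end CZF

namespace CZF

section Functions

variable {P Q R : PrimeTheory}

/-! ## Induction over iterated elements -/

/-- `x` is an element of `a`, or an element of an element, and so on, with up to `N + 1` steps. -/
def Below : ℕ → P → P → Prop
  | 0, x, a => x ∈ a
  | N + 1, x, a => x ∈ a ∨ ∃ y ∈ a, Below N x y

theorem Below.of_mem {N : ℕ} {x a : P} (h : x ∈ a) : Below N x a := by
  cases N with
  | zero => exact h
  | succ N => exact Or.inl h

theorem Below.succ {N : ℕ} {x a : P} (h : Below N x a) : Below (N + 1) x a := by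
  induction N generalizing a with
  | zero => exact Or.inl h
  | succ N ih => exact h.imp_right fun ⟨y, hy, h⟩ => ⟨y, hy, ih h⟩

theorem Below.mono {M N : ℕ} {x a : P} (h : Below M x a) (hMN : M ≤ N) : Below N x a := by
  induction hMN with
  | refl => exact h
  | step _ ih => exact ih.succ

theorem Below.trans {M N : ℕ} {x y z : P} (h₁ : Below M x y) (h₂ : Below N y z) :
    Below (M + N + 1) x z := by
  induction N generalizing z with
  | zero => exact Or.inr ⟨y, h₂, h₁⟩
  | succ N ih =>
    rcases h₂ with h₂ | ⟨u, hu, h₂⟩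
    · exact Or.inr ⟨y, h₂, h₁.mono (by omega)⟩
    · exact Or.inr ⟨u, hu, ih h₂⟩

theorem below_pr_right (a b : P) : Below 1 b (pr a b) :=
  Or.inr ⟨_, upair_mem_pr a b, by simp [Below]⟩

theorem below_tag (k : ℕ) (x : P) : Below 1 x (tag k x) := below_pr_right _ _

/-- The formula for `Below`. -/
def belowFm : ℕ → ℕ → ℕ → Fm
  | 0, x, a => x ∊ a
  | N + 1, x, a => x ∊ a ⋎ exIn a fun y => belowFm N x y

theorem ev_belowFm {N d x a : ℕ} {e : ℕ → P} (hx : x < d) (ha : a < d) :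
    Ev (belowFm N x a) d e ↔ Below N (lk d e x) (lk d e a) := by
  induction N generalizing d a e with
  | zero => rfl
  | succ N ih => simp (disch := omega) [belowFm, Below, ih]

/-- Subterms and subformulas are not elements of a code but lie boundedly many membership steps
below it. Plain set induction is applied to the strengthened claim that `p` holds of `a` and of
everything up to `N + 1` steps below. -/
theorem below_induction (N : ℕ) {p : Cls P} (hp : Dfn p)
    (h : ∀ ⦃Q⦄ (f : P ⇛ Q) (a : Q),
      (∀ ⦃R⦄ (g : Q ⇛ R) (x : R), Below N x (g a) → p (f.trans g) x) → p f a) (a : P) :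
    p (.refl P) a := by
  obtain ⟨φ, e, hφ⟩ := id hp
  suffices h' : ∀ ⦃Q⦄ (f : P ⇛ Q) (a : Q), (∀ ⦃R⦄ (g : Q ⇛ R) (x : R), x ∈ g a →
      (p (f.trans g) x ∧ ∀ S (g' : R ⇛ S) y, Below N y (g' x) → p ((f.trans g).trans g') y)) →
      (p f a ∧ ∀ R (g : Q ⇛ R) x, Below N x (g a) → p (f.trans g) x) by
    refine (set_induction (p := fun Q f a =>
        p f a ∧ ∀ R (g : Q ⇛ R) x, Below N x (g a) → p (f.trans g) x)
      (.of (app φ [0] ⋏ all fun x => belowFm N x 0 ⇾ app φ [x]) 0 e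
      fun Q f a => ?_) h' a).1
    rw [ev_conj, ev_all_imp]
    simp only [ev_app₁, hφ]
    refine and_congr Iff.rfl (forall₃_congr fun R g x => ?_)
    rw [ev_belowFm (by omega) (by omega)]
    rfl
  intro Q f a ih
  have : ∀ R (g : Q ⇛ R) x, Below N x (g a) → p (f.trans g) x := by
    intro R g x hx
    cases N with
    | zero => exact (ih g x hx).1
    | succ N =>
      rcases hx with hx | ⟨y, hy, hx⟩
      · exact (ih g x hx).1
      · exact (ih g y hy).2 R (.refl R) x hx.succ
  exact ⟨h f a this, this⟩

/-- Set induction on `x`: a two-cycle through `x` passes through an element of `x`, for which the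
claim is already known. -/
theorem not_mem_cycle {x y : P} (h₁ : x ∈ y) : y ∉ x := by
  refine set_induction (p := fun Q f x => ∀ R (g : Q ⇛ R) y, g x ∈ y →
      ∀ S (h : R ⇛ S), h y ∉ h (g x))
    (.of (all fun y => 0 ∊ y ⇾ neg (y ∊ 0)) 0 (fun _ => x) fun Q f x => ?_)
    (fun Q f a ih R g y h₁ S h h₂ => ih (g.trans h) (h y) h₂ S (.refl S) (h (g a)) h₂ S (.refl S)
      (h.mem h₁)) x P (.refl P) y h₁ P (.refl P)
  rw [ev_all_imp]
  simp (disch := omega) only [ev_mem, ev_neg, lk_old, lk_new, lk_comp]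

/-! ## Natural numbers -/

/-- `om` is the set of natural numbers. -/
def IsOmega (om : P) : Prop :=
  ∀ ⦃Q⦄ (f : P ⇛ Q) (u : Q), u ∈ f om ↔ u = ∅ ∨ ∃ v ∈ f om, u = adjoin v v

theorem ev_isOmega {d x : ℕ} {e : ℕ → P} (hx : x < d) :
    Ev (isOmega x) d e ↔ IsOmega (lk d e x) := by
  rw [isOmega, ev_all_iff]
  simp (disch := omega) only [ev_mem, ev_disj, ev_exIn, ev_isEmpty, ev_isAdjoin, lk_old, lk_new,
    lk_comp]
  rfl

theorem IsOmega.up {om : P} (h : IsOmega om) (f : P ⇛ Q) : IsOmega (f om) :=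
  fun _ g => h (f.trans g)

theorem exists_omega (P : PrimeTheory) : ∃ om : P, IsOmega om := by
  have := holds_axiom .infinity (fun _ => (∅ : P))
  change Ev infinity 0 _ at this
  obtain ⟨om, h⟩ := ev_ex.1 this
  exact ⟨om, by simpa using (ev_isOmega (by omega)).1 h⟩

theorem adjoin_self_inj {u v : P} (h : adjoin u u = adjoin v v) : u = v := by
  have h₁ : u ∈ adjoin v v := by rw [← h]; simp
  have h₂ : v ∈ adjoin u u := by rw [h]; simp
  rw [mem_adjoin] at h₁ h₂
  rcases h₁ with h₁ | h₁
  · rcases h₂ with h₂ | h₂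
    · exact (not_mem_cycle h₁ h₂).elim
    · exact h₂.symm
  · exact h₁

theorem adjoin_ne_empty {u v : P} : adjoin u v ≠ ∅ := fun h => by
  have : v ∈ adjoin u v := by simp
  rw [h] at this
  exact not_mem_empty _ this

/-- Equality of `a` and `b` is decidable. -/
def EqDec (a b : P) : Prop := a = b ∨ ∀ ⦃Q⦄ (f : P ⇛ Q), f a ≠ f b

/-- A natural number is ∅ or a successor, and a successor determines its predecessor by
`adjoin_self_inj`; so two numbers are compared through their predecessors, by induction. -/
theorem IsOmega.eqDec {om : P} (h : IsOmega om) {m n : P} (hn : n ∈ om) (hm : m ∈ om) :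
    EqDec n m := by
  refine set_induction (p := fun Q f n => ∀ R (g : Q ⇛ R) m, g n ∈ g (f om) ∧ m ∈ g (f om) →
      EqDec (g n) m)
    (.of (all fun m => 1 ∊ 0 ⋏ m ∊ 0 ⇾ (1 ≐ m ⋎ neg (1 ≐ m))) 1 (om ∷ fun _ => om)
      fun Q f n => ?_) ?_ n P (.refl P) m ⟨hn, hm⟩
  · rw [ev_all_imp]
    simp (disch := omega) only [ev_mem, ev_conj, ev_disj, ev_eq, ev_neg, lk_old, lk_new, lk_comp]
    rfl
  · rintro Q f n ih R g m ⟨hn, hm⟩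
    rcases (h (f.trans g) _).1 hn with hn | ⟨u, hu, hn⟩ <;>
      rcases (h (f.trans g) _).1 hm with hm | ⟨v, hv, hm⟩
    · exact Or.inl (hn.trans hm.symm)
    · refine Or.inr fun S g' => ?_
      simp [hn, hm, adjoin_ne_empty.symm]
    · refine Or.inr fun S g' => ?_
      simp [hn, hm, adjoin_ne_empty]
    · rw [hn, hm]
      refine (ih g u (by simp [hn]) R (.refl R) v ⟨hu, hv⟩).imp (fun h => ?_) fun h S g' e => ?_
      · change u = v at h
        rw [h]
      · rw [map_adjoin, map_adjoin] at e
        exact h g' (adjoin_self_inj e)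

end Functions

end CZF

namespace CZF

section Functions

variable {P Q R : PrimeTheory}

/-! ## Products and function sets -/

theorem isSet_prod (X Y : P) : IsSet fun _ f p => ∃ x ∈ f X, ∃ y ∈ f Y, p = pr x y := by
  refine isSet_iUnion (r := fun _ f x p => ∃ y ∈ f Y, p = pr x y)
    (.of (exIn 0 fun y => isPair 2 1 y) 1 (Y ∷ fun _ => Y) fun Q f x p => ?_) fun Q f x hx => ?_
  · simp
  · exact isSet_image (r := fun _ g y p => p = pr (g x) y)
      (.of (isPair 2 0 1) 1 (x ∷ fun _ => x) fun R g y p => by simp)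
      fun R g y hy => ⟨pr (g x) y, fun S h z => by simp [Hom.trans]⟩

/-- The product of two sets. -/
noncomputable def prod (X Y : P) : P := (isSet_prod X Y).set

theorem mem_prod {X Y p : P} : p ∈ prod X Y ↔ ∃ x ∈ X, ∃ y ∈ Y, p = pr x y := (isSet_prod X Y).mem

@[simp] theorem pr_mem_prod {X Y x y : P} : pr x y ∈ prod X Y ↔ x ∈ X ∧ y ∈ Y := by
  simp only [mem_prod, pr_inj]
  constructor
  · rintro ⟨_, h₁, _, h₂, rfl, rfl⟩
    exact ⟨h₁, h₂⟩
  · rintro ⟨h₁, h₂⟩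
    exact ⟨x, h₁, y, h₂, rfl, rfl⟩

@[simp] theorem map_prod (f : P ⇛ Q) (X Y : P) : f (prod X Y) = prod (f X) (f Y) :=
  ext fun _ g _ => ((isSet_prod X Y).mem_map (f.trans g)).trans
    ((isSet_prod (f X) (f Y)).mem_map g).symm

/-- `⟨x, y⟩ ∈ g` and `⟨x, y'⟩ ∈ g` imply `y = y'`. -/
def Functional (g : P) : Prop :=
  ∀ ⦃Q⦄ (f : P ⇛ Q) (x y y' : Q), pr x y ∈ f g → pr x y' ∈ f g → y = y'

/-- `g` is a function from `X` to `Y`. -/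
structure IsFun (g X Y : P) : Prop where
  sub : ∀ ⦃Q⦄ (f : P ⇛ Q), ∀ p ∈ f g, ∃ x ∈ f X, ∃ y ∈ f Y, p = pr x y
  total : ∀ ⦃Q⦄ (f : P ⇛ Q), ∀ x ∈ f X, ∃ y ∈ f Y, pr x y ∈ f g
  functional : Functional g

variable {d x y z g X Y : ℕ} {e : ℕ → P}

theorem ev_functional (hg : g < d) : Ev (functional g) d e ↔ Functional (lk d e g) := by
  rw [functional, ev_all₃_imp₂]
  simp (disch := omega) only [ev_pairMem, ev_eq, lk_old, lk_new, lk_comp]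
  rfl

@[simp] theorem ev_isFun (hg : g < d) (hX : X < d) (hY : Y < d) :
    Ev (isFun g X Y) d e ↔ IsFun (lk d e g) (lk d e X) (lk d e Y) := by
  rw [isFun, ev_conj, ev_conj, ev_allIn hg, ev_allIn hX, ev_functional hg]
  simp (disch := omega) only [ev_exIn, ev_pairMem, ev_isPair, lk_old, lk_new, lk_comp]
  exact ⟨fun ⟨h₁, h₂, h₃⟩ => ⟨h₁, h₂, h₃⟩, fun ⟨h₁, h₂, h₃⟩ => ⟨h₁, h₂, h₃⟩⟩

theorem Functional.up {g : P} (h : Functional g) (f : P ⇛ Q) : Functional (f g) :=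
  fun _ f' => h (f.trans f')

theorem IsFun.up {g X Y : P} (h : IsFun g X Y) (f : P ⇛ Q) : IsFun (f g) (f X) (f Y) :=
  ⟨fun _ f' => h.sub (f.trans f'), fun _ f' => h.total (f.trans f'), h.functional.up f⟩

theorem Functional.eq {g x y y' : P} (h : Functional g) (h₁ : pr x y ∈ g) (h₂ : pr x y' ∈ g) :
    y = y' := h (.refl P) x y y' h₁ h₂

theorem IsFun.value {g X Y x : P} (h : IsFun g X Y) (hx : x ∈ X) : ∃ y ∈ Y, pr x y ∈ g :=
  h.total (.refl P) x hx

theorem IsFun.mem {g X Y x y : P} (h : IsFun g X Y) (hp : pr x y ∈ g) : x ∈ X ∧ y ∈ Y := by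
  obtain ⟨x', hx, y', hy, e⟩ := h.sub (.refl P) _ hp
  rw [pr_inj] at e
  exact ⟨e.1 ▸ hx, e.2 ▸ hy⟩

/-- Functionality quantifies over all sets. Since `g` is also required to be a subset of the
product, it is enough to test arguments in `X` and values in `Y`, and the condition becomes bounded.
-/
theorem small_isFun (g X Y : P) : Small fun _ f => IsFun (f g) (f X) (f Y) := by
  have h₁ : Small fun Q f => ∀ ⦃R⦄ (h : Q ⇛ R), ∀ p ∈ h (f g), p ∈ h (f (prod X Y)) :=
    Small.allIn (p := fun _ f p => p ∈ f (prod X Y))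
      (.of (1 ∊ 0) 1 (prod X Y ∷ fun _ => X) fun Q f x => by simp)
      fun Q f p _ => small_mem p (f (prod X Y))
  have h₂ : Small fun Q f => ∀ ⦃R⦄ (h : Q ⇛ R), ∀ x ∈ h (f X), ∃ y ∈ h (f Y), pr x y ∈ h (f g) :=
    Small.allIn (p := fun _ f x => ∃ y ∈ f Y, pr x y ∈ f g)
      (.of (exIn 0 fun y => pairMem 2 y 1) 2 (g ∷ Y ∷ fun _ => X) fun Q f x => by simp)
      fun Q f x _ => Small.exIn (p := fun _ h y => pr (h x) y ∈ h (f g))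
        (.of (pairMem 1 2 0) 2 (x ∷ f g ∷ fun _ => x) fun R h y => by simp)
        fun R h y _ => (small_mem (pr (h x) y) (h (f g))).congr fun S k => by simp; rfl
  -- The three bounded quantifiers of functionality are added one at a time, from the inside
  -- outwards.
  have k₁ : ∀ {Q : PrimeTheory} (g x y y' : Q), Small fun R f => ∀ S (h : R ⇛ S),
      pr (h (f x)) (h (f y)) ∈ h (f g) ∧ pr (h (f x)) (h (f y')) ∈ h (f g) →
        h (f y) = h (f y') := fun g x y y' =>
    (Small.imp ((small_mem (pr x y) g).and (small_mem (pr x y') g)) (small_eq y y')).congr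
      fun R f => by simp; rfl
  have k₂ : ∀ {Q : PrimeTheory} (g Y x y : Q), Small fun R f => ∀ ⦃S⦄ (h : R ⇛ S),
      ∀ y' ∈ h (f Y), ∀ T (k : S ⇛ T), pr (k (h (f x))) (k (h (f y))) ∈ k (h (f g)) ∧
        pr (k (h (f x))) (k y') ∈ k (h (f g)) → k (h (f y)) = k y' := fun g Y x y =>
    Small.allIn (p := fun Q f y' => ∀ R (h : Q ⇛ R), pr (h (f x)) (h (f y)) ∈ h (f g) ∧
        pr (h (f x)) (h y') ∈ h (f g) → h (f y) = h y')
      (.of (pairMem 1 2 0 ⋏ pairMem 1 3 0 ⇾ 2 ≐ 3) 3 (y ∷ x ∷ g ∷ fun _ => g) fun Q f y' => by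
        simp) fun R f y' _ => k₁ (f g) (f x) (f y) y'
  have k₃ : ∀ {Q : PrimeTheory} (g Y x : Q), Small fun R f => ∀ ⦃S⦄ (h : R ⇛ S),
      ∀ y ∈ h (f Y), ∀ T (k : S ⇛ T), ∀ y' ∈ k (h (f Y)), ∀ U (l : T ⇛ U),
        pr (l (k (h (f x)))) (l (k y)) ∈ l (k (h (f g))) ∧
        pr (l (k (h (f x)))) (l y') ∈ l (k (h (f g))) → l (k y) = l y' := fun g Y x =>
    Small.allIn (p := fun Q f y => ∀ R (h : Q ⇛ R), ∀ y' ∈ h (f Y), ∀ S (k : R ⇛ S),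
        pr (k (h (f x))) (k (h y)) ∈ k (h (f g)) ∧
        pr (k (h (f x))) (k y') ∈ k (h (f g)) → k (h y) = k y')
      (.of (allIn 2 fun y' => pairMem 1 3 0 ⋏ pairMem 1 y' 0 ⇾ 3 ≐ y') 3
        (Y ∷ x ∷ g ∷ fun _ => g) fun Q f y => by simp [ev_allIn])
      fun R f y _ => k₂ (f g) (f Y) (f x) y
  have h₃ : Small fun Q f => ∀ ⦃R⦄ (h : Q ⇛ R),
      ∀ x ∈ h (f X), ∀ S (k : R ⇛ S), ∀ y ∈ k (h (f Y)), ∀ T (l : S ⇛ T), ∀ y' ∈ l (k (h (f Y))),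
        ∀ U (m : T ⇛ U), pr (m (l (k x))) (m (l y)) ∈ m (l (k (h (f g)))) ∧
        pr (m (l (k x))) (m y') ∈ m (l (k (h (f g)))) → m (l y) = m y' :=
    Small.allIn (p := fun Q f x => ∀ R (k : Q ⇛ R), ∀ y ∈ k (f Y), ∀ S (l : R ⇛ S),
        ∀ y' ∈ l (k (f Y)), ∀ T (m : S ⇛ T), pr (m (l (k x))) (m (l y)) ∈ m (l (k (f g))) ∧
        pr (m (l (k x))) (m y') ∈ m (l (k (f g))) → m (l y) = m y')
      (.of (allIn 1 fun y => allIn 1 fun y' => pairMem 2 y 0 ⋏ pairMem 2 y' 0 ⇾ y ≐ y') 2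
        (Y ∷ g ∷ fun _ => g) fun Q f x => by simp [ev_allIn])
      fun R f x _ => k₃ (f g) (f Y) x
  refine (h₁.and (h₂.and h₃)).congr fun Q f => ⟨fun h => ⟨fun R k p hp => ?_, fun R k => ?_, ?_⟩,
    fun ⟨h₁, h₂, h₃⟩ => ⟨fun R k p hp => ?_, fun R k => h₂ k, fun R k x y y' hy hy' => ?_⟩⟩
  · obtain ⟨x, hx, y, hy, rfl⟩ := h.sub k p hp
    simpa using ⟨hx, hy⟩
  · exact h.total k
  · intro R k x hx S l y hy T m y' hy' U i hi
    exact h.functional ((((k.trans l).trans m).trans i)) _ _ _ hi.1 hi.2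
  · have := h₁ k p hp
    rwa [map_prod, map_prod, mem_prod] at this
  · have m₁ : ∀ {x y : Carrier R}, pr x y ∈ k (f g) → x ∈ k (f X) ∧ y ∈ k (f Y) := fun h => by
      simpa using h₁ k _ h
    exact h₃ k x (m₁ hy).1 R (.refl R) y (m₁ hy).2 R (.refl R) y' (m₁ hy').2 R (.refl R) ⟨hy, hy'⟩

/-- Exponentiation from Subset Collection for `X` and `X × Y`, with the relation "y ∈ u and y has
first component x". When `u` is a function `g`, the set of values provided must be `g` itself:
functionality leaves one possible value at each argument. -/
theorem isSet_exp (X Y : P) : IsSet fun _ f g => IsFun g (f X) (f Y) := by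
  obtain ⟨c, hc⟩ := subset_collection ((1 ∊ 0 ⋏ ex fun v => isPair 1 2 v) 3) (fun _ => X)
    X (prod X Y)
  have hφ : ∀ {Q} (x y u : Carrier Q) (e : ℕ → Q),
      Holds Q ((1 ∊ 0 ⋏ ex fun v => isPair 1 2 v) 3) (x ∷ y ∷ u ∷ e) ↔
        y ∈ u ∧ ∃ v, y = pr x v := by
    intro Q x y u e
    change Ev _ 3 _ ↔ _
    simp
  simp only [hφ] at hc
  have := isSet_sep (p := fun Q f g => IsFun g (f X) (f Y)) (a := c)
    (.of (isFun 2 0 1) 2 (Y ∷ X ∷ fun _ => X) fun Q f x => by simp)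
    fun Q f g _ => small_isFun g (f X) (f Y)
  refine this.congr fun Q f g => ⟨fun hg => ⟨?_, hg⟩, fun h => h.2⟩
  obtain ⟨u, hu, h₁, h₂⟩ := hc f g fun R h x hx => by
    obtain ⟨y, hy, hxy⟩ := (hg.up h).value hx
    exact ⟨pr x y, by simpa using ⟨hx, hy⟩, hxy, y, rfl⟩
  convert hu
  refine ext fun R h p => ⟨fun hp => ?_, fun hp => ?_⟩
  · obtain ⟨x, hx, y, hy, rfl⟩ := hg.sub h p hp
    obtain ⟨q, hq, hq', y', rfl⟩ := h₁ h x hx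
    rwa [(hg.up h).functional.eq hp hq']
  · obtain ⟨x, hx, hp', -⟩ := h₂ h p hp
    exact hp'

/-- The set of functions from `X` to `Y`. -/
noncomputable def exp (X Y : P) : P := (isSet_exp X Y).set

@[simp] theorem mem_exp {X Y g : P} : g ∈ exp X Y ↔ IsFun g X Y := (isSet_exp X Y).mem

@[simp] theorem map_exp (f : P ⇛ Q) (X Y : P) : f (exp X Y) = exp (f X) (f Y) :=
  ext fun _ g _ => ((isSet_exp X Y).mem_map (f.trans g)).trans
    ((isSet_exp (f X) (f Y)).mem_map g).symm

/-! ## Updating an assignment -/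

/-- `v'` sends `n` to `m` and agrees with `v` otherwise. -/
def IsUpdate (v' v n m : P) : Prop := ∀ ⦃Q⦄ (f : P ⇛ Q) (p : Q), p ∈ f v' ↔
  (p ∈ f v ∧ ∀ R (g : Q ⇛ R), ¬ ∃ y, g p = pr (g (f n)) y) ∨ p = pr (f n) (f m)

@[simp] theorem ev_isUpdate {v' v n m : ℕ} (h₁ : v' < d) (h₂ : v < d) (h₃ : n < d) (h₄ : m < d) :
    Ev (isUpdate v' v n m) d e ↔ IsUpdate (lk d e v') (lk d e v) (lk d e n) (lk d e m) := by
  rw [isUpdate, ev_all_iff]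
  simp (disch := omega) only [ev_mem, ev_disj, ev_conj, ev_neg, ev_ex, ev_isPair, lk_old, lk_new,
    lk_comp]
  rfl

theorem IsUpdate.up {v' v n m : P} (h : IsUpdate v' v n m) (f : P ⇛ Q) :
    IsUpdate (f v') (f v) (f n) (f m) :=
  fun _ g => h (f.trans g)

theorem IsUpdate.unique {v v₁ v₂ n m : P} (h₁ : IsUpdate v₁ v n m) (h₂ : IsUpdate v₂ v n m) :
    v₁ = v₂ :=
  ext fun _ f p => (h₁ f p).trans (h₂ f p).symm

/-- Removing the old value at `n` means separating by a negated condition. Decidability of equality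
with `n` makes this condition small and the updated assignment total. -/
theorem exists_update {v E A n m : P} (hv : IsFun v E A) (hm : m ∈ A)
    (hn : ∀ ⦃Q⦄ (f : P ⇛ Q), ∀ x ∈ f E, EqDec x (f n)) :
    ∃ v', IsUpdate v' v n m ∧ IsFun v' (adjoin E n) A := by
  have key : ∀ {Q : PrimeTheory} (f : P ⇛ Q) {x y : Q}, x ∈ f E → EqDec x (f n) →
      ((x = f n ∧ ∃ y', pr x y = pr (f n) y') ∨
      ∀ R (g : Q ⇛ R), ¬ ∃ y', g (pr x y) = pr (g (f n)) y') := by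
    rintro Q f x y hx (rfl | h)
    · exact Or.inl ⟨rfl, y, rfl⟩
    · exact Or.inr fun R g => by simpa using h g
  have hs : IsSet fun Q f p => p ∈ f v ∧ ∀ R (g : Q ⇛ R), ¬ ∃ y, g p = pr (g (f n)) y := by
    refine isSet_sep (p := fun Q f p => ∀ R (g : Q ⇛ R), ¬ ∃ y, g p = pr (g (f n)) y)
      (.of (neg (ex fun y => isPair 1 0 y)) 1 (n ∷ fun _ => n) fun Q f p => by simp)
      fun Q f p hp => ?_
    obtain ⟨x, hx, y, hy, rfl⟩ := hv.sub f p hp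
    -- By decidability the condition is false or true, with truth value ∅ or {∅}.
    rcases key f (y := y) hx (hn f x hx) with ⟨h, y', hxy⟩ | h
    · refine ⟨∅, fun R g => iff_of_false (fun h' => h' R (.refl R) ⟨g y', ?_⟩) (by simp)⟩
      have := congrArg g hxy
      rwa [map_pr g (f n)] at this
    · exact ⟨single ∅, fun R g => iff_of_true (fun S k => h S (g.trans k)) (by simp)⟩
  have mem_v' : ∀ ⦃Q⦄ (f : P ⇛ Q) (p : Q), p ∈ f (adjoin hs.set (pr n m)) ↔
      (p ∈ f v ∧ ∀ R (g : Q ⇛ R), ¬ ∃ y, g p = pr (g (f n)) y) ∨ p = pr (f n) (f m) := by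
    intro Q f p
    rw [map_adjoin, mem_adjoin, hs.mem_map f, map_pr]
  refine ⟨adjoin hs.set (pr n m), mem_v', fun Q f p hp => ?_, fun Q f x hx => ?_, ?_⟩
  · rcases (mem_v' f p).1 hp with ⟨hp, -⟩ | rfl
    · obtain ⟨x, hx, y, hy, rfl⟩ := hv.sub f p hp
      exact ⟨x, by simp [hx], y, hy, rfl⟩
    · exact ⟨f n, by simp, f m, f.mem hm, rfl⟩
  · have hxn : x = f n ∨ x ∈ f E ∧ ∀ ⦃R⦄ (g : Q ⇛ R), g x ≠ g (f n) := by
      rw [map_adjoin, mem_adjoin] at hx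
      rcases hx with hx | hx
      · exact (hn f x hx).imp_right fun h => ⟨hx, h⟩
      · exact Or.inl hx
    rcases hxn with rfl | ⟨hx, h⟩
    · exact ⟨f m, f.mem hm, (mem_v' f _).2 (Or.inr rfl)⟩
    · obtain ⟨y, hy, hxy⟩ := (hv.up f).value hx
      exact ⟨y, hy, (mem_v' f _).2 (Or.inl ⟨hxy, fun R g => by simpa using h g⟩)⟩
  · intro Q f x y y' h₁ h₂
    rcases (mem_v' f _).1 h₁ with ⟨h₁, h₁'⟩ | h₁ <;> rcases (mem_v' f _).1 h₂ with ⟨h₂, h₂'⟩ | h₂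
    · exact (hv.up f).functional.eq h₁ h₂
    · rw [pr_inj] at h₂
      exact (h₁' Q (.refl Q) ⟨y, by rw [← h₂.1]; rfl⟩).elim
    · rw [pr_inj] at h₁
      exact (h₂' Q (.refl Q) ⟨y', by rw [← h₁.1]; rfl⟩).elim
    · rw [pr_inj] at h₁ h₂
      rw [h₁.2, h₂.2]

end Functions

end CZF

namespace CZF

section GameFormulas

variable {P Q R : PrimeTheory}

/-! ## Signatures, game formulas and satisfaction in a world -/

/-- This and the following notions are the Kripke readings of the formulas with corresponding names;
later worlds enter where an implication or a universal quantifier does. -/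
def Sub (x y : P) : Prop := ∀ ⦃Q⦄ (f : P ⇛ Q), ∀ z ∈ f x, z ∈ f y

theorem Hom.mem_pr (f : P ⇛ Q) {x y r : P} (h : pr x y ∈ r) : pr (f x) (f y) ∈ f r := by
  simpa using f.mem h

theorem Sub.up {x y : P} (h : Sub x y) (f : P ⇛ Q) : Sub (f x) (f y) := fun _ g => h (f.trans g)

theorem Sub.mem {x y z : P} (h : Sub x y) (hz : z ∈ x) : z ∈ y := h (.refl P) z hz

/-- All elements of `S` are terms over `f` with variables in `D` and direct subterms in `S`. -/
def TermClosed (f D S : P) : Prop := ∀ ⦃Q⦄ (i : P ⇛ Q), ∀ s ∈ i S,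
  (∃ n ∈ i D, s = tag 0 n) ∨ ∃ h k g, pr h k ∈ i f ∧ IsFun g k (i S) ∧ s = tag 1 (pr h g)

def IsTerm (f D t : P) : Prop := ∃ S, t ∈ S ∧ TermClosed f D S

def IsTermTuple (f D k g : P) : Prop :=
  ∃ Y, IsFun g k Y ∧ ∀ ⦃Q⦄ (i : P ⇛ Q), ∀ t ∈ i Y, IsTerm (i f) (i D) t

/-- All elements `⟨E, χ⟩` of `S` consist of a formula `χ` with free variables in `E` and direct
subformulas in `S`. -/
def GameClosed (om f q S : P) : Prop := ∀ ⦃Q⦄ (i : P ⇛ Q) (E χ : Q), pr E χ ∈ i S →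
  (∃ R k g, pr R k ∈ i q ∧ IsTermTuple (i f) E k g ∧ χ = tag 0 (pr R g)) ∨
  (∃ Φ, χ = tag 1 Φ ∧ ∀ R (j : Q ⇛ R), ∀ ψ ∈ j Φ, pr (j E) ψ ∈ j (i S)) ∨
  (∃ Φ, χ = tag 2 Φ ∧ ∀ R (j : Q ⇛ R), ∀ ψ ∈ j Φ, pr (j E) ψ ∈ j (i S)) ∨
  (∃ n ∈ i om, ∃ ψ E', χ = tag 3 (pr n ψ) ∧ E' = adjoin E n ∧ pr E' ψ ∈ i S) ∨
  (∃ n ∈ i om, ∃ ψ E', χ = tag 4 (pr n ψ) ∧ E' = adjoin E n ∧ pr E' ψ ∈ i S)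

def IsGameFormula (om f q D φ : P) : Prop := ∃ S, pr D φ ∈ S ∧ GameClosed om f q S

def IsGameTheory (om f q T : P) : Prop := ∀ ⦃Q⦄ (i : P ⇛ Q), ∀ s ∈ i T, ∃ D φ ψ,
  s = pr D (pr φ ψ) ∧ Sub D (i om) ∧ IsGameFormula (i om) (i f) (i q) D φ ∧
    IsGameFormula (i om) (i f) (i q) D ψ

def IsArity (om σ : P) : Prop :=
  (∀ ⦃Q⦄ (i : P ⇛ Q), ∀ p ∈ i σ, ∃ s, ∃ k ∈ i om, p = pr s k) ∧ Functional σ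

def NoCommonSymbol (σ τ : P) : Prop :=
  ∀ ⦃Q⦄ (i : P ⇛ Q) (s k l : Q), pr s k ∈ i σ → pr s l ∈ i τ → False

structure IsFunInterp (f A F : P) : Prop where
  sub : ∀ ⦃Q⦄ (i : P ⇛ Q), ∀ p ∈ i F, ∃ h k b z, ∃ y ∈ i A,
    pr h k ∈ i f ∧ IsFun b k (i A) ∧ z = pr h b ∧ p = pr z y
  total : ∀ ⦃Q⦄ (i : P ⇛ Q) (h k b : Q), pr h k ∈ i f → IsFun b k (i A) →
    ∃ y ∈ i A, pr (pr h b) y ∈ i F ∧ ∀ R (j : Q ⇛ R) y', pr (pr (j h) (j b)) y' ∈ j (i F) → y' = j y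

def IsRelInterp (q A J : P) : Prop := ∀ ⦃Q⦄ (i : P ⇛ Q), ∀ p ∈ i J, ∃ R k a,
  pr R k ∈ i q ∧ IsFun a k (i A) ∧ p = pr R a

/-- A signature and a structure without its relations. -/
structure Str (P : PrimeTheory) where
  (f q A F : P)

/-- The structure in a later world. -/
def Str.up (M : Str P) (i : P ⇛ Q) : Str Q := ⟨i M.f, i M.q, i M.A, i M.F⟩

/-- The elements `⟨s, y⟩` of `W` consist of a term and its value under the assignment `v`. -/
def ValueClosed (M : Str P) (v W : P) : Prop := ∀ ⦃Q⦄ (i : P ⇛ Q) (s y : Q), pr s y ∈ i W →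
  (∃ n, s = tag 0 n ∧ pr n y ∈ i v) ∨
  (∃ h k g b, pr h k ∈ i M.f ∧ s = tag 1 (pr h g) ∧ IsFun b k (i M.A) ∧
    (∀ R (j : Q ⇛ R) (l t m : R), pr l t ∈ j g → pr l m ∈ j b → pr t m ∈ j (i W)) ∧
    pr (pr h b) y ∈ i M.F)

def HasValue (M : Str P) (v t m : P) : Prop := ∃ W, pr t m ∈ W ∧ ValueClosed M v W

/-- The condition for the truth of a formula `χ` under `w`, where `I` is the interpretation of the
relation symbols and `Z` is the truth of the direct subformulas. -/
def Clause (M : Str P) (I : P → P → Prop) (Z : Rel P) (χ w : P) : Prop :=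
  (∃ R k g a, pr R k ∈ M.q ∧ χ = tag 0 (pr R g) ∧ IsFun a k M.A ∧
    (∀ Q (i : P ⇛ Q) (l t m : Q), pr l t ∈ i g → pr l m ∈ i a → HasValue (M.up i) (i w) t m) ∧
    I R a) ∨
  (∃ Φ, χ = tag 1 Φ ∧ ∀ Q (i : P ⇛ Q), ∀ ψ ∈ i Φ, Z i ψ (i w)) ∨
  (∃ Φ, χ = tag 2 Φ ∧ ∃ ψ ∈ Φ, Z (.refl P) ψ w) ∨
  (∃ n ψ, χ = tag 3 (pr n ψ) ∧ ∃ m ∈ M.A, ∃ w', IsUpdate w' w n m ∧ Z (.refl P) ψ w') ∨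
  (∃ n ψ, χ = tag 4 (pr n ψ) ∧
    ∀ Q (i : P ⇛ Q), ∀ m ∈ i M.A, ∃ w', IsUpdate w' (i w) (i n) m ∧ Z i (i ψ) w')

/-- The elements `⟨χ, w⟩` of `W` consist of a formula and an assignment which satisfies it. -/
def SatClosed (M : Str P) (J W : P) : Prop := ∀ ⦃Q⦄ (i : P ⇛ Q) (χ w : Q), pr χ w ∈ i W →
  Clause (M.up i) (fun R a => pr R a ∈ i J) (fun _ j ψ u => pr ψ u ∈ j (i W)) χ w

def Sat (M : Str P) (J φ v : P) : Prop := ∃ W, pr φ v ∈ W ∧ SatClosed M J W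

def IsModel (M : Str P) (J T : P) : Prop := ∀ ⦃Q⦄ (i : P ⇛ Q) (D φ ψ v : Q),
  pr D (pr φ ψ) ∈ i T → IsFun v D (i M.A) → Sat (M.up i) (i J) φ v → Sat (M.up i) (i J) ψ v

structure IsExpansion (r q A I J : P) : Prop where
  rel : IsRelInterp q A J
  iff : ∀ ⦃Q⦄ (i : P ⇛ Q) (R k a : Q), pr R k ∈ i r → (pr R a ∈ i J ↔ pr R a ∈ i I)

def IsUnionOf (n J N : P) : Prop := ∀ ⦃Q⦄ (i : P ⇛ Q) (R k a : Q), pr R k ∈ i n →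
  (pr R a ∈ i J ↔ ∃ K ∈ i N, pr R a ∈ K)

def IsRuleSet (R X : P) : Prop := ∀ ⦃Q⦄ (i : P ⇛ Q), ∀ ρ ∈ i R, ∃ a b,
  ρ = pr a b ∧ Sub a (i X) ∧ Sub b (i X)

structure IsClosed (R X Y : P) : Prop where
  sub : Sub Y X
  closed : ∀ ⦃Q⦄ (i : P ⇛ Q) (a b : Q), pr a b ∈ i R → Sub a (i Y) → ∃ y ∈ b, y ∈ i Y

/-! ### Truth of the formulas about signatures, structures and rules -/

variable {d : ℕ} {e : ℕ → P}

@[simp] theorem ev_sub {x y : ℕ} (hx : x < d) (hy : y < d) :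
    Ev (sub x y) d e ↔ Sub (lk d e x) (lk d e y) := by
  rw [sub, ev_allIn hx]
  simp (disch := omega) only [ev_mem, lk_old, lk_new, lk_comp]
  rfl

theorem ev_isTerm {f D t : ℕ} (hf : f < d) (hD : D < d) (ht : t < d) :
    Ev (isTerm f D t) d e ↔ IsTerm (lk d e f) (lk d e D) (lk d e t) := by
  simp (disch := omega) only [isTerm, ev_ex, ev_conj, ev_allIn, ev_mem, ev_disj, ev_exIn,
    ev_isTagged, ev_isTagged₂, ev_pairMem, ev_isFun, lk_old, lk_new, lk_comp]
  rfl

theorem ev_isTermTuple {f D k g : ℕ} (hf : f < d) (hD : D < d) (hk : k < d) (hg : g < d) :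
    Ev (isTermTuple f D k g) d e ↔
      IsTermTuple (lk d e f) (lk d e D) (lk d e k) (lk d e g) := by
  simp (disch := omega) only [isTermTuple, ev_ex, ev_conj, ev_allIn, ev_isFun, ev_isTerm,
    lk_old, lk_new, lk_comp]
  rfl

/-- The formula for `GameClosed`. -/
def gameClosedFm (om f q S : ℕ) : Fm :=
  all fun E => all fun χ => pairMem E χ S ⇾
    (ex fun R => ex fun k => ex fun g =>
      pairMem R k q ⋏ isTermTuple f E k g ⋏ isTagged₂ 0 χ R g) ⋎
    (ex fun Φ => isTagged 1 χ Φ ⋏ allIn Φ fun ψ => pairMem E ψ S) ⋎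
    (ex fun Φ => isTagged 2 χ Φ ⋏ allIn Φ fun ψ => pairMem E ψ S) ⋎
    (exIn om fun n => ex fun ψ => ex fun E' =>
      isTagged₂ 3 χ n ψ ⋏ isAdjoin E' E n ⋏ pairMem E' ψ S) ⋎
    (exIn om fun n => ex fun ψ => ex fun E' =>
      isTagged₂ 4 χ n ψ ⋏ isAdjoin E' E n ⋏ pairMem E' ψ S)

theorem ev_gameClosedFm {om f q S : ℕ} (ho : om < d) (hf : f < d) (hq : q < d) (hS : S < d) :
    Ev (gameClosedFm om f q S) d e ↔ GameClosed (lk d e om) (lk d e f) (lk d e q) (lk d e S) := by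
  rw [gameClosedFm, ev_all₂_imp]
  simp (disch := omega) only [ev_ex, ev_conj, ev_allIn, ev_disj, ev_exIn,
    ev_isTagged, ev_isTagged₂, ev_pairMem, ev_isTermTuple, ev_isAdjoin, lk_old, lk_new, lk_comp]
  rfl

theorem ev_isGameFormula {om f q D φ : ℕ} (ho : om < d) (hf : f < d) (hq : q < d) (hD : D < d)
    (hφ : φ < d) : Ev (isGameFormula om f q D φ) d e ↔
      IsGameFormula (lk d e om) (lk d e f) (lk d e q) (lk d e D) (lk d e φ) := by
  change Ev (ex fun S => pairMem D φ S ⋏ gameClosedFm om f q S) d e ↔ _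
  simp (disch := omega) only [ev_ex, ev_conj, ev_pairMem, ev_gameClosedFm, lk_old, lk_new]
  rfl

@[simp] theorem ev_isSequent {s D φ ψ : ℕ} (hs : s < d) (hD : D < d) (hφ : φ < d) (hψ : ψ < d) :
    Ev (isSequent s D φ ψ) d e ↔ lk d e s = pr (lk d e D) (pr (lk d e φ) (lk d e ψ)) := by
  simp (disch := omega) only [isSequent, ev_ex, ev_conj, ev_isPair, lk_old, lk_new]
  simp

theorem ev_isGameTheory {om f q T : ℕ} (ho : om < d) (hf : f < d) (hq : q < d) (hT : T < d) :
    Ev (isGameTheory om f q T) d e ↔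
      IsGameTheory (lk d e om) (lk d e f) (lk d e q) (lk d e T) := by
  simp (disch := omega) only [isGameTheory, ev_allIn, ev_ex, ev_conj, ev_isSequent, ev_sub,
    ev_isGameFormula, lk_old, lk_new, lk_comp]
  rfl

theorem ev_isArity {om σ : ℕ} (ho : om < d) (hσ : σ < d) :
    Ev (isArity om σ) d e ↔ IsArity (lk d e om) (lk d e σ) := by
  simp (disch := omega) only [isArity, ev_conj, ev_allIn, ev_ex, ev_exIn, ev_isPair,
    ev_functional, lk_old, lk_new, lk_comp]
  rfl

theorem ev_noCommonSymbol {σ τ : ℕ} (hσ : σ < d) (hτ : τ < d) :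
    Ev (noCommonSymbol σ τ) d e ↔ NoCommonSymbol (lk d e σ) (lk d e τ) := by
  rw [noCommonSymbol, ev_all₃_imp₂]
  simp (disch := omega) only [ev_pairMem, ev_fal, lk_old, lk_new, lk_comp]
  rfl

theorem ev_valueAt {F h b y : ℕ} (hF : F < d) (hh : h < d) (hb : b < d) (hy : y < d) :
    Ev (valueAt F h b y) d e ↔ pr (pr (lk d e h) (lk d e b)) (lk d e y) ∈ lk d e F := by
  simp (disch := omega) only [valueAt, ev_ex, ev_conj, ev_isPair, ev_pairMem, lk_old, lk_new]
  simp

theorem ev_isFunInterp {f A F : ℕ} (hf : f < d) (hA : A < d) (hF : F < d) :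
    Ev (isFunInterp f A F) d e ↔ IsFunInterp (lk d e f) (lk d e A) (lk d e F) := by
  rw [isFunInterp, ev_conj, ev_all₃_imp₂]
  simp (disch := omega) only [ev_allIn, ev_ex, ev_exIn, ev_conj, ev_pairMem, ev_isFun, ev_isPair,
    ev_valueAt, ev_all_imp, ev_eq, lk_old, lk_new, lk_comp]
  exact ⟨fun ⟨h₁, h₂⟩ => ⟨h₁, h₂⟩, fun ⟨h₁, h₂⟩ => ⟨h₁, h₂⟩⟩

theorem ev_isRelInterp {q A J : ℕ} (hq : q < d) (hA : A < d) (hJ : J < d) :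
    Ev (isRelInterp q A J) d e ↔ IsRelInterp (lk d e q) (lk d e A) (lk d e J) := by
  simp (disch := omega) only [isRelInterp, ev_allIn, ev_ex, ev_conj, ev_pairMem, ev_isFun,
    ev_isPair, lk_old, lk_new, lk_comp]
  rfl

/-- The formula for `ValueClosed`. -/
def valueClosedFm (f A F v W : ℕ) : Fm :=
  all fun s => all fun y => pairMem s y W ⇾
    (ex fun n => isTagged 0 s n ⋏ pairMem n y v) ⋎
    (ex fun h => ex fun k => ex fun g => ex fun b =>
      pairMem h k f ⋏ isTagged₂ 1 s h g ⋏ isFun b k A ⋏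
      (all fun i => all fun t' => all fun m' =>
        pairMem i t' g ⇾ pairMem i m' b ⇾ pairMem t' m' W) ⋏
      valueAt F h b y)

theorem ev_valueClosedFm {f A F v W q : ℕ} (hf : f < d) (hA : A < d) (hF : F < d) (hv : v < d)
    (hW : W < d) : Ev (valueClosedFm f A F v W) d e ↔
      ValueClosed ⟨lk d e f, lk d e q, lk d e A, lk d e F⟩ (lk d e v) (lk d e W) := by
  rw [valueClosedFm, ev_all₂_imp]
  simp (disch := omega) only [ev_disj, ev_ex, ev_conj, ev_all₃_imp₂, ev_isTagged, ev_isTagged₂,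
    ev_pairMem, ev_isFun, ev_valueAt, lk_old, lk_new, lk_comp]
  rfl

/-- Values of terms do not involve the relation symbols, so the component `q` of the structure is
arbitrary. -/
theorem ev_hasValue {f A F v t m q : ℕ} (hf : f < d) (hA : A < d) (hF : F < d) (hv : v < d)
    (ht : t < d) (hm : m < d) : Ev (hasValue f A F v t m) d e ↔
      HasValue ⟨lk d e f, lk d e q, lk d e A, lk d e F⟩ (lk d e v) (lk d e t) (lk d e m) := by
  change Ev (ex fun W => pairMem t m W ⋏ valueClosedFm f A F v W) d e ↔ _
  rw [ev_ex]
  refine exists_congr fun W => ?_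
  rw [ev_conj, ev_valueClosedFm (q := d) (by omega) (by omega) (by omega) (by omega) (by omega)]
  simp (disch := omega) only [ev_pairMem, lk_old, lk_new]
  rfl

/-- The formula for `SatClosed`. -/
def satClosedFm (f q A F J W : ℕ) : Fm :=
  all fun χ => all fun w => pairMem χ w W ⇾
    (ex fun R => ex fun k => ex fun g => ex fun a =>
      pairMem R k q ⋏ isTagged₂ 0 χ R g ⋏ isFun a k A ⋏
      (all fun i => all fun t => all fun m =>
        pairMem i t g ⇾ pairMem i m a ⇾ hasValue f A F w t m) ⋏
      pairMem R a J) ⋎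
    (ex fun Φ => isTagged 1 χ Φ ⋏ allIn Φ fun ψ => pairMem ψ w W) ⋎
    (ex fun Φ => isTagged 2 χ Φ ⋏ exIn Φ fun ψ => pairMem ψ w W) ⋎
    (ex fun n => ex fun ψ => isTagged₂ 3 χ n ψ ⋏
      exIn A fun m => ex fun w' => isUpdate w' w n m ⋏ pairMem ψ w' W) ⋎
    (ex fun n => ex fun ψ => isTagged₂ 4 χ n ψ ⋏
      allIn A fun m => ex fun w' => isUpdate w' w n m ⋏ pairMem ψ w' W)

theorem ev_satClosedFm {f q A F J W : ℕ} (hf : f < d) (hq : q < d) (hA : A < d) (hF : F < d)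
    (hJ : J < d) (hW : W < d) : Ev (satClosedFm f q A F J W) d e ↔
      SatClosed ⟨lk d e f, lk d e q, lk d e A, lk d e F⟩ (lk d e J) (lk d e W) := by
  rw [satClosedFm, ev_all₂_imp]
  simp (disch := omega) only [ev_disj, ev_ex, ev_conj, ev_allIn, ev_exIn, ev_all₃_imp₂,
    ev_isTagged, ev_isTagged₂, ev_pairMem, ev_isFun, ev_isUpdate, ev_hasValue (q := q), lk_old,
    lk_new, lk_comp]
  rfl

theorem ev_satisfies {f q A F J φ v : ℕ} (hf : f < d) (hq : q < d) (hA : A < d) (hF : F < d)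
    (hJ : J < d) (hφ : φ < d) (hv : v < d) : Ev (satisfies f q A F J φ v) d e ↔
      Sat ⟨lk d e f, lk d e q, lk d e A, lk d e F⟩ (lk d e J) (lk d e φ) (lk d e v) := by
  change Ev (ex fun W => pairMem φ v W ⋏ satClosedFm f q A F J W) d e ↔ _
  simp (disch := omega) only [ev_ex, ev_conj, ev_pairMem, ev_satClosedFm, lk_old, lk_new]
  rfl

theorem ev_isModel {f q A F J T : ℕ} (hf : f < d) (hq : q < d) (hA : A < d) (hF : F < d)
    (hJ : J < d) (hT : T < d) : Ev (isModel f q A F J T) d e ↔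
      IsModel ⟨lk d e f, lk d e q, lk d e A, lk d e F⟩ (lk d e J) (lk d e T) := by
  rw [isModel, ev_allIn hT]
  simp only [ev_all₃_imp]
  simp only [ev_all (φ := fun v => _ ⇾ _ ⇾ _), ev_imp₂]
  simp (disch := omega) only [ev_isSequent, ev_isFun, ev_satisfies, lk_old, lk_new, lk_comp]
  constructor
  · intro h Q i D φ ψ v hs hv hφ
    exact h Q i _ hs Q (.refl Q) D φ ψ rfl Q (.refl Q) v Q (.refl Q) hv hφ
  · intro h Q i s hs R j D φ ψ e S k v U l hv hφ
    refine h (((i.trans j).trans k).trans l) _ _ (l (k ψ)) _ ?_ hv hφ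
    have := l.mem (k.mem (j.mem hs))
    simp only [e, map_pr] at this
    exact this

theorem ev_isExpansion {r q A I J : ℕ} (hr : r < d) (hq : q < d) (hA : A < d) (hI : I < d)
    (hJ : J < d) : Ev (isExpansion r q A I J) d e ↔
      IsExpansion (lk d e r) (lk d e q) (lk d e A) (lk d e I) (lk d e J) := by
  rw [isExpansion, ev_conj, ev_isRelInterp hq hA hJ, ev_all₃_imp]
  simp (disch := omega) only [ev_pairMem, ev_equi, lk_old, lk_new, lk_comp]
  refine ⟨fun ⟨h₁, h₂⟩ => ⟨h₁, fun Q i R k a h => ?_⟩, fun h => ⟨h.rel, fun Q i R k a hR S j => ?_⟩⟩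
  · exact h₂ Q i R k a h Q (.refl Q)
  · exact h.iff (i.trans j) (j R) (j k) (j a) (j.mem_pr hR)

theorem ev_isUnionOf {n J N : ℕ} (hn : n < d) (hJ : J < d) (hN : N < d) :
    Ev (isUnionOf n J N) d e ↔ IsUnionOf (lk d e n) (lk d e J) (lk d e N) := by
  rw [isUnionOf, ev_all₃_imp]
  simp (disch := omega) only [ev_pairMem, ev_exIn, ev_equi, lk_old, lk_new, lk_comp]
  refine ⟨fun h Q i R k a hR => h Q i R k a hR Q (.refl Q), fun h Q i R k a hR S j => ?_⟩
  exact h (i.trans j) (j R) (j k) (j a) (j.mem_pr hR)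

theorem ev_isRuleSet {R X : ℕ} (hR : R < d) (hX : X < d) :
    Ev (isRuleSet R X) d e ↔ IsRuleSet (lk d e R) (lk d e X) := by
  simp (disch := omega) only [isRuleSet, ev_allIn, ev_ex, ev_conj, ev_isPair, ev_sub,
    lk_old, lk_new, lk_comp]
  rfl

theorem ev_isClosed {R X Y : ℕ} (hR : R < d) (hX : X < d) (hY : Y < d) :
    Ev (isClosed R X Y) d e ↔ IsClosed (lk d e R) (lk d e X) (lk d e Y) := by
  rw [isClosed, ev_conj, ev_all₂_imp₂]
  simp (disch := omega) only [ev_pairMem, ev_exIn, ev_mem, ev_sub, lk_old, lk_new, lk_comp]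
  exact ⟨fun ⟨h₁, h₂⟩ => ⟨h₁, h₂⟩, fun ⟨h₁, h₂⟩ => ⟨h₁, h₂⟩⟩

end GameFormulas

end CZF

namespace CZF

section Satisfaction

variable {P Q R : PrimeTheory} {M : Str P} {J W χ w : P}

/-! ## The inductive clauses for satisfaction -/

/-- Truth of atoms and of subformulas occurs only positively in the clauses. This is why unions of
sets closed in the sense of `SatClosed` are again closed. -/
theorem Clause.mono {I I' : P → P → Prop} {Z Z' : Rel P} (h : Clause M I Z χ w)
    (hI : ∀ R a, I R a → I' R a) (hZ : ∀ ⦃Q⦄ (i : P ⇛ Q) ψ u, Z i ψ u → Z' i ψ u) :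
    Clause M I' Z' χ w := by
  rcases h with ⟨R, k, g, a, h₁, h₂, h₃, h₄, h₅⟩ | ⟨Φ, h₁, h₂⟩ | ⟨Φ, h₁, ψ, h₂, h₃⟩ |
    ⟨n, ψ, h₁, m, hm, w', h₂, h₃⟩ | ⟨n, ψ, h₁, h₂⟩
  · exact Or.inl ⟨R, k, g, a, h₁, h₂, h₃, h₄, hI _ _ h₅⟩
  · exact Or.inr (Or.inl ⟨Φ, h₁, fun Q i ψ hψ => hZ _ _ _ (h₂ Q i ψ hψ)⟩)
  · exact Or.inr (Or.inr (Or.inl ⟨Φ, h₁, ψ, h₂, hZ _ _ _ h₃⟩))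
  · exact Or.inr (Or.inr (Or.inr (Or.inl ⟨n, ψ, h₁, m, hm, w', h₂, hZ _ _ _ h₃⟩)))
  · refine Or.inr (Or.inr (Or.inr (Or.inr ⟨n, ψ, h₁, fun Q i m hm => ?_⟩)))
    obtain ⟨w', h₃, h₄⟩ := h₂ Q i m hm
    exact ⟨w', h₃, hZ _ _ _ h₄⟩

theorem HasValue.up {v t m : P} (h : HasValue M v t m) (i : P ⇛ Q) :
    HasValue (M.up i) (i v) (i t) (i m) :=
  let ⟨W, h₁, h₂⟩ := h
  ⟨i W, i.mem_pr h₁, fun _ j => h₂ (i.trans j)⟩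

theorem Clause.up {I : P → P → Prop} {Z : Rel P} (h : Clause M I Z χ w) (i : P ⇛ Q)
    {I' : Q → Q → Prop} (hI : ∀ R a, I R a → I' (i R) (i a))
    (hZ : ∀ ψ u, Z (.refl P) ψ u → Z i (i ψ) (i u)) :
    Clause (M.up i) I' (fun _ j => Z (i.trans j)) (i χ) (i w) := by
  rcases h with ⟨R, k, g, a, h₁, rfl, h₃, h₄, h₅⟩ | ⟨Φ, rfl, h₂⟩ | ⟨Φ, rfl, ψ, h₂, h₃⟩ |
    ⟨n, ψ, rfl, m, hm, w', h₂, h₃⟩ | ⟨n, ψ, rfl, h₂⟩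
  · exact Or.inl ⟨i R, i k, i g, i a, i.mem_pr h₁, by simp, h₃.up i, fun S j => h₄ S (i.trans j),
      hI _ _ h₅⟩
  · exact Or.inr (Or.inl ⟨i Φ, by simp, fun S j => h₂ S (i.trans j)⟩)
  · exact Or.inr (Or.inr (Or.inl ⟨i Φ, by simp, i ψ, i.mem h₂, hZ _ _ h₃⟩))
  · exact Or.inr (Or.inr (Or.inr (Or.inl ⟨i n, i ψ, by simp, i m, i.mem hm, i w', h₂.up i,
      hZ _ _ h₃⟩)))
  · exact Or.inr (Or.inr (Or.inr (Or.inr ⟨i n, i ψ, by simp, fun S j => h₂ S (i.trans j)⟩)))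

theorem SatClosed.up (h : SatClosed M J W) (i : P ⇛ Q) : SatClosed (M.up i) (i J) (i W) :=
  fun _ j => h (i.trans j)

theorem Sat.clause (h : Sat M J χ w) :
    Clause M (fun R a => pr R a ∈ J) (fun _ i ψ u => Sat (M.up i) (i J) ψ u) χ w := by
  obtain ⟨W, h₁, h₂⟩ := h
  exact (h₂ (.refl P) χ w h₁).mono (fun _ _ h => h) fun Q i ψ u h => ⟨i W, h, h₂.up i⟩

theorem SatClosed.adjoin (h : SatClosed M J W)
    (hc : Clause M (fun R a => pr R a ∈ J) (fun _ i ψ u => pr ψ u ∈ i W) χ w) :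
    SatClosed M J (adjoin W (pr χ w)) := by
  intro Q i χ' w' hp
  have hW : ∀ {R} (j : Q ⇛ R) ψ u, pr ψ u ∈ j (i W) →
      pr ψ u ∈ j (i (CZF.adjoin W (pr χ w))) := fun j ψ u h => by simp [h]
  rw [map_adjoin, mem_adjoin, map_pr, pr_inj] at hp
  rcases hp with hp | ⟨rfl, rfl⟩
  · exact (h i χ' w' hp).mono (fun _ _ h => h) fun R j => hW j
  · exact (hc.up i (I' := fun R a => pr R a ∈ i J) (fun _ _ h => i.mem_pr h)
      fun _ _ h => i.mem_pr h).mono (fun _ _ h => h) fun R j => hW j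

theorem sat_of_satClosed (h : SatClosed M J W)
    (hc : Clause M (fun R a => pr R a ∈ J) (fun _ i ψ u => pr ψ u ∈ i W) χ w) : Sat M J χ w :=
  ⟨_, by simp, h.adjoin hc⟩

/-- Strong Collection gathers witnessing sets for all pairs in `V` without choosing among them, and
their union is a common witness. -/
theorem exists_satClosed {V : P} (hV : ∀ ⦃Q⦄ (i : P ⇛ Q), ∀ p ∈ i V, ∃ χ w, p = pr χ w ∧
    Sat (M.up i) (i J) χ w) : ∃ W, SatClosed M J W ∧ Sub V W := by
  obtain ⟨b, h₁, h₂⟩ := collection (a := V)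
    (p := fun Q i p W => p ∈ W ∧ SatClosed (M.up i) (i J) W)
    (.of (5 ∊ 6 ⋏ satClosedFm 0 1 2 3 4 6) 5 (J ∷ M.F ∷ M.A ∷ M.q ∷ M.f ∷ fun _ => J)
      fun Q i p W => by simp [ev_satClosedFm]; exact fun _ => Iff.rfl)
    fun Q i p hp => by
      obtain ⟨χ, w, rfl, W, h₁, h₂⟩ := hV i p hp
      exact ⟨W, h₁, h₂⟩
  refine ⟨sUnion b, fun Q i χ w hp => ?_, fun Q i p hp => ?_⟩
  · rw [map_sUnion, mem_sUnion] at hp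
    obtain ⟨W, hW, hp⟩ := hp
    obtain ⟨p, hpV, -, hc⟩ := h₂ i W hW
    refine (hc (.refl Q) χ w hp).mono (fun _ _ h => h) fun R j ψ u h => ?_
    rw [map_sUnion, map_sUnion, mem_sUnion]
    exact ⟨j W, j.mem hW, h⟩
  · obtain ⟨W, hW, hp, -⟩ := h₁ i p hp
    rw [map_sUnion, mem_sUnion]
    exact ⟨W, hW, hp⟩

theorem isSet_pairs (Φ w : P) : IsSet fun _ i p => ∃ ψ ∈ i Φ, p = pr ψ (i w) :=
  isSet_image (r := fun _ i ψ p => p = pr ψ (i w))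
    (.of (isPair 2 1 0) 1 (w ∷ fun _ => w) fun Q i ψ p => by simp)
    fun Q i ψ _ => ⟨pr ψ (i w), fun R j z => by simp [Hom.trans]⟩

theorem isSet_updates {A w n ψ : P} (h : ∀ ⦃Q⦄ (i : P ⇛ Q), ∀ m ∈ i A,
    ∃ w', IsUpdate w' (i w) (i n) m) :
    IsSet fun _ i p => ∃ m ∈ i A, ∃ w', IsUpdate w' (i w) (i n) m ∧ p = pr (i ψ) w' := by
  refine isSet_image (r := fun _ i m p => ∃ w', IsUpdate w' (i w) (i n) m ∧ p = pr (i ψ) w')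
    (.of (ex fun w' => isUpdate w' 2 1 3 ⋏ isPair 4 0 w') 3 (w ∷ n ∷ ψ ∷ fun _ => ψ)
      fun Q i m p => by simp)
    fun Q i m hm => ?_
  obtain ⟨w', hw'⟩ := h i m hm
  refine ⟨pr (i ψ) w', fun R j z => ⟨?_, ?_⟩⟩
  · rintro ⟨u, hu, rfl⟩
    rw [map_pr, (hw'.up j).unique hu]
    rfl
  · rintro rfl
    exact ⟨j w', hw'.up j, by rw [map_pr]; rfl⟩

/-- For ⋁ and ∃ the witness for one subformula is extended by the new pair. For ⋀ and ∀ the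
witnesses for a whole set of instances are first united by `exists_satClosed`. -/
theorem Clause.sat
    (h : Clause M (fun R a => pr R a ∈ J) (fun _ i ψ u => Sat (M.up i) (i J) ψ u) χ w) :
    Sat M J χ w := by
  rcases h with ⟨R, k, g, a, h₁, h₂, h₃, h₄, h₅⟩ | ⟨Φ, h₁, h₂⟩ | ⟨Φ, h₁, ψ, h₂, W, h₃, h₄⟩ |
    ⟨n, ψ, h₁, m, hm, w', h₂, W, h₃, h₄⟩ | ⟨n, ψ, h₁, h₂⟩
  · refine sat_of_satClosed (W := ∅) (fun Q i χ w h => ?_)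
      (Or.inl ⟨R, k, g, a, h₁, h₂, h₃, h₄, h₅⟩)
    rw [map_empty] at h
    exact (not_mem_empty _ h).elim
  · have hs := isSet_pairs Φ w
    obtain ⟨W, hW, hV⟩ := exists_satClosed (M := M) (J := J) (V := hs.set) fun Q i p hp => by
      obtain ⟨ψ, hψ, rfl⟩ := (hs.mem_map i).1 hp
      exact ⟨ψ, i w, rfl, h₂ Q i ψ hψ⟩
    exact sat_of_satClosed hW (Or.inr (Or.inl ⟨Φ, h₁, fun Q i ψ hψ =>
      hV i _ ((hs.mem_map i).2 ⟨ψ, hψ, rfl⟩)⟩))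
  · exact sat_of_satClosed h₄ (Or.inr (Or.inr (Or.inl ⟨Φ, h₁, ψ, h₂, h₃⟩)))
  · exact sat_of_satClosed h₄ (Or.inr (Or.inr (Or.inr (Or.inl ⟨n, ψ, h₁, m, hm, w', h₂, h₃⟩))))
  · have hs := isSet_updates (A := M.A) (w := w) (n := n) (ψ := ψ) fun Q i m hm =>
      let ⟨w', h, _⟩ := h₂ Q i m hm; ⟨w', h⟩
    obtain ⟨W, hW, hV⟩ := exists_satClosed (M := M) (J := J) (V := hs.set) fun Q i p hp => by
      obtain ⟨m, hm, w', hw', rfl⟩ := (hs.mem_map i).1 hp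
      obtain ⟨u, hu, hsat⟩ := h₂ Q i m hm
      rw [hu.unique hw'] at hsat
      exact ⟨_, _, rfl, hsat⟩
    refine sat_of_satClosed hW (Or.inr (Or.inr (Or.inr (Or.inr ⟨n, ψ, h₁, fun Q i m hm => ?_⟩))))
    obtain ⟨u, hu, -⟩ := h₂ Q i m hm
    exact ⟨u, hu, hV i _ ((hs.mem_map i).2 ⟨m, hm, u, hu, rfl⟩)⟩

theorem sat_iff : Sat M J χ w ↔
    Clause M (fun R a => pr R a ∈ J) (fun _ i ψ u => Sat (M.up i) (i J) ψ u) χ w :=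
  ⟨Sat.clause, Clause.sat⟩

end Satisfaction

end CZF

namespace CZF

section Principles

variable {P Q R : PrimeTheory}

/-! ## The two principles in a world -/

/-- The principle of full NID. -/
def FullNID (P : PrimeTheory) : Prop :=
  ∀ ⦃Q : PrimeTheory⦄ (_ : P ⇛ Q) (X R : Q), IsRuleSet R X →
    ∃ G : Q, (∀ S (j : Q ⇛ S), ∀ β ∈ j G, IsClosed (j R) (j X) β) ∧
      ∀ S (j : Q ⇛ S) (α : S), IsClosed (j R) (j X) α → ∀ x ∈ α, ∃ β ∈ j G, x ∈ β ∧ Sub β α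

/-- `(A, F, I)` is a structure for the signature `(f, r)`, and `T` is a game theory over `(f, q)`,
where `q` consists of the symbols in `r` and the new symbols in `n`. -/
structure ExpansionData (om f r n q A F I T : P) : Prop where
  omega : IsOmega om
  arity_f : IsArity om f
  arity_r : IsArity om r
  arity_n : IsArity om n
  disj_f : NoCommonSymbol f n
  disj_r : NoCommonSymbol r n
  union : q = cup r n
  funInterp : IsFunInterp f A F
  relInterp : IsRelInterp r A I
  theory : IsGameTheory om f q T

/-- The principle that the models of a game theory which expand a structure are generated by a
set. -/
def ExpansionsGenerated (P : PrimeTheory) : Prop :=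
  ∀ ⦃Q : PrimeTheory⦄ (_ : P ⇛ Q) (om f r n q A F I T : Q), ExpansionData om f r n q A F I T →
    ∃ M : Q, (∀ S (j : Q ⇛ S), ∀ J ∈ j M, IsExpansion (j r) (j q) (j A) (j I) J ∧
        IsModel ⟨j f, j q, j A, j F⟩ J (j T)) ∧
      ∀ S (j : Q ⇛ S) (J : S), IsExpansion (j r) (j q) (j A) (j I) J →
        IsModel ⟨j f, j q, j A, j F⟩ J (j T) → ∃ N, Sub N (j M) ∧ IsUnionOf (j n) J N

theorem IsClosed.up {R X Y : P} (h : IsClosed R X Y) (i : P ⇛ Q) :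
    IsClosed (i R) (i X) (i Y) :=
  ⟨h.sub.up i, fun _ j => h.closed (i.trans j)⟩

theorem IsArity.up {om σ : P} (h : IsArity om σ) (i : P ⇛ Q) : IsArity (i om) (i σ) :=
  ⟨fun _ j => h.1 (i.trans j), h.2.up i⟩

theorem NoCommonSymbol.up {σ τ : P} (h : NoCommonSymbol σ τ) (i : P ⇛ Q) :
    NoCommonSymbol (i σ) (i τ) :=
  fun _ j => h (i.trans j)

theorem IsFunInterp.up {f A F : P} (h : IsFunInterp f A F) (i : P ⇛ Q) :
    IsFunInterp (i f) (i A) (i F) :=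
  ⟨fun _ j => h.sub (i.trans j), fun _ j => h.total (i.trans j)⟩

theorem IsRelInterp.up {q A J : P} (h : IsRelInterp q A J) (i : P ⇛ Q) :
    IsRelInterp (i q) (i A) (i J) :=
  fun _ j => h (i.trans j)

theorem IsGameTheory.up {om f q T : P} (h : IsGameTheory om f q T) (i : P ⇛ Q) :
    IsGameTheory (i om) (i f) (i q) (i T) :=
  fun _ j => h (i.trans j)

theorem IsExpansion.up {r q A I J : P} (h : IsExpansion r q A I J) (i : P ⇛ Q) :
    IsExpansion (i r) (i q) (i A) (i I) (i J) :=
  ⟨h.rel.up i, fun _ j => h.iff (i.trans j)⟩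

theorem ExpansionData.up {om f r n q A F I T : P} (h : ExpansionData om f r n q A F I T)
    (i : P ⇛ Q) : ExpansionData (i om) (i f) (i r) (i n) (i q) (i A) (i F) (i I) (i T) where
  omega := h.omega.up i
  arity_f := h.arity_f.up i
  arity_r := h.arity_r.up i
  arity_n := h.arity_n.up i
  disj_f := h.disj_f.up i
  disj_r := h.disj_r.up i
  union := by rw [h.union, map_cup]
  funInterp := h.funInterp.up i
  relInterp := h.relInterp.up i
  theory := h.theory.up i

theorem FullNID.up (h : FullNID P) (i : P ⇛ Q) : FullNID Q := fun _ j => h (i.trans j)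

theorem ExpansionsGenerated.up (h : ExpansionsGenerated P) (i : P ⇛ Q) : ExpansionsGenerated Q :=
  fun _ j => h (i.trans j)

theorem ev_fullNID {e : ℕ → P} : Ev fullNID 0 e ↔ FullNID P := by
  simp only [fullNID, ev_all₂_imp]
  refine forall₄_congr fun Q i X R => ?_
  rw [ev_isRuleSet (by omega) (by omega), ev_ex]
  refine forall_congr' fun hR => exists_congr fun G => ?_
  rw [ev_conj, ev_allIn (by omega), ev_all_imp]
  refine and_congr ?_ ?_
  · refine forall₄_congr fun S j β _ => ?_
    rw [ev_isClosed (by omega) (by omega) (by omega)]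
    rfl
  · simp (disch := omega) only [ev_isClosed, ev_allIn, ev_exIn, ev_conj, ev_mem, ev_sub, lk_old,
      lk_new, lk_comp]
    exact ⟨fun h S j α hα x hx => h S j α hα S (.refl S) x hx,
      fun h S j α hα U k x hx => h U (j.trans k) (k α) (hα.up k) x hx⟩

theorem expansionsGenerated_of_ev {e : ℕ → P} (h : Ev expansionsGenerated 0 e) :
    ExpansionsGenerated P := by
  simp (disch := omega) only [expansionsGenerated, ev_all, ev_impl, ev_isOmega, ev_isArity,
    ev_noCommonSymbol, ev_isUnion, ev_isFunInterp, ev_isRelInterp, ev_isGameTheory, lk_old, lk_new,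
    lk_comp] at h
  intro Q i om f r n q A F I T hd
  have h₁ := h Q i om Q (.refl Q) hd.omega Q (.refl Q) f Q (.refl Q) r Q (.refl Q) n Q (.refl Q) q
    Q (.refl Q) hd.arity_f Q (.refl Q) hd.arity_r Q (.refl Q) hd.arity_n Q (.refl Q) hd.disj_f
    Q (.refl Q) hd.disj_r Q (.refl Q) hd.union Q (.refl Q) A Q (.refl Q) F Q (.refl Q) I
    Q (.refl Q) hd.funInterp Q (.refl Q) hd.relInterp Q (.refl Q) T Q (.refl Q) hd.theory
  obtain ⟨M, hM⟩ := ev_ex.1 h₁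
  rw [ev_conj, ev_allIn (by omega)] at hM
  simp (disch := omega) only [ev_conj, ev_all, ev_ex, ev_impl, ev_isExpansion, ev_isModel, ev_sub,
    ev_isUnionOf, lk_old, lk_new, lk_comp] at hM
  exact ⟨M, hM.1, fun S j J hJ hJ' => hM.2 S j J S (.refl S) hJ S (.refl S) hJ'⟩

theorem ev_of_expansionsGenerated {e : ℕ → P} (h : ExpansionsGenerated P) :
    Ev expansionsGenerated 0 e := by
  simp (disch := omega) only [expansionsGenerated, ev_all, ev_impl, ev_isOmega, ev_isArity,
    ev_noCommonSymbol, ev_isUnion, ev_isFunInterp, ev_isRelInterp, ev_isGameTheory, lk_old, lk_new,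
    lk_comp]
  intro _ i1 om _ i2 ho _ i3 f _ i4 r _ i5 n _ i6 q _ i7 hf _ i8 hr _ i9 hn _ i10 hfn _ i11 hrn
    _ i12 hq _ i13 A _ i14 F _ i15 I _ i16 hF _ i17 hI _ i18 T Q t18 hT
  -- Each quantifier and each implication has introduced a world of its own. The map `tk` carries
  -- the world reached by `ik` to the last one, where all data are compared.
  let t17 := i18.trans t18
  let t16 := i17.trans t17
  let t15 := i16.trans t16
  let t14 := i15.trans t15
  let t13 := i14.trans t14
  let t12 := i13.trans t13
  let t11 := i12.trans t12
  let t10 := i11.trans t11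
  let t9 := i10.trans t10
  let t8 := i9.trans t9
  let t7 := i8.trans t8
  let t6 := i7.trans t7
  let t5 := i6.trans t6
  let t4 := i5.trans t5
  let t3 := i4.trans t4
  let t2 := i3.trans t3
  let t1 := i2.trans t2
  have hd : ExpansionData (t1 om) (t3 f) (t4 r) (t5 n) (t6 q) (t13 A) (t14 F) (t15 I) (t18 T) :=
    ⟨ho.up t2, hf.up t7, hr.up t8, hn.up t9, hfn.up t10, hrn.up t11,
      (congrArg t12 hq).trans (map_cup t12 _ _), hF.up t16, hI.up t17, hT⟩
  obtain ⟨M, h₁, h₂⟩ := h (i1.trans t1) _ _ _ _ _ _ _ _ _ hd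
  refine ev_ex.2 ⟨M, ?_⟩
  rw [ev_conj, ev_allIn (by omega)]
  simp (disch := omega) only [ev_conj, ev_all, ev_ex, ev_impl, ev_isExpansion, ev_isModel, ev_sub,
    ev_isUnionOf, lk_old, lk_new, lk_comp]
  exact ⟨h₁, fun S j J U k hJ V l hJ' => h₂ V ((j.trans k).trans l) (l (k J)) (hJ.up l) hJ'⟩

end Principles

end CZF

namespace CZF

section Propositional

variable {P Q : PrimeTheory}

/-! ## Full NID from the generation of expansions -/

theorem eq_empty_of_isFun {g A : P} (h : IsFun g ∅ A) : g = ∅ :=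
  ext fun Q i p => by
    refine iff_of_false (fun hp => ?_) (by simp)
    obtain ⟨x, hx, -⟩ := h.sub i p hp
    simp at hx

theorem isFun_empty (A : P) : IsFun ∅ ∅ A where
  sub Q i p hp := by simp at hp
  total Q i x hx := by simp at hx
  functional Q i x y y' h := by simp at h

theorem isSet_atoms (a : P) : IsSet fun _ i z => ∃ x ∈ i a, z = tag 0 (pr x ∅) :=
  isSet_image (r := fun _ i x z => z = tag 0 (pr x ∅))
    (.of (isTagged₂ 0 2 1 0) 1 (∅ ∷ fun _ => a) fun Q i x z => by simp)
    fun Q i x _ => ⟨tag 0 (pr x ∅), fun R j z => by simp⟩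

/-- The set of propositional variables with names in `a`. -/
noncomputable def atoms (a : P) : P := (isSet_atoms a).set

@[simp] theorem mem_atoms {a z : P} : z ∈ atoms a ↔ ∃ x ∈ a, z = tag 0 (pr x ∅) :=
  (isSet_atoms a).mem

@[simp] theorem map_atoms (i : P ⇛ Q) (a : P) : i (atoms a) = atoms (i a) :=
  ext fun _ j _ => ((isSet_atoms a).mem_map (i.trans j)).trans
    ((isSet_atoms (i a)).mem_map j).symm

/-- The formula which says that `y` is `atoms a`, where `o` is the empty set. -/
def atomsFm (o a y : ℕ) : Fm := all fun z => z ∊ y ⇿ exIn a fun x => isTagged₂ 0 z x o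

theorem ev_atomsFm {d o a y : ℕ} {e : ℕ → P} (ho : o < d) (ha : a < d) (hy : y < d)
    (hoe : lk d e o = ∅) : Ev (atomsFm o a y) d e ↔ lk d e y = atoms (lk d e a) := by
  rw [atomsFm, ev_all_iff]
  simp (disch := omega) only [ev_mem, ev_exIn, ev_isTagged₂, lk_old, lk_new, lk_comp, hoe,
    map_empty]
  refine ⟨fun h => ext fun Q i z => ?_, fun h Q i z => ?_⟩
  · rw [h Q i z, map_atoms, mem_atoms]
  · rw [h, map_atoms, mem_atoms]

/-- The sequent which expresses the rule `(a, b)`. -/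
noncomputable def ruleSequent (a b : P) : P := pr ∅ (pr (tag 1 (atoms a)) (tag 2 (atoms b)))

theorem isSet_ruleSequents {R X : P} (hR : IsRuleSet R X) :
    IsSet fun _ i s => ∃ ρ ∈ i R, ∃ a b, ρ = pr a b ∧ s = ruleSequent a b := by
  refine isSet_image (r := fun _ i ρ s => ∃ a b, ρ = pr a b ∧ s = ruleSequent a b)
    (.of (ex fun a => ex fun b => isPair 1 a b ⋏ ex fun y => ex fun z => ex fun u => ex fun v =>
      atomsFm 0 a y ⋏ atomsFm 0 b z ⋏ isTagged 1 u y ⋏ isTagged 2 v z ⋏ isSequent 2 0 u v) 1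
      (∅ ∷ fun _ => R) fun Q i ρ s => ?_) fun Q i ρ hρ => ?_
  · simp (disch := simp) [ev_atomsFm, ruleSequent]
  · obtain ⟨a, b, rfl, -⟩ := hR i ρ hρ
    refine ⟨ruleSequent a b, fun S j s => ?_⟩
    simp [ruleSequent]

/-- All propositional variables with names in `X`, together with the formula itself and each with
the empty set of free variables, form a set closed under subformulas. -/
theorem isGameFormula_atoms {om X a : P} {k : ℕ} (hk : k = 1 ∨ k = 2) (ha : Sub a X) {n : P}
    (hn : ∀ ⦃Q⦄ (i : P ⇛ Q), ∀ x ∈ i X, pr x ∅ ∈ i n) :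
    IsGameFormula om ∅ n ∅ (tag k (atoms a)) := by
  have hs : IsSet fun _ i p => ∃ x ∈ i X, p = pr ∅ (tag 0 (pr x ∅)) :=
    isSet_image (r := fun _ i x p => p = pr ∅ (tag 0 (pr x ∅)))
      (.of (ex fun z => isTagged₂ 0 z 1 0 ⋏ isPair 2 0 z) 1 (∅ ∷ fun _ => a) fun Q i x z => by simp)
      fun Q i x _ => ⟨pr ∅ (tag 0 (pr x ∅)), fun R j z => by simp⟩
  refine ⟨adjoin hs.set (pr ∅ (tag k (atoms a))), by simp, fun Q i E χ hp => ?_⟩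
  rw [map_adjoin, mem_adjoin, hs.mem_map i] at hp
  have key : ∀ R (j : Q ⇛ R), ∀ ψ ∈ j (atoms (i a)),
      pr (j ∅) ψ ∈ j (i (adjoin hs.set (pr ∅ (tag k (atoms a))))) := by
    intro R j ψ hψ
    rw [map_atoms, mem_atoms] at hψ
    obtain ⟨x, hx, rfl⟩ := hψ
    have : pr ∅ (tag 0 (pr x ∅)) ∈ j (i hs.set) :=
      (hs.mem_map (i.trans j)).2 ⟨x, ha (i.trans j) x hx, rfl⟩
    simp [this]
  rcases hp with ⟨x, hx, hp⟩ | hp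
  · rw [pr_inj] at hp
    obtain ⟨rfl, rfl⟩ := hp
    exact Or.inl ⟨x, ∅, ∅, hn i x hx, ⟨∅, isFun_empty _, fun R j t ht => by simp at ht⟩, rfl⟩
  · simp only [map_pr, map_empty, map_tag, map_atoms, pr_inj] at hp
    obtain ⟨rfl, rfl⟩ := hp
    rcases hk with rfl | rfl
    · exact Or.inr (Or.inl ⟨_, rfl, key⟩)
    · exact Or.inr (Or.inr (Or.inl ⟨_, rfl, key⟩))

/-- The structure without elements for the signature without function symbols and with relation
symbols `n`. -/
noncomputable def emptyStr (n : P) : Str P := ⟨∅, n, ∅, ∅⟩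

theorem up_emptyStr (n : P) (i : P ⇛ Q) : (emptyStr n).up i = emptyStr (i n) := by
  simp [emptyStr, Str.up]

/-- The arity can only be 0, and the only tuple of length 0 is ∅; the conditions on the values of
terms are vacuous. -/
theorem sat_atom {n J x : P} (hn : ∀ k, pr x k ∈ n ↔ k = ∅) :
    Sat (emptyStr n) J (tag 0 (pr x ∅)) ∅ ↔ pr x ∅ ∈ J := by
  rw [sat_iff]
  constructor
  · rintro (⟨R, k, g, a, h₁, h₂, h₃, -, h₅⟩ | ⟨Φ, h, -⟩ | ⟨Φ, h, -⟩ | ⟨n, ψ, h, -⟩ |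
      ⟨n, ψ, h, -⟩) <;>
      simp only [tag_inj, pr_inj, true_and, OfNat.zero_ne_ofNat, false_and,
        zero_ne_one] at *
    obtain ⟨rfl, rfl⟩ := h₂
    obtain rfl := (hn k).1 h₁
    rwa [eq_empty_of_isFun h₃] at h₅
  · intro h
    exact Or.inl ⟨x, ∅, ∅, ∅, (hn ∅).2 rfl, rfl, isFun_empty _, fun Q i l t m h => by simp at h, h⟩

theorem sat_conj_atoms {n J a : P}
    (hn : ∀ ⦃Q⦄ (i : P ⇛ Q), ∀ x ∈ i a, ∀ k, pr x k ∈ i n ↔ k = ∅) :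
    Sat (emptyStr n) J (tag 1 (atoms a)) ∅ ↔ ∀ ⦃Q⦄ (i : P ⇛ Q), ∀ x ∈ i a, pr x ∅ ∈ i J := by
  rw [sat_iff]
  constructor
  · rintro (⟨R, k, g, a, -, h, -⟩ | ⟨Φ, h, h'⟩ | ⟨Φ, h, -⟩ | ⟨n, ψ, h, -⟩ | ⟨n, ψ, h, -⟩) <;>
      simp at h
    subst h
    intro Q i x hx
    have : Sat ((emptyStr n).up i) (i J) (tag 0 (pr x ∅)) (i ∅) :=
      h' Q i _ (by rw [map_atoms, mem_atoms]; exact ⟨x, hx, rfl⟩)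
    rw [up_emptyStr, map_empty] at this
    exact (sat_atom (hn i x hx)).1 this
  · intro h
    refine Or.inr (Or.inl ⟨_, rfl, fun Q i ψ hψ => ?_⟩)
    rw [map_atoms, mem_atoms] at hψ
    obtain ⟨x, hx, rfl⟩ := hψ
    rw [up_emptyStr, map_empty]
    exact (sat_atom (hn i x hx)).2 (h i x hx)

theorem sat_disj_atoms {n J b : P} (hn : ∀ x ∈ b, ∀ k, pr x k ∈ n ↔ k = ∅) :
    Sat (emptyStr n) J (tag 2 (atoms b)) ∅ ↔ ∃ x ∈ b, pr x ∅ ∈ J := by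
  rw [sat_iff]
  constructor
  · rintro (⟨R, k, g, a, -, h, -⟩ | ⟨Φ, h, -⟩ | ⟨Φ, h, ψ, hψ, h'⟩ | ⟨n, ψ, h, -⟩ | ⟨n, ψ, h, -⟩) <;>
      simp at h
    subst h
    rw [mem_atoms] at hψ
    obtain ⟨x, hx, rfl⟩ := hψ
    exact ⟨x, hx, (sat_atom (hn x hx)).1 h'⟩
  · rintro ⟨x, hx, h⟩
    exact Or.inr (Or.inr (Or.inl ⟨_, rfl, _, mem_atoms.2 ⟨x, hx, rfl⟩, (sat_atom (hn x hx)).2 h⟩))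

theorem isSet_trueAtoms (X J : P) : IsSet fun _ i x => x ∈ i X ∧ pr x ∅ ∈ i J :=
  isSet_sep (p := fun _ i x => pr x ∅ ∈ i J)
    (.of (pairMem 2 0 1) 2 (J ∷ ∅ ∷ fun _ => X) fun Q i x => by simp)
    fun Q i x _ => (small_mem (pr x ∅) (i J)).congr fun R j => by simp; rfl

/-- A closed set `α` is the model in which exactly the propositional variables from `α` are true. If
this model is a union of models from a set, then `α` is the union of the closed sets belonging to
these. -/
theorem fullNID_of_expansionsGenerated (h : ExpansionsGenerated P) : FullNID P := by
  intro Q i X R hR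
  replace h := h.up i
  clear i
  obtain ⟨om, hom⟩ := exists_omega Q
  let n : Q := (isSet_pairs X ∅).set
  have mem_n : ∀ {S} (j : Q ⇛ S) {p : S}, p ∈ j n ↔ ∃ x ∈ j X, p = pr x ∅ := fun {S} j {p} => by
    rw [(isSet_pairs X ∅).mem_map j, map_empty]
  have pr_mem_n : ∀ {S} (j : Q ⇛ S) {x k : S}, pr x k ∈ j n ↔ x ∈ j X ∧ k = ∅ := by
    intro S j x k
    rw [mem_n]
    simp only [pr_inj]
    exact ⟨fun ⟨y, hy, h⟩ => ⟨h.1 ▸ hy, h.2⟩, fun h => ⟨x, h.1, rfl, h.2⟩⟩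
  have hn : ∀ {S} (j : Q ⇛ S) {a : S}, Sub a (j X) → ∀ ⦃U⦄ (k : S ⇛ U), ∀ x ∈ k a, ∀ l,
      pr x l ∈ k (j n) ↔ l = ∅ := fun {S} j {a} ha U k x hx l =>
    (pr_mem_n (j.trans k)).trans (and_iff_right (ha k x hx))
  have hT := isSet_ruleSequents hR
  -- The old signature and the structure are empty; the only symbols are the nullary relation
  -- symbols named by elements of `X`.
  obtain ⟨M, hM, hgen⟩ := h (.refl Q) om ∅ ∅ n n ∅ ∅ ∅ hT.set
    { omega := hom
      arity_f := ⟨fun S j p hp => by simp at hp, fun S j x y y' h => by simp at h⟩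
      arity_r := ⟨fun S j p hp => by simp at hp, fun S j x y y' h => by simp at h⟩
      arity_n := by
        refine ⟨fun S j p hp => ?_, fun S j x y y' h₁ h₂ => ?_⟩
        · obtain ⟨x, -, rfl⟩ := (mem_n j).1 hp
          exact ⟨x, ∅, (hom j ∅).2 (Or.inl rfl), rfl⟩
        · rw [((pr_mem_n j).1 h₁).2, ((pr_mem_n j).1 h₂).2]
      disj_f := fun S j x k l h => by simp at h
      disj_r := fun S j x k l h => by simp at h
      union := ext fun S j x => by simp
      funInterp := ⟨fun S j p hp => by simp at hp, fun S j h k b hp => by simp at hp⟩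
      relInterp := fun S j p hp => by simp at hp
      theory := by
        intro S j s hs
        obtain ⟨ρ, hρ, a, b, rfl, rfl⟩ := (hT.mem_map j).1 hs
        obtain ⟨a', b', e, ha, hb⟩ := hR j _ hρ
        rw [pr_inj] at e
        obtain ⟨rfl, rfl⟩ := e
        have hn' : ∀ ⦃U⦄ (k : S ⇛ U), ∀ x ∈ k (j X), pr x ∅ ∈ k (j n) := fun U k x hx =>
          (pr_mem_n (j.trans k)).2 ⟨hx, rfl⟩
        refine ⟨∅, _, _, rfl, fun U k z hz => by simp at hz, ?_, ?_⟩
        · simpa using isGameFormula_atoms (Or.inl rfl) ha hn'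
        · simpa using isGameFormula_atoms (Or.inr rfl) hb hn' }
  -- The generating set consists of the sets of propositional variables true in the models from `M`.
  have hG : IsSet fun _ j Y => ∃ J ∈ j M, ∀ ⦃S⦄ (k : _ ⇛ S) (x : S),
      x ∈ k Y ↔ x ∈ k (j X) ∧ pr x ∅ ∈ k J := by
    refine isSet_image (r := fun U j J Y => ∀ ⦃S⦄ (k : U ⇛ S) (x : S),
      x ∈ k Y ↔ x ∈ k (j X) ∧ pr x ∅ ∈ k J)
      (.of (all fun x => x ∊ 3 ⇿ x ∊ 1 ⋏ pairMem x 0 2) 2 (X ∷ ∅ ∷ fun _ => X) fun S j J Y => ?_)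
      fun S j J hJ => ⟨(isSet_trueAtoms (j X) J).set, fun U k Y => ⟨fun h => ?_, ?_⟩⟩
    · simp [ev_all_iff]
    · exact ext fun V l x => (h l x).trans ((isSet_trueAtoms (j X) J).mem_map (k.trans l)).symm
    · rintro rfl V l x
      exact (isSet_trueAtoms (j X) J).mem_map (k.trans l)
  have str : ∀ {S} (j : Q ⇛ S), (⟨j ∅, j n, j ∅, j ∅⟩ : Str S) = emptyStr (j n) := fun j => by
    simp [emptyStr]
  refine ⟨hG.set, fun S j Y hY => ?_, fun S j α hα x hx => ?_⟩
  · obtain ⟨J, hJ, hY⟩ := (hG.mem_map j).1 hY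
    obtain ⟨-, hmod⟩ := hM S j J hJ
    rw [str] at hmod
    refine ⟨fun U k x hx => ((hY k x).1 hx).1, fun U k a b hab ha => ?_⟩
    obtain ⟨a', b', e, haX, hbX⟩ := hR (j.trans k) _ hab
    rw [pr_inj] at e
    obtain ⟨rfl, rfl⟩ := e
    have := hmod k ∅ (tag 1 (atoms a)) (tag 2 (atoms b)) ∅
      ((hT.mem_map (j.trans k)).2 ⟨_, hab, a, b, rfl, rfl⟩)
      (by simpa [emptyStr] using isFun_empty _)
    rw [up_emptyStr] at this
    obtain ⟨y, hy, hyJ⟩ := (sat_disj_atoms (hn (j.trans k) hbX (.refl U))).1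
      (this ((sat_conj_atoms (hn (j.trans k) haX)).2 fun V l x hx =>
        ((hY (k.trans l) x).1 (ha l x hx)).2))
    exact ⟨y, hy, (hY k y).2 ⟨hbX.mem hy, hyJ⟩⟩
  · have hJ := isSet_pairs α ∅
    have mem_J : ∀ {U} (k : S ⇛ U) {x : U}, pr x ∅ ∈ k hJ.set ↔ x ∈ k α := by
      intro U k x
      rw [hJ.mem_map k]
      simp
    obtain ⟨N, hN, hun⟩ := hgen S j hJ.set
      ⟨fun U k p hp => by
        obtain ⟨x, hx, rfl⟩ := (hJ.mem_map k).1 hp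
        exact ⟨x, ∅, ∅, (pr_mem_n (j.trans k)).2 ⟨hα.sub k x hx, rfl⟩, by simpa using isFun_empty _,
          by simp⟩, fun U k R l a h => by simp at h⟩
      (by
        rw [str]
        intro U k D φ ψ v hs hv hφ
        obtain ⟨ρ, hρ, a, b, rfl, e⟩ := (hT.mem_map (j.trans k)).1 hs
        obtain ⟨a', b', e', haX, hbX⟩ := hR (j.trans k) _ hρ
        simp only [pr_inj, ruleSequent] at e e'
        obtain ⟨rfl, rfl⟩ := e'
        obtain ⟨rfl, rfl, rfl⟩ := e
        obtain rfl := eq_empty_of_isFun hv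
        rw [up_emptyStr] at hφ ⊢
        have ha := (sat_conj_atoms (hn (j.trans k) haX)).1 hφ
        obtain ⟨y, hy, hyα⟩ := hα.closed k a b hρ fun V l x hx =>
          (mem_J (k.trans l)).1 (ha l x hx)
        exact (sat_disj_atoms (hn (j.trans k) hbX (.refl U))).2 ⟨y, hy, (mem_J k).2 hyα⟩)
    have hun' : ∀ {U} (k : S ⇛ U) {x : U}, x ∈ k (j X) → (x ∈ k α ↔ ∃ K ∈ k N, pr x ∅ ∈ K) :=
      fun k x hx => (mem_J k).symm.trans (hun k _ _ _ ((pr_mem_n (j.trans k)).2 ⟨hx, rfl⟩))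
    -- One of the models with union `α` makes `x` true; everything true in it lies in `α`.
    obtain ⟨K, hK, hxK⟩ := (hun' (.refl S) (hα.sub.mem hx)).1 hx
    have hY := isSet_trueAtoms (j X) K
    refine ⟨hY.set, (hG.mem_map j).2 ⟨K, hN.mem hK, fun U k x => hY.mem_map k⟩,
      hY.mem.2 ⟨hα.sub.mem hx, hxK⟩, fun U k z hz => ?_⟩
    obtain ⟨hz, hzK⟩ := (hY.mem_map k).1 hz
    exact (hun' k hz).2 ⟨k K, k.mem hK, hzK⟩

end Propositional

end CZF

namespace CZF

section Values

variable {P Q R : PrimeTheory} {M : Str P} {v W : P}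

/-! ## Values of terms -/

/-- One inclusion suffices, because `g` is total and `g'` is single-valued on the same domain. -/
theorem IsFun.ext {g g' X Y Y' : P} (h : IsFun g X Y) (h' : IsFun g' X Y')
    (hs : ∀ ⦃Q⦄ (i : P ⇛ Q) (x y : Q), pr x y ∈ i g → pr x y ∈ i g') : g = g' := by
  refine CZF.ext fun Q i p => ⟨fun hp => ?_, fun hp => ?_⟩
  · obtain ⟨x, -, y, -, rfl⟩ := h.sub i p hp
    exact hs i x y hp
  · obtain ⟨x, hx, y, -, rfl⟩ := h'.sub i p hp
    obtain ⟨y', -, hy'⟩ := (h.up i).value hx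
    rwa [(h'.up i).functional.eq hp (hs i x y' hy')]

theorem ValueClosed.up (h : ValueClosed M v W) (i : P ⇛ Q) : ValueClosed (M.up i) (i v) (i W) :=
  fun _ j => h (i.trans j)

/-- The condition for `⟨s, y⟩` to be an element of a set of terms with their values. -/
def ValueClause (M : Str P) (v W s y : P) : Prop :=
  (∃ n, s = tag 0 n ∧ pr n y ∈ v) ∨
  (∃ h k g b, pr h k ∈ M.f ∧ s = tag 1 (pr h g) ∧ IsFun b k M.A ∧
    (∀ R (j : P ⇛ R) (l t m : R), pr l t ∈ j g → pr l m ∈ j b → pr t m ∈ j W) ∧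
    pr (pr h b) y ∈ M.F)

theorem ValueClause.mono {W' s y : P} (h : ValueClause M v W s y) (hW : Sub W W') :
    ValueClause M v W' s y := by
  rcases h with h | ⟨h, k, g, b, h₁, h₂, h₃, h₄, h₅⟩
  · exact Or.inl h
  · exact Or.inr ⟨h, k, g, b, h₁, h₂, h₃, fun R j l t m hl hm => hW j _ (h₄ R j l t m hl hm), h₅⟩

theorem ValueClause.up {s y : P} (h : ValueClause M v W s y) (i : P ⇛ Q) :
    ValueClause (M.up i) (i v) (i W) (i s) (i y) := by
  rcases h with ⟨n, rfl, h⟩ | ⟨h, k, g, b, h₁, rfl, h₃, h₄, h₅⟩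
  · exact Or.inl ⟨i n, by simp, i.mem_pr h⟩
  · refine Or.inr ⟨i h, i k, i g, i b, i.mem_pr h₁, by simp, h₃.up i, fun R j => h₄ R (i.trans j),
      ?_⟩
    have := i.mem_pr h₅
    rwa [map_pr] at this

theorem ValueClosed.adjoin {s y : P} (h : ValueClosed M v W) (hc : ValueClause M v W s y) :
    ValueClosed M v (adjoin W (pr s y)) := by
  intro Q i s' y' hp
  have hW : Sub (i W) (i (CZF.adjoin W (pr s y))) := fun R j p hp => by simp [hp]
  rw [map_adjoin, mem_adjoin, map_pr, pr_inj] at hp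
  rcases hp with hp | ⟨rfl, rfl⟩
  · exact ValueClause.mono (M := M.up i) (h i s' y' hp) hW
  · exact (hc.up i).mono hW

theorem HasValue.clause {s y : P} (h : HasValue M v s y) : ∃ W, ValueClosed M v W ∧
    ValueClause M v W s y :=
  let ⟨W, h₁, h₂⟩ := h
  ⟨W, h₂, h₂ (.refl P) s y h₁⟩

theorem exists_valueClosed {V : P} (hV : ∀ ⦃Q⦄ (i : P ⇛ Q), ∀ p ∈ i V, ∃ s y, p = pr s y ∧
    HasValue (M.up i) (i v) s y) : ∃ W, ValueClosed M v W ∧ Sub V W := by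
  obtain ⟨b, h₁, h₂⟩ := collection (a := V)
    (p := fun Q i p W => p ∈ W ∧ ValueClosed (M.up i) (i v) W)
    (.of (5 ∊ 6 ⋏ valueClosedFm 0 2 3 4 6) 5 (v ∷ M.F ∷ M.A ∷ M.q ∷ M.f ∷ fun _ => v)
      fun Q i p W => by simp [ev_valueClosedFm (q := 1)]; exact fun _ => Iff.rfl)
    fun Q i p hp => by
      obtain ⟨s, y, rfl, W, h₁, h₂⟩ := hV i p hp
      exact ⟨W, h₁, h₂⟩
  refine ⟨sUnion b, fun Q i s y hp => ?_, fun Q i p hp => ?_⟩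
  · rw [map_sUnion, mem_sUnion] at hp
    obtain ⟨W, hW, hp⟩ := hp
    obtain ⟨p, hpV, -, hc⟩ := h₂ i W hW
    refine ValueClause.mono (M := M.up i) (hc (.refl Q) s y hp) fun R j p hp => ?_
    rw [map_sUnion, map_sUnion, mem_sUnion]
    exact ⟨j W, j.mem hW, hp⟩
  · obtain ⟨W, hW, hp, -⟩ := h₁ i p hp
    rw [map_sUnion, mem_sUnion]
    exact ⟨W, hW, hp⟩

/-- The term `t` has exactly one value under `v`, which is an element of the structure. -/
def UniqueValue (M : Str P) (v t : P) : Prop := ∃ m ∈ M.A, HasValue M v t m ∧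
  ∀ Q (i : P ⇛ Q) m', HasValue (M.up i) (i v) (i t) m' → m' = i m

/-- The elements of the tuple `a` are values of the terms in the tuple `g`. -/
def ValueTuple (M : Str P) (v g a : P) : Prop :=
  ∀ Q (i : P ⇛ Q) (l t m : Q), pr l t ∈ i g → pr l m ∈ i a → HasValue (M.up i) (i v) t m

/-- Uniqueness of the values lets replacement form the tuple, with no appeal to choice. -/
theorem exists_valueTuple {g k Y : P} (hg : IsFun g k Y)
    (H : ∀ ⦃Q⦄ (i : P ⇛ Q) (l t : Q), pr l t ∈ i g → UniqueValue (M.up i) (i v) t) :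
    ∃ a, IsFun a k M.A ∧ ValueTuple M v g a ∧ ∀ ⦃Q⦄ (i : P ⇛ Q) (a' : Q),
      IsFun a' (i k) (i M.A) → ValueTuple (M.up i) (i v) (i g) a' → a' = i a := by
  have ha : IsSet fun _ i p => ∃ l ∈ i k, ∃ t m, pr l t ∈ i g ∧
      HasValue (M.up i) (i v) t m ∧ p = pr l m := by
    refine isSet_image (r := fun _ i l p => ∃ t m, pr l t ∈ i g ∧
      HasValue (M.up i) (i v) t m ∧ p = pr l m)
      (.of (ex fun t => ex fun m => pairMem 5 t 0 ⋏ hasValue 1 2 3 4 t m ⋏ isPair 6 5 m) 5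
        (v ∷ M.F ∷ M.A ∷ M.f ∷ g ∷ fun _ => v) fun Q i l p => ?_) fun Q i l hl => ?_
    · simp [ev_hasValue (q := 1)]
      rfl
    · obtain ⟨t, ht, hlt⟩ := (hg.up i).value hl
      obtain ⟨m, hm, hv, hu⟩ := H i l t hlt
      refine ⟨pr l m, fun R j p => ⟨?_, ?_⟩⟩
      · rintro ⟨t', m', h₁, h₂, rfl⟩
        obtain rfl := ((hg.up i).up j).functional.eq h₁ (j.mem_pr hlt)
        rw [map_pr, hu R j m' h₂]
      · rintro rfl
        exact ⟨j t, j m, j.mem_pr hlt, hv.up j, map_pr _ _ _⟩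
  have mem_a : ∀ {Q} (i : P ⇛ Q) {l m t : Q}, pr l t ∈ i g → (pr l m ∈ i ha.set ↔
      HasValue (M.up i) (i v) t m) := by
    intro Q i l m t hlt
    rw [ha.mem_map i]
    constructor
    · rintro ⟨l', hl', t', m', h₁, h₂, h₃⟩
      rw [pr_inj] at h₃
      obtain ⟨rfl, rfl⟩ := h₃
      rwa [(hg.up i).functional.eq hlt h₁]
    · intro h
      exact ⟨l, ((hg.up i).mem hlt).1, t, m, hlt, h, rfl⟩
  have hfun : IsFun ha.set k M.A := by
    refine ⟨fun Q i p hp => ?_, fun Q i l hl => ?_, fun Q i l m m' h₁ h₂ => ?_⟩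
    · obtain ⟨l, hl, t, m, h₁, h₂, rfl⟩ := (ha.mem_map i).1 hp
      obtain ⟨m', hm', -, hu⟩ := H i l t h₁
      rw [hu Q (.refl Q) m h₂]
      exact ⟨l, hl, m', hm', rfl⟩
    · obtain ⟨t, ht, hlt⟩ := (hg.up i).value hl
      obtain ⟨m, hm, hv, hu⟩ := H i l t hlt
      exact ⟨m, hm, (mem_a i hlt).2 hv⟩
    · obtain ⟨l', hl', t, m'', h₃, h₄, e⟩ := (ha.mem_map i).1 h₁
      rw [pr_inj] at e
      obtain ⟨rfl, rfl⟩ := e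
      obtain ⟨m₀, hm₀, -, hu⟩ := H i l t h₃
      rw [hu Q (.refl Q) m h₄, hu Q (.refl Q) m' ((mem_a i h₃).1 h₂)]
  refine ⟨ha.set, hfun, fun Q i l t m hlt hlm => (mem_a i hlt).1 hlm, fun Q i a' ha' hva => ?_⟩
  refine ha'.ext (hfun.up i) fun R j l m hlm => ?_
  obtain ⟨t, ht, hlt⟩ := ((hg.up i).up j).value ((ha'.up j).mem hlm).1
  exact (mem_a (i.trans j) hlt).2 (hva R j l t m hlt hlm)

theorem uniqueValue_var {E n : P} (hv : IsFun v E M.A) (hn : n ∈ E) :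
    UniqueValue M v (tag 0 n) := by
  obtain ⟨m, hm, hnm⟩ := hv.value hn
  have h₀ : ValueClosed M v ∅ := fun Q i s y h => by simp at h
  refine ⟨m, hm, ⟨_, by simp, h₀.adjoin (Or.inl ⟨n, rfl, hnm⟩)⟩, fun Q i m' h => ?_⟩
  obtain ⟨W, -, ⟨n', h₁, h₂⟩ | ⟨_, _, _, _, _, h, _⟩⟩ := h.clause
  · rw [map_tag, tag_inj] at h₁
    obtain ⟨-, rfl⟩ := h₁
    exact (hv.up i).functional.eq h₂ (i.mem_pr hnm)
  · simp at h

theorem uniqueValue_app {h k g Y : P} (hf : Functional M.f) (hF : IsFunInterp M.f M.A M.F)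
    (hh : pr h k ∈ M.f) (hg : IsFun g k Y)
    (H : ∀ ⦃Q⦄ (i : P ⇛ Q) (l t : Q), pr l t ∈ i g → UniqueValue (M.up i) (i v) t) :
    UniqueValue M v (tag 1 (pr h g)) := by
  obtain ⟨b, hb, hval, huniq⟩ := exists_valueTuple hg H
  obtain ⟨y, hy, hby, hyu⟩ := hF.total (.refl P) h k b hh hb
  have hV : IsSet fun _ i p => ∃ l ∈ i k, ∃ t m, pr l t ∈ i g ∧ pr l m ∈ i b ∧ p = pr t m := by
    refine isSet_image (r := fun _ i l p => ∃ t m, pr l t ∈ i g ∧ pr l m ∈ i b ∧ p = pr t m)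
      (.of (ex fun t => ex fun m => pairMem 2 t 0 ⋏ pairMem 2 m 1 ⋏ isPair 3 t m) 2
        (b ∷ g ∷ fun _ => b) fun Q i l p => by simp) fun Q i l hl => ?_
    obtain ⟨t, -, hlt⟩ := (hg.up i).value hl
    obtain ⟨m, -, hlm⟩ := (hb.up i).value hl
    refine ⟨pr t m, fun R j p => ⟨?_, ?_⟩⟩
    · rintro ⟨t', m', h₁, h₂, rfl⟩
      rw [((hg.up i).up j).functional.eq h₁ (j.mem_pr hlt),
        ((hb.up i).up j).functional.eq h₂ (j.mem_pr hlm), map_pr]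
    · rintro rfl
      exact ⟨j t, j m, j.mem_pr hlt, j.mem_pr hlm, map_pr _ _ _⟩
  -- The evaluations of the arguments are merged into one set, to which the value of the whole term
  -- is adjoined.
  obtain ⟨W, hW, hVW⟩ := exists_valueClosed (M := M) (v := v) (V := hV.set) fun Q i p hp => by
    obtain ⟨l, hl, t, m, h₁, h₂, rfl⟩ := (hV.mem_map i).1 hp
    exact ⟨t, m, rfl, hval Q i l t m h₁ h₂⟩
  refine ⟨y, hy, ⟨_, by simp, hW.adjoin (Or.inr ⟨h, k, g, b, hh, rfl, hb,
    fun Q i l t m h₁ h₂ => hVW i _ ((hV.mem_map i).2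
      ⟨l, ((hg.up i).mem h₁).1, t, m, h₁, h₂, rfl⟩), hby⟩)⟩, fun Q i y' hy' => ?_⟩
  obtain ⟨W', hW', ⟨n', h₁, -⟩ | ⟨h', k', g', b', h₁, h₂, h₃, h₄, h₅⟩⟩ := hy'.clause
  · simp at h₁
  · simp only [map_tag, map_pr, tag_inj, pr_inj, true_and] at h₂
    obtain ⟨rfl, rfl⟩ := h₂
    obtain rfl := (hf.up i).eq h₁ (i.mem_pr hh)
    obtain rfl := huniq i b' h₃ fun R j l t m hl hm => ⟨j W', h₄ R j l t m hl hm, hW'.up j⟩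
    exact hyu Q i y' h₅

theorem uniqueValue_of_isTerm {E t : P} (hf : Functional M.f) (hF : IsFunInterp M.f M.A M.F)
    (hv : IsFun v E M.A) (ht : IsTerm M.f E t) : UniqueValue M v t := by
  obtain ⟨S, htS, hS⟩ := ht
  -- An argument lies in a pair, in the tuple `g`, in the pair with `h`, and in the tagged code: 2 +
  -- 1 + 2 + 2 = 7 membership steps, and `Below 6` allows 7.
  refine below_induction 6 (p := fun Q i t => ∀ R (j : Q ⇛ R), j t ∈ j (i S) →
    UniqueValue ((M.up i).up j) (j (i v)) (j t))
    (.of (5 ∊ 0 ⇾ exIn 2 fun m => hasValue 1 2 3 4 5 m ⋏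
      all fun m' => hasValue 1 2 3 4 5 m' ⇾ m' ≐ m) 5 (v ∷ M.F ∷ M.A ∷ M.f ∷ S ∷ fun _ => v)
      fun Q i t => ?_) (fun Q i t ih R j htS => ?_) t P (.refl P) htS
  · simp [ev_hasValue (q := 1), ev_all_imp]
    rfl
  · rcases hS (i.trans j) _ htS with ⟨n, hn, e⟩ | ⟨h, k, g, hh, hg, e⟩
    · rw [e]
      exact uniqueValue_var (hv.up (i.trans j)) hn
    · rw [e]
      refine uniqueValue_app (M := M.up (i.trans j)) (hf.up (i.trans j)) (hF.up (i.trans j)) hh hg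
        fun U l x s hxs => ?_
      refine ih (j.trans l) s ?_ U (.refl U) ((hg.up l).mem hxs).2
      change Below 6 s (l (j t))
      rw [e, map_tag, map_pr]
      exact (below_pr_right _ _).trans ((Below.of_mem (N := 0) hxs).trans
        ((below_pr_right _ _).trans (below_tag _ _))) |>.mono (by omega)

end Values

end CZF

namespace CZF

section Rules

variable {P Q R : PrimeTheory}

/-! ## Conditions given by rules -/

theorem sub_single {x X : P} : Sub (single x) X ↔ x ∈ X :=
  ⟨fun h => h.mem (by simp), fun h Q i y hy => by
    rw [map_single, mem_single] at hy
    exact hy ▸ i.mem h⟩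

/-- The condition `C` on subsets of `X` says that a subset is closed under a set of rules. -/
def Ruleable (X : P) (C : Cls P) : Prop :=
  ∃ ρ, IsRuleSet ρ X ∧ ∀ ⦃Q⦄ (i : P ⇛ Q) (Y : Q), Sub Y (i X) →
    (IsClosed (i ρ) (i X) Y ↔ C i Y)

theorem Ruleable.congr {X : P} {C C' : Cls P} (h : Ruleable X C)
    (hC : ∀ ⦃Q⦄ (i : P ⇛ Q) (Y : Q), Sub Y (i X) → (C i Y ↔ C' i Y)) : Ruleable X C' :=
  let ⟨ρ, h₁, h₂⟩ := h
  ⟨ρ, h₁, fun _ i Y hY => (h₂ i Y hY).trans (hC i Y hY)⟩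

theorem ruleable_rule {a b X : P} (ha : Sub a X) (hb : Sub b X) :
    Ruleable X fun Q i Y => ∀ R (j : Q ⇛ R), Sub (j (i a)) (j Y) → ∃ y ∈ j (i b), y ∈ j Y := by
  refine ⟨single (pr a b), fun Q i ρ hρ => ?_, fun Q i Y hY => ⟨fun h R j hj => ?_, fun h => ⟨hY,
    fun R j a' b' hab hj => ?_⟩⟩⟩
  · rw [map_single, mem_single] at hρ
    exact ⟨i a, i b, by rw [hρ, map_pr], ha.up i, hb.up i⟩
  · exact h.closed j (j (i a)) (j (i b)) (by simp) hj
  · simp only [map_single, map_pr, mem_single, pr_inj] at hab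
    obtain ⟨rfl, rfl⟩ := hab
    exact h R j hj

/-- The rule is ({s}, {t}). -/
theorem ruleable_imp {s t X : P} (hs : s ∈ X) (ht : t ∈ X) :
    Ruleable X fun Q i Y => ∀ R (j : Q ⇛ R), j (i s) ∈ j Y → j (i t) ∈ j Y :=
  (ruleable_rule (sub_single.2 hs) (sub_single.2 ht)).congr fun Q i Y _ => by
    simp only [map_single, sub_single, mem_single, exists_eq_left]

theorem ruleable_mem {t X : P} (ht : t ∈ X) : Ruleable X fun _ i Y => i t ∈ Y :=
  (ruleable_rule (a := ∅) (fun Q i y hy => by simp at hy) (sub_single.2 ht)).congr fun Q i Y _ => by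
    simp only [map_single, mem_single, exists_eq_left]
    exact ⟨fun h => h Q (.refl Q) fun R j y hy => by simp at hy, fun h R j _ => j.mem h⟩

theorem Ruleable.and {X : P} {C C' : Cls P} (h : Ruleable X C) (h' : Ruleable X C') :
    Ruleable X fun _ i Y => C i Y ∧ C' i Y := by
  obtain ⟨ρ, h₁, h₂⟩ := h
  obtain ⟨ρ', h₁', h₂'⟩ := h'
  refine ⟨cup ρ ρ', fun Q i x hx => ?_, fun Q i Y hY => ?_⟩
  · rw [map_cup, mem_cup] at hx
    exact hx.elim (h₁ i x) (h₁' i x)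
  · change _ ↔ C i Y ∧ C' i Y
    rw [← h₂ i Y hY, ← h₂' i Y hY]
    refine ⟨fun h => ⟨⟨hY, fun R j a b hab => h.closed j a b (by simp [hab])⟩,
      ⟨hY, fun R j a b hab => h.closed j a b (by simp [hab])⟩⟩,
      fun h => ⟨hY, fun R j a b hab => ?_⟩⟩
    rw [map_cup, map_cup, mem_cup] at hab
    exact hab.elim (h.1.closed j a b) (h.2.closed j a b)

/-- Rule sets for the members of `a` are gathered by Strong Collection and united. Every set
gathered expresses the condition for some member of `a`, so the union demands no more than intended.
-/
theorem ruleable_all {X a : P} {C : Rel P} (hC : Dfn₂ C)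
    (h : ∀ ⦃Q⦄ (i : P ⇛ Q), ∀ x ∈ i a, Ruleable (i X) fun _ j Y => C (i.trans j) (j x) Y) :
    Ruleable X fun Q i Y => ∀ R (j : Q ⇛ R), ∀ x ∈ j (i a), C (i.trans j) x (j Y) := by
  obtain ⟨φ, e, hφ⟩ := id hC
  obtain ⟨b, h₁, h₂⟩ := collection (a := a)
    (p := fun Q i x ρ => IsRuleSet ρ (i X) ∧ ∀ R (j : Q ⇛ R) (Y : R), Sub Y (j (i X)) →
      (IsClosed (j ρ) (j (i X)) Y ↔ C (i.trans j) (j x) Y))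
    (.of (isRuleSet 2 0 ⋏ all fun Y => sub Y 0 ⇾ (isClosed 2 0 Y ⇿ app φ [1, Y])) 1 (X ∷ e)
      fun Q i x ρ => by
        rw [ev_conj, ev_isRuleSet (by omega) (by omega), ev_all_imp]
        simp (disch := omega) only [ev_sub, ev_equi, ev_isClosed, ev_app₂, lk_old, lk_new, lk_comp]
        refine and_congr Iff.rfl ⟨fun h R j Y hY S k => ?_, fun h R j Y hY => ?_⟩
        · refine (h S (j.trans k) (k Y) (hY.up k)).trans ((hφ _ _ _).trans ?_)
          rfl
        · refine (h R j Y hY R (.refl R)).trans (Iff.trans ?_ (hφ _ _ _).symm)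
          rfl)
    fun Q i x hx => let ⟨ρ, h₁, h₂⟩ := h i x hx; ⟨ρ, h₁, fun R j => h₂ j⟩
  refine ⟨sUnion b, fun Q i p hp => ?_, fun Q i Y hY => ⟨fun hc R j x hx => ?_,
    fun hc => ⟨hY, fun R j a' b' hab => ?_⟩⟩⟩
  · rw [map_sUnion, mem_sUnion] at hp
    obtain ⟨ρ, hρ, hp⟩ := hp
    obtain ⟨x, -, hr, -⟩ := h₂ i ρ hρ
    exact hr (.refl Q) p hp
  · obtain ⟨ρ, hρ, hr, hρ'⟩ := h₁ (i.trans j) x hx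
    refine (hρ' R (.refl R) (j Y) (hY.up j)).1 ⟨hY.up j, fun S k a' b' hab =>
      hc.closed (j.trans k) a' b' ?_⟩
    rw [map_sUnion, map_sUnion, mem_sUnion]
    exact ⟨k ρ, k.mem hρ, hab⟩
  · rw [map_sUnion, map_sUnion, mem_sUnion] at hab
    obtain ⟨ρ, hρ, hab⟩ := hab
    obtain ⟨x, hx, hr, hρ'⟩ := h₂ (i.trans j) ρ hρ
    exact ((hρ' R (.refl R) (j Y) (hY.up j)).2 (hc R j x hx)).closed (.refl R) a' b' hab

/-! ## Tagged elements -/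

theorem isSet_tagged (k : ℕ) (a : P) : IsSet fun _ i x => ∃ p ∈ i a, x = tag k p :=
  isSet_image (r := fun _ _ p x => x = tag k p)
    (.of (isTagged k 1 0) 0 (fun _ => a) fun Q i p x => by simp)
    fun Q i p _ => ⟨tag k p, fun R j z => by simp⟩

/-- The set of all `tag k p` with `p ∈ a`. -/
noncomputable def tagged (k : ℕ) (a : P) : P := (isSet_tagged k a).set

@[simp] theorem mem_tagged {k : ℕ} {a x : P} : x ∈ tagged k a ↔ ∃ p ∈ a, x = tag k p :=
  (isSet_tagged k a).mem

@[simp] theorem map_tagged (i : P ⇛ Q) (k : ℕ) (a : P) : i (tagged k a) = tagged k (i a) :=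
  ext fun _ j _ => ((isSet_tagged k a).mem_map (i.trans j)).trans
    ((isSet_tagged k (i a)).mem_map j).symm

/-- The components of Kuratowski pairs in `S` lie in its double union, the ambient set for
separating them. -/
theorem left_mem_sUnion {S a b : P} (h : pr a b ∈ S) : a ∈ sUnion (sUnion S) := by
  simp only [mem_sUnion]
  exact ⟨single a, ⟨_, h, single_mem_pr a b⟩, by simp⟩

theorem right_mem_sUnion {S a b : P} (h : pr a b ∈ S) : b ∈ sUnion (sUnion S) := by
  simp only [mem_sUnion]
  exact ⟨upair a b, ⟨_, h, upair_mem_pr a b⟩, by simp⟩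

theorem isSet_untag (k : ℕ) (Y : P) : IsSet fun _ i p => tag k p ∈ i Y := by
  refine (isSet_sep (p := fun _ i p => tag k p ∈ i Y) (a := sUnion (sUnion Y))
    (.of (ex fun x => isTagged k x 1 ⋏ x ∊ 0) 1 (Y ∷ fun _ => Y) fun Q i p => by simp)
    fun Q i p _ => (small_mem (tag k p) (i Y)).congr fun R j => by simp; rfl).congr fun Q i p => ?_
  simp only [map_sUnion, iff_and_self]
  exact fun h => right_mem_sUnion h

/-- The set of all `p` with `tag k p ∈ Y`. -/
noncomputable def untag (k : ℕ) (Y : P) : P := (isSet_untag k Y).set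

@[simp] theorem mem_untag {k : ℕ} {Y p : P} : p ∈ untag k Y ↔ tag k p ∈ Y := (isSet_untag k Y).mem

@[simp] theorem map_untag (i : P ⇛ Q) (k : ℕ) (Y : P) : i (untag k Y) = untag k (i Y) :=
  ext fun _ j _ => ((isSet_untag k Y).mem_map (i.trans j)).trans
    ((isSet_untag k (i Y)).mem_map j).symm

end Rules

end CZF

namespace CZF

section Nodes

variable {P Q R : PrimeTheory} {M : Str P} {om S : P}

/-! ## Facts and instances of formulas -/

/-- A structure with a set `S` of formulas and their sets of free variables. -/
structure FormulaSystem (M : Str P) (om S : P) : Prop where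
  omega : IsOmega om
  arity_q : IsArity om M.q
  functional_f : Functional M.f
  funInterp : IsFunInterp M.f M.A M.F
  closed : GameClosed om M.f M.q S

theorem FormulaSystem.up (h : FormulaSystem M om S) (i : P ⇛ Q) :
    FormulaSystem (M.up i) (i om) (i S) :=
  ⟨h.omega.up i, h.arity_q.up i, h.functional_f.up i, h.funInterp.up i,
    fun _ j => h.closed (i.trans j)⟩

/-- `w` assigns values to a set of variables which contains the free variables of `χ`. -/
def Instance (M : Str P) (om S χ w : P) : Prop := ∃ E, Sub E om ∧ pr E χ ∈ S ∧ IsFun w E M.A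

theorem Instance.up {χ w : P} (h : Instance M om S χ w) (i : P ⇛ Q) :
    Instance (M.up i) (i om) (i S) (i χ) (i w) :=
  let ⟨E, h₁, h₂, h₃⟩ := h
  ⟨i E, h₁.up i, i.mem_pr h₂, h₃.up i⟩

/-- `p` consists of a relation symbol in `q` and a tuple of elements of `A`. -/
def Fact (q A p : P) : Prop := ∃ R k a, pr R k ∈ q ∧ IsFun a k A ∧ p = pr R a

/-- Exponentiation is used here: for each symbol, the tuples of its arity form a function set. -/
theorem isSet_facts {q A : P} (hq : IsArity om q) :
    IsSet fun _ i p => Fact (i q) (i A) p := by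
  refine (isSet_iUnion (r := fun _ i s p => ∃ R k a, s = pr R k ∧ IsFun a k (i A) ∧ p = pr R a)
    (.of (ex fun R => ex fun k => ex fun a => isPair 1 R k ⋏ isFun a k 0 ⋏ isPair 2 R a) 1
      (A ∷ fun _ => A) fun Q i s p => by simp) (a := q) fun Q i s hs => ?_).congr fun Q i p => ?_
  · obtain ⟨R, k, -, rfl⟩ := hq.1 i s hs
    refine (isSet_image (r := fun S j a p => p = pr (j R) a) (a := exp k (i A))
      (.of (isPair 2 0 1) 1 (R ∷ fun _ => R) fun S j a p => by simp)
      fun S j a _ => ⟨pr (j R) a, fun U l z => by simp [Hom.trans]⟩).congr fun S j p => ?_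
    simp only [map_pr, pr_inj, map_exp, mem_exp]
    constructor
    · rintro ⟨R', k', a, ⟨rfl, rfl⟩, h₁, h₂⟩
      exact ⟨a, h₁, h₂⟩
    · rintro ⟨a, h₁, h₂⟩
      exact ⟨_, _, a, ⟨rfl, rfl⟩, h₁, h₂⟩
  · constructor
    · rintro ⟨R, k, a, h₁, h₂, rfl⟩
      exact ⟨_, h₁, R, k, a, rfl, h₂, rfl⟩
    · rintro ⟨_, h₁, R, k, a, rfl, h₂, rfl⟩
      exact ⟨R, k, a, h₁, h₂, rfl⟩

theorem isSet_instances (M : Str P) (om S : P) :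
    IsSet fun _ i p => ∃ χ w, Instance (M.up i) (i om) (i S) χ w ∧ p = pr χ w := by
  have hE : IsSet fun _ i E => E ∈ i (sUnion (sUnion S)) ∧ Sub E (i om) :=
    isSet_sep (p := fun _ i E => Sub E (i om))
      (.of (sub 1 0) 1 (om ∷ fun _ => om) fun Q i E => by simp)
      fun Q i E _ => Small.allIn (p := fun _ j x => x ∈ j (i om))
        (.of (1 ∊ 0) 1 (i om ∷ fun _ => i om) fun R j x => by simp)
        fun R j x _ => small_mem x (j (i om))
  refine (isSet_iUnion (r := fun _ i E p => ∃ χ w, pr E χ ∈ i S ∧ IsFun w E (i M.A) ∧ p = pr χ w)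
    (.of (ex fun χ => ex fun w => pairMem 2 χ 0 ⋏ isFun w 2 1 ⋏ isPair 3 χ w) 2
      (M.A ∷ S ∷ fun _ => S) fun Q i E p => by simp) (a := hE.set) fun Q i E _ => ?_).congr
    fun Q i p => ?_
  · have hχ : IsSet fun _ j χ => χ ∈ j (i (sUnion (sUnion S))) ∧ pr (j E) χ ∈ j (i S) :=
      isSet_sep (p := fun _ j χ => pr (j E) χ ∈ j (i S))
        (.of (pairMem 0 2 1) 2 (i S ∷ E ∷ fun _ => E) fun R j χ => by simp)
        fun R j χ _ => (small_mem (pr (j E) χ) (j (i S))).congr fun U l => by simp; rfl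
    refine ⟨prod hχ.set (exp E (i M.A)), fun R j p => ?_⟩
    rw [map_prod, mem_prod]
    constructor
    · rintro ⟨χ, h₁, w, h₂, rfl⟩
      rw [map_exp, mem_exp] at h₂
      exact ⟨χ, w, ((hχ.mem_map j).1 h₁).2, h₂, rfl⟩
    · rintro ⟨χ, w, h₁, h₂, rfl⟩
      refine ⟨χ, (hχ.mem_map j).2 ⟨?_, h₁⟩, w, by rwa [map_exp, mem_exp], rfl⟩
      have := right_mem_sUnion h₁
      rwa [← map_sUnion, ← map_sUnion] at this
  · constructor
    · rintro ⟨χ, w, ⟨E, h₁, h₂, h₃⟩, rfl⟩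
      refine ⟨E, (hE.mem_map i).2 ⟨?_, h₁⟩, χ, w, h₂, h₃, rfl⟩
      simpa using left_mem_sUnion h₂
    · rintro ⟨E, h₁, χ, w, h₂, h₃, rfl⟩
      exact ⟨χ, w, ⟨E, ((hE.mem_map i).1 h₁).2, h₂, h₃⟩, rfl⟩

/-- The set of facts and instances of formulas. -/
def Node (M : Str P) (om S x : P) : Prop :=
  (∃ p, Fact M.q M.A p ∧ x = tag 0 p) ∨ ∃ χ w, Instance M om S χ w ∧ x = tag 1 (pr χ w)

theorem isSet_nodes (h : FormulaSystem M om S) :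
    IsSet fun _ i x => Node (M.up i) (i om) (i S) x := by
  have h₀ := isSet_facts (A := M.A) h.arity_q
  have h₁ := isSet_instances M om S
  refine ⟨cup (tagged 0 h₀.set) (tagged 1 h₁.set), fun Q i x => ?_⟩
  rw [map_cup, mem_cup, map_tagged, map_tagged, mem_tagged, mem_tagged]
  simp only [h₀.mem_map i, h₁.mem_map i]
  refine or_congr Iff.rfl ?_
  constructor
  · rintro ⟨_, ⟨χ, w, h, rfl⟩, rfl⟩
    exact ⟨χ, w, h, rfl⟩
  · rintro ⟨χ, w, h, rfl⟩
    exact ⟨_, ⟨χ, w, h, rfl⟩, rfl⟩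

/-! ## The clauses as conjunctions and disjunctions -/

/-- The clause for the truth of `χ` under `w`, where `T` is the truth of facts and instances. -/
def NodeClause (M : Str P) (T : Cls P) (χ w : P) : Prop :=
  Clause M (fun R a => T (.refl P) (tag 0 (pr R a))) (fun _ i ψ u => T i (tag 1 (pr ψ u))) χ w

/-- The elements of `z` are the facts and instances on which the truth of `χ` depends. -/
def Premises (M : Str P) (om S χ z : P) : Prop := ∀ ⦃Q⦄ (i : P ⇛ Q), ∀ x ∈ i z,
  (∃ p, Fact (i M.q) (i M.A) p ∧ x = tag 0 p) ∨
    ∃ ψ u, Instance (M.up i) (i om) (i S) ψ u ∧ Below 3 ψ (i χ) ∧ x = tag 1 (pr ψ u)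

/-- `χ` is true under `w` if and only if all elements of `z` are true. -/
def IsMeet (M : Str P) (χ w z : P) : Prop := ∀ ⦃Q⦄ (i : P ⇛ Q) (T : Cls Q),
  NodeClause (M.up i) T (i χ) (i w) ↔ ∀ R (j : Q ⇛ R), ∀ x ∈ j (i z), T j x

/-- `χ` is true under `w` if and only if some element of `z` is true. -/
def IsJoin (M : Str P) (χ w z : P) : Prop := ∀ ⦃Q⦄ (i : P ⇛ Q) (T : Cls Q),
  NodeClause (M.up i) T (i χ) (i w) ↔ ∃ x ∈ i z, T (.refl Q) x

variable {χ w z Φ n ψ : P} {T : Cls P}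

theorem nodeClause_conj :
    NodeClause M T (tag 1 Φ) w ↔ ∀ Q (i : P ⇛ Q), ∀ ψ ∈ i Φ, T i (tag 1 (pr ψ (i w))) := by
  simp [NodeClause, Clause]

theorem nodeClause_disj :
    NodeClause M T (tag 2 Φ) w ↔ ∃ ψ ∈ Φ, T (.refl P) (tag 1 (pr ψ w)) := by
  simp [NodeClause, Clause]

theorem nodeClause_ex : NodeClause M T (tag 3 (pr n ψ)) w ↔
    ∃ m ∈ M.A, ∃ w', IsUpdate w' w n m ∧ T (.refl P) (tag 1 (pr ψ w')) := by
  simp [NodeClause, Clause]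

theorem nodeClause_all : NodeClause M T (tag 4 (pr n ψ)) w ↔
    ∀ Q (i : P ⇛ Q), ∀ m ∈ i M.A, ∃ w', IsUpdate w' (i w) (i n) m ∧
      T i (tag 1 (pr (i ψ) w')) := by
  simp [NodeClause, Clause]

/-- Since terms have unique values and symbols unique arities, an atomic formula under `w` amounts
to a single fact, that is, to a disjunction with one member. -/
theorem isJoin_atom (h : FormulaSystem M om S) {E R k g : P} (hR : pr R k ∈ M.q)
    (hg : IsTermTuple M.f E k g) (hw : IsFun w E M.A) : ∃ a, IsFun a k M.A ∧
      IsJoin M (tag 0 (pr R g)) w (single (tag 0 (pr R a))) := by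
  obtain ⟨Y, hY, ht⟩ := hg
  obtain ⟨a, ha, hv, hu⟩ := exists_valueTuple hY fun Q i l t hlt =>
    uniqueValue_of_isTerm (M := M.up i) (h.functional_f.up i) (h.funInterp.up i) (hw.up i)
      (ht i t ((hY.up i).mem hlt).2)
  refine ⟨a, ha, fun Q i T => ?_⟩
  simp only [map_single, map_tag, map_pr, mem_single, exists_eq_left]
  constructor
  · rintro (⟨R', k', g', a', h₁, h₂, h₃, h₄, h₅⟩ | ⟨Φ, h, -⟩ | ⟨Φ, h, -⟩ | ⟨n, ψ, h, -⟩ |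
      ⟨n, ψ, h, -⟩)
    · simp only [tag_inj, pr_inj, true_and] at h₂
      obtain ⟨rfl, rfl⟩ := h₂
      obtain rfl := (h.arity_q.2.up i).eq h₁ (i.mem_pr hR)
      rwa [hu i a' h₃ h₄] at h₅
    all_goals simp at h
  · intro hT
    exact Or.inl ⟨i R, i k, i g, i a, i.mem_pr hR, rfl, ha.up i, fun R j => hv R (i.trans j), hT⟩

/-- The use of the restriction to game formulas: ⋀ and ∀ are meets, ⋁, ∃ and atoms are joins, over a
set of nodes that involve only simpler formulas. For the quantifiers these are instances under
updated assignments, which exist because equality of variables is decidable. -/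
theorem exists_premises (h : FormulaSystem M om S) (hI : Instance M om S χ w) :
    ∃ z, Premises M om S χ z ∧ (IsMeet M χ w z ∨ IsJoin M χ w z) := by
  obtain ⟨E, hE, hχ, hw⟩ := hI
  have hupd : ∀ {n : P}, n ∈ om → ∀ ⦃Q⦄ (i : P ⇛ Q), ∀ m ∈ i M.A,
      ∃ w', IsUpdate w' (i w) (i n) m ∧ IsFun w' (adjoin (i E) (i n)) (i M.A) :=
    fun {n} hn Q i m hm => exists_update (hw.up i) hm fun R j x hx =>
      ((h.omega.up i).up j).eqDec (hE.up i j x hx) (j.mem (i.mem hn))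
  have hsub : ∀ {n : P}, n ∈ om → Sub (adjoin E n) om := fun {n} hn Q i x hx => by
    rw [map_adjoin, mem_adjoin] at hx
    rcases hx with hx | rfl
    · exact hE i x hx
    · exact i.mem hn
  -- A member of `Φ` is three membership steps below the tagged code, and a quantified formula's
  -- body is four, the number allowed by `Below 3`.
  have below₁ : ∀ {Q : PrimeTheory} {k : ℕ} {Φ ψ : Q}, ψ ∈ Φ → Below 3 ψ (tag k Φ) :=
    fun {Q k Φ ψ} hψ => ((Below.of_mem (N := 0) hψ).trans (below_tag k Φ)).mono (by omega)
  have below₂ : ∀ {Q : PrimeTheory} {k : ℕ} {n ψ : Q}, Below 3 ψ (tag k (pr n ψ)) :=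
    fun {Q k n ψ} => (below_pr_right n ψ).trans (below_tag k _)
  rcases h.closed (.refl P) E χ hχ with ⟨R, k, g, h₁, h₂, rfl⟩ | ⟨Φ, rfl, h₁⟩ | ⟨Φ, rfl, h₁⟩ |
    ⟨n, hn, ψ, E', rfl, rfl, h₁⟩ | ⟨n, hn, ψ, E', rfl, rfl, h₁⟩
  · obtain ⟨a, ha, hz⟩ := isJoin_atom h h₁ h₂ hw
    refine ⟨_, fun Q i x hx => Or.inl ⟨pr (i R) (i a),
      ⟨i R, i k, i a, i.mem_pr h₁, ha.up i, rfl⟩, ?_⟩, Or.inr hz⟩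
    simpa using hx
  · have hz := isSet_pairs Φ w
    refine ⟨tagged 1 hz.set, fun Q i x hx => Or.inr ?_, Or.inl fun Q i T => ?_⟩
    · rw [map_tagged, mem_tagged] at hx
      obtain ⟨p, hp, rfl⟩ := hx
      obtain ⟨ψ, hψ, rfl⟩ := (hz.mem_map i).1 hp
      exact ⟨ψ, i w, ⟨i E, hE.up i, h₁ Q i ψ hψ, hw.up i⟩, by rw [map_tag]; exact below₁ hψ, rfl⟩
    · rw [map_tag, nodeClause_conj]
      refine forall₂_congr fun R j => ⟨fun hT x hx => ?_, fun hT ψ hψ => hT _ ?_⟩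
      · rw [map_tagged, map_tagged, mem_tagged] at hx
        obtain ⟨p, hp, rfl⟩ := hx
        obtain ⟨ψ, hψ, rfl⟩ := (hz.mem_map (i.trans j)).1 hp
        exact hT ψ hψ
      · rw [map_tagged, map_tagged, mem_tagged]
        exact ⟨_, (hz.mem_map (i.trans j)).2 ⟨ψ, hψ, rfl⟩, rfl⟩
  · have hz := isSet_pairs Φ w
    refine ⟨tagged 1 hz.set, fun Q i x hx => Or.inr ?_, Or.inr fun Q i T => ?_⟩
    · rw [map_tagged, mem_tagged] at hx
      obtain ⟨p, hp, rfl⟩ := hx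
      obtain ⟨ψ, hψ, rfl⟩ := (hz.mem_map i).1 hp
      exact ⟨ψ, i w, ⟨i E, hE.up i, h₁ Q i ψ hψ, hw.up i⟩, by rw [map_tag]; exact below₁ hψ, rfl⟩
    · rw [map_tag, nodeClause_disj]
      constructor
      · rintro ⟨ψ, hψ, hT⟩
        refine ⟨_, ?_, hT⟩
        rw [map_tagged, mem_tagged]
        exact ⟨_, (hz.mem_map i).2 ⟨ψ, hψ, rfl⟩, rfl⟩
      · rintro ⟨x, hx, hT⟩
        rw [map_tagged, mem_tagged] at hx
        obtain ⟨p, hp, rfl⟩ := hx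
        obtain ⟨ψ, hψ, rfl⟩ := (hz.mem_map i).1 hp
        exact ⟨ψ, hψ, hT⟩
  -- ∃ and ∀ have the same premises; only join and meet differ.
  all_goals
    have hz := isSet_updates (A := M.A) (w := w) (n := n) (ψ := ψ) fun Q i m hm =>
      (hupd hn i m hm).imp fun _ h => h.1
    have hp : ∀ k, Premises M om S (tag k (pr n ψ)) (tagged 1 hz.set) :=
      fun k Q i x hx => Or.inr (by
      rw [map_tagged, mem_tagged] at hx
      obtain ⟨p, hp, rfl⟩ := hx
      obtain ⟨m, hm, w', hw', rfl⟩ := (hz.mem_map i).1 hp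
      obtain ⟨u, hu, hu'⟩ := hupd hn i m hm
      obtain rfl := hu.unique hw'
      refine ⟨i ψ, u, ⟨i (adjoin E n), (hsub hn).up i, i.mem_pr h₁, ?_⟩,
        by rw [map_tag, map_pr]; exact below₂, rfl⟩
      rwa [map_adjoin])
    refine ⟨_, hp _, ?_⟩
  · refine Or.inr fun Q i T => ?_
    rw [map_tag, map_pr, nodeClause_ex]
    constructor
    · rintro ⟨m, hm, w', hw', hT⟩
      refine ⟨_, ?_, hT⟩
      rw [map_tagged, mem_tagged]
      exact ⟨_, (hz.mem_map i).2 ⟨m, hm, w', hw', rfl⟩, rfl⟩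
    · rintro ⟨x, hx, hT⟩
      rw [map_tagged, mem_tagged] at hx
      obtain ⟨p, hp, rfl⟩ := hx
      obtain ⟨m, hm, w', hw', rfl⟩ := (hz.mem_map i).1 hp
      exact ⟨m, hm, w', hw', hT⟩
  · refine Or.inl fun Q i T => ?_
    rw [map_tag, map_pr, nodeClause_all]
    refine forall₂_congr fun R j => ⟨fun hT x hx => ?_, fun hT m hm => ?_⟩
    · rw [map_tagged, map_tagged, mem_tagged] at hx
      obtain ⟨p, hp, rfl⟩ := hx
      obtain ⟨m, hm, w', hw', rfl⟩ := (hz.mem_map (i.trans j)).1 hp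
      obtain ⟨u, hu, hTu⟩ := hT m hm
      obtain rfl := hu.unique hw'
      exact hTu
    · obtain ⟨u, hu, -⟩ := hupd hn (i.trans j) m hm
      refine ⟨u, hu, hT _ ?_⟩
      rw [map_tagged, map_tagged, mem_tagged]
      exact ⟨_, (hz.mem_map (i.trans j)).2 ⟨m, hm, u, hu, rfl⟩, rfl⟩

end Nodes

end CZF

namespace CZF

section Truth

variable {P Q R : PrimeTheory} {M : Str P} {om S J Y χ w : P}

/-! ## The truth of facts and instances -/

/-- The truth of facts and instances of formulas in the structure with relations `J`. -/
def Truth (M : Str P) (J : P) : Cls P := fun _ i x =>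
  (∃ p ∈ i J, x = tag 0 p) ∨ ∃ ψ u, x = tag 1 (pr ψ u) ∧ Sat (M.up i) (i J) ψ u

theorem dfn_truth (M : Str P) (J : P) : Dfn (Truth M J) :=
  .of ((exIn 4 fun p => isTagged 0 5 p) ⋎ ex fun ψ => ex fun u =>
      isTagged₂ 1 5 ψ u ⋏ satisfies 0 1 2 3 4 ψ u) 5
    (J ∷ M.F ∷ M.A ∷ M.q ∷ M.f ∷ fun _ => J) fun Q i x => by simp [ev_satisfies]; rfl

theorem truth_fact {i : P ⇛ Q} {p : Q} : Truth M J i (tag 0 p) ↔ p ∈ i J := by simp [Truth]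

theorem truth_instance {i : P ⇛ Q} {ψ u : Q} :
    Truth M J i (tag 1 (pr ψ u)) ↔ Sat (M.up i) (i J) ψ u := by simp [Truth]

theorem sat_iff_nodeClause : Sat M J χ w ↔ NodeClause M (Truth M J) χ w := by
  rw [sat_iff, NodeClause]
  simp only [truth_fact, truth_instance]
  rfl

/-- The node `x` is a fact or an instance of a formula below `χ`. -/
def NodeBelow (M : Str P) (om S χ x : P) : Prop :=
  (∃ p, Fact M.q M.A p ∧ x = tag 0 p) ∨
    ∃ ψ u, Instance M om S ψ u ∧ Below 3 ψ χ ∧ x = tag 1 (pr ψ u)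

theorem NodeBelow.node {x : P} (h : NodeBelow M om S χ x) : Node M om S x :=
  h.imp_right fun ⟨ψ, u, h₁, _, h₂⟩ => ⟨ψ, u, h₁, h₂⟩

/-- A clause consults only its premises, so truth need be compared only on facts and on instances of
formulas below `χ`. This is what an induction hypothesis provides. -/
theorem NodeClause.mono {T T' : Cls P} (hN : NodeClause M T χ w) (h : FormulaSystem M om S)
    (hI : Instance M om S χ w) (hT : ∀ ⦃Q⦄ (i : P ⇛ Q) (x : Q),
      NodeBelow (M.up i) (i om) (i S) (i χ) x → T i x → T' i x) : NodeClause M T' χ w := by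
  obtain ⟨z, hz, hm | hj⟩ := exists_premises h hI
  · exact (hm (.refl P) T').2 fun R j x hx => hT j x (hz j x hx) ((hm (.refl P) T).1 hN R j x hx)
  · obtain ⟨x, hx, hTx⟩ := (hj (.refl P) T).1 hN
    exact (hj (.refl P) T').2 ⟨x, hx, hT (.refl P) x (hz (.refl P) x hx) hTx⟩

/-- The formula for `Instance`. -/
def instanceFm (A om S χ w : ℕ) : Fm :=
  ex fun E => sub E om ⋏ pairMem E χ S ⋏ isFun w E A

theorem ev_instanceFm {d f q F A om S χ w : ℕ} {e : ℕ → P} (hA : A < d) (ho : om < d) (hS : S < d)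
    (hχ : χ < d) (hw : w < d) : Ev (instanceFm A om S χ w) d e ↔
      Instance ⟨lk d e f, lk d e q, lk d e A, lk d e F⟩ (lk d e om) (lk d e S) (lk d e χ)
        (lk d e w) := by
  simp (disch := omega) only [instanceFm, ev_ex, ev_conj, ev_sub, ev_pairMem, ev_isFun, lk_old,
    lk_new]
  rfl

/-- `Sat` asks for a witness among all sets and is not bounded as it stands. By induction on
formulas it is a bounded quantification of small propositions over the set of premises. -/
theorem small_sat (h : FormulaSystem M om S) (J : P) (hI : Instance M om S χ w) :
    Small fun _ i => Sat (M.up i) (i J) (i χ) (i w) := by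
  refine below_induction 3 (p := fun Q i χ => ∀ R (j : Q ⇛ R) w,
      Instance ((M.up i).up j) (j (i om)) (j (i S)) (j χ) w →
      Small fun _ k => Sat (((M.up i).up j).up k) (k (j (i J))) (k (j χ)) (k w))
    (.of (all fun w => instanceFm 2 4 5 8 w ⇾
      ex fun s => satisfies 0 1 2 3 6 8 w ⇿ 7 ∊ s) 8
      (∅ ∷ J ∷ S ∷ om ∷ M.F ∷ M.A ∷ M.q ∷ M.f ∷ fun _ => J) fun Q i χ => ?_)
    (fun Q i χ ih R j w hI => ?_) χ P (.refl P) w hI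
  · rw [ev_all_imp]
    simp [ev_instanceFm (f := 0) (q := 1) (F := 3), ev_satisfies, Small]
    rfl
  · let M' := M.up (i.trans j)
    obtain ⟨z, hz, hm⟩ := exists_premises (h.up (i.trans j)) hI
    have key : ∀ ⦃U⦄ (k : R ⇛ U), ∀ x ∈ k z,
        Small fun V l => Truth M' (j (i J)) (k.trans l) (l x) := by
      intro U k x hx
      rcases hz k x hx with ⟨p, -, rfl⟩ | ⟨ψ, u, hψ, hb, rfl⟩
      · refine (small_mem p (k (j (i J)))).congr fun V l => ?_
        rw [map_tag, truth_fact]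
        rfl
      · refine (ih (j.trans k) ψ hb U (.refl U) u hψ).congr fun V l => ?_
        rw [map_tag, map_pr, truth_instance]
        rfl
    rcases hm with hm | hm
    · refine (Small.allIn (dfn_truth M' (j (i J))) key).congr fun U k => ?_
      exact sat_iff_nodeClause.trans (hm k _)
    · refine (Small.exIn (dfn_truth M' (j (i J))) key).congr fun U k => ?_
      exact sat_iff_nodeClause.trans (hm k _)

theorem isSet_trueNodes (h : FormulaSystem M om S) (J : P) :
    IsSet fun _ i x => Node (M.up i) (i om) (i S) x ∧ Truth M J i x := by
  refine (isSet_sep (dfn_truth M J) (a := (isSet_nodes h).set) fun Q i x hx => ?_).congr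
    fun Q i x => by rw [(isSet_nodes h).mem_map i]
  rcases ((isSet_nodes h).mem_map i).1 hx with ⟨p, -, rfl⟩ | ⟨ψ, u, hψ, rfl⟩
  · refine (small_mem p (i J)).congr fun V l => ?_
    rw [map_tag, truth_fact]
    rfl
  · refine (small_sat (h.up i) (i J) hψ).congr fun V l => ?_
    rw [map_tag, map_pr, truth_instance]
    rfl

/-! ### Coherent sets of nodes -/

/-- The set `Y` of nodes is compatible with the inductive clauses for truth. -/
structure Coherent (M : Str P) (om S Y : P) : Prop where
  node : ∀ ⦃Q⦄ (i : P ⇛ Q), ∀ x ∈ i Y, Node (M.up i) (i om) (i S) x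
  clause : ∀ ⦃Q⦄ (i : P ⇛ Q) (χ w : Q), Instance (M.up i) (i om) (i S) χ w →
    (tag 1 (pr χ w) ∈ i Y ↔ NodeClause (M.up i) (fun _ j x => x ∈ j (i Y)) χ w)

theorem Coherent.up (h : Coherent M om S Y) (i : P ⇛ Q) : Coherent (M.up i) (i om) (i S) (i Y) :=
  ⟨fun _ j => h.node (i.trans j), fun _ j => h.clause (i.trans j)⟩

theorem Coherent.isInstance (h : Coherent M om S Y) (hx : tag 1 (pr χ w) ∈ Y) :
    Instance M om S χ w := by
  rcases h.node (.refl P) _ hx with ⟨p, -, h⟩ | ⟨χ', w', h, e⟩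
  · simp at h
  · simp only [tag_inj, pr_inj, true_and] at e
    rwa [e.1, e.2]

theorem Coherent.fact (h : Coherent M om S Y) {p : P} (hx : tag 0 p ∈ Y) : Fact M.q M.A p := by
  rcases h.node (.refl P) _ hx with ⟨p, h, e⟩ | ⟨χ', w', h, e⟩
  · simp only [tag_inj, true_and] at e
    rwa [e]
  · simp at e

/-- From satisfaction to membership by induction on formulas, along the premises. Conversely, the
instances in `Y` themselves witness satisfaction. -/
theorem Coherent.sat_iff (hY : Coherent M om S Y) (h : FormulaSystem M om S)
    (hI : Instance M om S χ w) : Sat M (untag 0 Y) χ w ↔ tag 1 (pr χ w) ∈ Y := by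
  constructor
  · intro hs
    refine below_induction 3 (p := fun Q i χ => ∀ R (j : Q ⇛ R) w,
        Instance ((M.up i).up j) (j (i om)) (j (i S)) (j χ) w ∧
          Sat ((M.up i).up j) (j (i (untag 0 Y))) (j χ) w → tag 1 (pr (j χ) w) ∈ j (i Y))
      (.of (all fun w => instanceFm 2 4 5 8 w ⋏ satisfies 0 1 2 3 6 8 w ⇾
        ex fun x => isTagged₂ 1 x 8 w ⋏ x ∊ 7) 8
        (Y ∷ untag 0 Y ∷ S ∷ om ∷ M.F ∷ M.A ∷ M.q ∷ M.f ∷ fun _ => Y) fun Q i χ => ?_)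
      (fun Q i χ ih R j w hw => ?_) χ P (.refl P) w ⟨hI, hs⟩
    · rw [ev_all_imp]
      simp [ev_instanceFm (f := 0) (q := 1) (F := 3), ev_satisfies]
      rfl
    · obtain ⟨hI, hs⟩ := hw
      refine (hY.clause (i.trans j) (j χ) w hI).2 ((sat_iff_nodeClause.1 hs).mono
        (h.up (i.trans j)) hI fun U k x hx hT => ?_)
      rcases hx with ⟨p, -, rfl⟩ | ⟨ψ, u, hψ, hb, rfl⟩
      · rw [truth_fact, map_untag, map_untag, map_untag, mem_untag] at hT
        exact hT
      · exact ih (j.trans k) ψ hb U (.refl U) u ⟨hψ, truth_instance.1 hT⟩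
  · intro hx
    refine ⟨untag 1 Y, mem_untag.2 hx, fun Q i χ w hp => ?_⟩
    rw [map_untag, mem_untag] at hp
    refine Clause.mono ((hY.clause i χ w ((hY.up i).isInstance hp)).1 hp) (fun R a hR => ?_)
      fun R j ψ u hu => ?_
    · rwa [map_untag, mem_untag]
    · rwa [map_untag, map_untag, mem_untag]

theorem coherent_trueNodes (h : FormulaSystem M om S) (J : P) :
    Coherent M om S (isSet_trueNodes h J).set := by
  refine ⟨fun Q i x hx => (((isSet_trueNodes h J).mem_map i).1 hx).1, fun Q i χ w hI => ?_⟩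
  have hN : Node (M.up i) (i om) (i S) (tag 1 (pr χ w)) := Or.inr ⟨χ, w, hI, rfl⟩
  rw [(isSet_trueNodes h J).mem_map i, and_iff_right hN, truth_instance, sat_iff_nodeClause]
  refine ⟨fun hc => hc.mono (h.up i) hI fun R j x hx hT => ?_,
    fun hc => hc.mono (h.up i) hI fun R j x hx hT => ?_⟩
  · exact ((isSet_trueNodes h J).mem_map (i.trans j)).2 ⟨hx.node, hT⟩
  · exact (((isSet_trueNodes h J).mem_map (i.trans j)).1 hT).2

end Truth

end CZF

namespace CZF

section Solutions

variable {P Q R : PrimeTheory} {M : Str P} {om S X T I r : P}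

/-! ## Sets of formulas for a game theory -/

theorem GameClosed.sUnion {om f q b : P}
    (h : ∀ ⦃Q⦄ (i : P ⇛ Q), ∀ S ∈ i b, GameClosed (i om) (i f) (i q) S) :
    GameClosed om f q (sUnion b) := by
  intro Q i E χ hp
  rw [map_sUnion, mem_sUnion] at hp
  obtain ⟨S, hS, hp⟩ := hp
  have hs : ∀ {R} (j : Q ⇛ R) {p : R}, p ∈ j S → p ∈ j (i (CZF.sUnion b)) := fun j p hp => by
    rw [map_sUnion, map_sUnion, mem_sUnion]
    exact ⟨j S, j.mem hS, hp⟩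
  rcases h i S hS (.refl Q) E χ hp with h | ⟨Φ, h₁, h₂⟩ | ⟨Φ, h₁, h₂⟩ |
    ⟨n, hn, ψ, E', h₁, h₂, h₃⟩ | ⟨n, hn, ψ, E', h₁, h₂, h₃⟩
  · exact Or.inl h
  · exact Or.inr (Or.inl ⟨Φ, h₁, fun R j ψ hψ => hs j (h₂ R j ψ hψ)⟩)
  · exact Or.inr (Or.inr (Or.inl ⟨Φ, h₁, fun R j ψ hψ => hs j (h₂ R j ψ hψ)⟩))
  · exact Or.inr (Or.inr (Or.inr (Or.inl ⟨n, hn, ψ, E', h₁, h₂, hs (.refl Q) h₃⟩)))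
  · exact Or.inr (Or.inr (Or.inr (Or.inr ⟨n, hn, ψ, E', h₁, h₂, hs (.refl Q) h₃⟩)))

/-- All elements of `T` are sequents between formulas in `S`. -/
def SequentsIn (om S T : P) : Prop := ∀ ⦃Q⦄ (i : P ⇛ Q), ∀ s ∈ i T, ∃ D φ ψ,
  s = pr D (pr φ ψ) ∧ Sub D (i om) ∧ pr D φ ∈ i S ∧ pr D ψ ∈ i S

/-- Each sequent comes with sets witnessing that its formulas are game formulas. Strong Collection
and a union give one set for the whole theory. -/
theorem exists_gameClosed {f q : P} (hT : IsGameTheory om f q T) :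
    ∃ S, GameClosed om f q S ∧ SequentsIn om S T := by
  obtain ⟨b, h₁, h₂⟩ := collection (a := T)
    (p := fun _ i s S => GameClosed (i om) (i f) (i q) S ∧
      ∃ D φ ψ, s = pr D (pr φ ψ) ∧ Sub D (i om) ∧ pr D φ ∈ S ∧ pr D ψ ∈ S)
    (.of (gameClosedFm 0 1 2 4 ⋏ ex fun D => ex fun φ => ex fun ψ =>
      isSequent 3 D φ ψ ⋏ sub D 0 ⋏ pairMem D φ 4 ⋏ pairMem D ψ 4) 3 (q ∷ f ∷ om ∷ fun _ => om)
      fun Q i s S => by simp [ev_gameClosedFm])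
    fun Q i s hs => by
      obtain ⟨D, φ, ψ, rfl, hD, ⟨S, hφ, hS⟩, ⟨S', hψ, hS'⟩⟩ := hT i s hs
      refine ⟨CZF.sUnion (upair S S'), GameClosed.sUnion fun R j S'' h => ?_, D, φ, ψ, rfl, hD,
        mem_sUnion.2 ⟨S, by simp, hφ⟩, mem_sUnion.2 ⟨S', by simp, hψ⟩⟩
      rw [map_upair, mem_upair] at h
      rcases h with rfl | rfl
      · exact fun U k => hS (j.trans k)
      · exact fun U k => hS' (j.trans k)
  refine ⟨CZF.sUnion b, GameClosed.sUnion fun Q i S hS => ?_, fun Q i s hs => ?_⟩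
  · obtain ⟨s, -, h, -⟩ := h₂ i S hS
    exact h
  · obtain ⟨S, hS, -, D, φ, ψ, rfl, hD, hφ, hψ⟩ := h₁ i s hs
    rw [map_sUnion]
    exact ⟨D, φ, ψ, rfl, hD, mem_sUnion.2 ⟨S, hS, hφ⟩, mem_sUnion.2 ⟨S, hS, hψ⟩⟩

/-! ## The rules for the models of a game theory -/

/-- The formula for `tag k ⟨x, y⟩ ∈ Y`. -/
def tagMemFm (k x y Y : ℕ) : Fm := ex fun z => isTagged₂ k z x y ⋏ z ∊ Y

@[simp] theorem ev_tagMemFm {d k x y Y : ℕ} {e : ℕ → P} (hx : x < d) (hy : y < d) (hY : Y < d) :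
    Ev (tagMemFm k x y Y) d e ↔ tag k (pr (lk d e x) (lk d e y)) ∈ lk d e Y := by
  simp (disch := omega) only [tagMemFm, ev_ex, ev_conj, ev_isTagged₂, ev_mem, lk_old, lk_new]
  simp

/-- The formula for `NodeClause` with truth given by a set `Y` of nodes. -/
def nodeClauseFm (f q A F Y χ w : ℕ) : Fm :=
  (ex fun R => ex fun k => ex fun g => ex fun a =>
    pairMem R k q ⋏ isTagged₂ 0 χ R g ⋏ isFun a k A ⋏
    (all fun i => all fun t => all fun m =>
      pairMem i t g ⇾ pairMem i m a ⇾ hasValue f A F w t m) ⋏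
    tagMemFm 0 R a Y) ⋎
  (ex fun Φ => isTagged 1 χ Φ ⋏ allIn Φ fun ψ => tagMemFm 1 ψ w Y) ⋎
  (ex fun Φ => isTagged 2 χ Φ ⋏ exIn Φ fun ψ => tagMemFm 1 ψ w Y) ⋎
  (ex fun n => ex fun ψ => isTagged₂ 3 χ n ψ ⋏
    exIn A fun m => ex fun w' => isUpdate w' w n m ⋏ tagMemFm 1 ψ w' Y) ⋎
  (ex fun n => ex fun ψ => isTagged₂ 4 χ n ψ ⋏
    allIn A fun m => ex fun w' => isUpdate w' w n m ⋏ tagMemFm 1 ψ w' Y)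

theorem ev_nodeClauseFm {d f q A F Y χ w : ℕ} {e : ℕ → P} (hf : f < d) (hq : q < d) (hA : A < d)
    (hF : F < d) (hY : Y < d) (hχ : χ < d) (hw : w < d) : Ev (nodeClauseFm f q A F Y χ w) d e ↔
      NodeClause ⟨lk d e f, lk d e q, lk d e A, lk d e F⟩ (fun _ i x => x ∈ i (lk d e Y))
        (lk d e χ) (lk d e w) := by
  simp (disch := omega) only [nodeClauseFm, ev_disj, ev_ex, ev_conj, ev_allIn, ev_exIn,
    ev_all₃_imp₂, ev_isTagged, ev_isTagged₂, ev_pairMem, ev_isFun, ev_isUpdate,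
    ev_hasValue (q := q), ev_tagMemFm, lk_old, lk_new, lk_comp]
  rfl

/-- The rules are ({s}, {x}) for x ∈ z, and (z, {s}). -/
theorem ruleable_iff_forall {s z : P} (hs : s ∈ X) (hz : Sub z X) : Ruleable X fun Q i Y =>
    ∀ R (j : Q ⇛ R), j (i s) ∈ j Y ↔ ∀ U (k : R ⇛ U), ∀ x ∈ k (j (i z)), x ∈ k (j Y) := by
  have h₁ := ruleable_all (X := X) (a := z)
    (C := fun Q i x Y => ∀ R (j : Q ⇛ R), j (i s) ∈ j Y → j x ∈ j Y)
    (.of (0 ∊ 2 ⇾ 1 ∊ 2) 1 (s ∷ fun _ => s) fun Q i x Y => by simp)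
    fun Q i x hx => ruleable_imp (i.mem hs) (hz i x hx)
  refine (h₁.and (ruleable_rule hz (sub_single.2 hs))).congr fun Q i Y _ => ?_
  simp only [map_single, mem_single, exists_eq_left]
  exact ⟨fun h R j => ⟨fun hj U k x hx => h.1 U (j.trans k) x hx U (.refl U) (k.mem hj),
    fun hj => h.2 R j hj⟩, fun h => ⟨fun R j x hx U k hk => (h U (j.trans k)).1 hk U (.refl U) _
      (k.mem hx), fun R j hj => (h R j).2 hj⟩⟩

/-- The rules are ({x}, {s}) for x ∈ z, and ({s}, z); the conclusion of the last is a genuine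
disjunction. -/
theorem ruleable_iff_exists {s z : P} (hs : s ∈ X) (hz : Sub z X) : Ruleable X fun Q i Y =>
    ∀ R (j : Q ⇛ R), j (i s) ∈ j Y ↔ ∃ x ∈ j (i z), x ∈ j Y := by
  have h₁ := ruleable_all (X := X) (a := z)
    (C := fun Q i x Y => ∀ R (j : Q ⇛ R), j x ∈ j Y → j (i s) ∈ j Y)
    (.of (1 ∊ 2 ⇾ 0 ∊ 2) 1 (s ∷ fun _ => s) fun Q i x Y => by simp)
    fun Q i x hx => ruleable_imp (hz i x hx) (i.mem hs)
  refine (h₁.and (ruleable_rule (sub_single.2 hs) hz)).congr fun Q i Y _ => ?_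
  simp only [map_single, sub_single]
  exact ⟨fun h R j => ⟨fun hj => h.2 R j hj, fun ⟨x, hx, hj⟩ => h.1 R j x hx R (.refl R) hj⟩,
    fun h => ⟨fun R j x hx U k hk => (h U (j.trans k)).2 ⟨k x, k.mem hx, hk⟩,
      fun R j hj => (h R j).1 hj⟩⟩

theorem Premises.sub {χ z : P} (h : Premises M om S χ z)
    (hX : ∀ ⦃Q⦄ (i : P ⇛ Q) (x : Q), x ∈ i X ↔ Node (M.up i) (i om) (i S) x) : Sub z X :=
  fun _ i x hx => (hX i x).2 ((h i x hx).imp_right fun ⟨ψ, u, h₁, _, h₂⟩ => ⟨ψ, u, h₁, h₂⟩)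

/-- For each instance, `exists_premises` turns the clause into an equivalence with a meet or a join
of nodes, which is given by rules. -/
theorem ruleable_coherent (h : FormulaSystem M om S)
    (hX : ∀ ⦃Q⦄ (i : P ⇛ Q) (x : Q), x ∈ i X ↔ Node (M.up i) (i om) (i S) x) :
    Ruleable X fun _ i Y => Coherent (M.up i) (i om) (i S) Y := by
  have hI := isSet_instances M om S
  have key := ruleable_all (X := X) (a := hI.set)
    (C := fun Q i x Y => ∃ χ w, x = pr χ w ∧ ∀ R (j : Q ⇛ R), tag 1 (pr (j χ) (j w)) ∈ j Y ↔
      NodeClause ((M.up i).up j) (fun _ k y => y ∈ k (j Y)) (j χ) (j w))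
    (.of (ex fun χ => ex fun w => isPair 4 χ w ⋏
      (tagMemFm 1 χ w 5 ⇿ nodeClauseFm 0 1 2 3 5 χ w)) 4
      (M.F ∷ M.A ∷ M.q ∷ M.f ∷ fun _ => M.f) fun Q i x Y => by simp [ev_nodeClauseFm]; rfl)
    fun Q i x hx => by
      obtain ⟨χ, w, hI, rfl⟩ := (hI.mem_map i).1 hx
      have hs : tag 1 (pr χ w) ∈ i X := (hX i _).2 (Or.inr ⟨χ, w, hI, rfl⟩)
      obtain ⟨z, hz, hm⟩ := exists_premises (h.up i) hI
      have hzX : Sub z (i X) := Premises.sub hz fun R j => hX (i.trans j)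
      rcases hm with hm | hm
      · refine (ruleable_iff_forall hs hzX).congr fun R j Y _ => ⟨fun hY => ⟨j χ, j w, by simp,
          fun U k => ?_⟩, ?_⟩
        · refine Iff.trans ?_ ((hY U k).trans (hm (j.trans k) _).symm)
          simp
        · rintro ⟨χ', w', e, hY⟩ U k
          rw [map_pr, pr_inj] at e
          obtain ⟨rfl, rfl⟩ := e
          refine Iff.trans ?_ ((hY U k).trans (hm (j.trans k) _))
          simp
      · refine (ruleable_iff_exists hs hzX).congr fun R j Y _ => ⟨fun hY => ⟨j χ, j w, by simp,
          fun U k => ?_⟩, ?_⟩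
        · refine Iff.trans ?_ ((hY U k).trans (hm (j.trans k) fun _ l y => y ∈ l (k Y)).symm)
          simp
        · rintro ⟨χ', w', e, hY⟩ U k
          rw [map_pr, pr_inj] at e
          obtain ⟨rfl, rfl⟩ := e
          refine Iff.trans ?_ ((hY U k).trans (hm (j.trans k) _))
          simp
  refine key.congr fun Q i Y hY => ⟨fun hc => ⟨fun R j x hx => (hX (i.trans j) x).1 (hY j x hx),
    fun R j χ w hχ => ?_⟩, fun hc R j x hx => ?_⟩
  · obtain ⟨χ', w', e, hc⟩ := hc R j (pr χ w) ((hI.mem_map (i.trans j)).2 ⟨χ, w, hχ, rfl⟩)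
    rw [pr_inj] at e
    obtain ⟨rfl, rfl⟩ := e
    exact hc R (.refl R)
  · obtain ⟨χ, w, hχ, rfl⟩ := (hI.mem_map (i.trans j)).1 hx
    exact ⟨χ, w, rfl, fun U k => hc.clause (j.trans k) _ _ (hχ.up k)⟩

/-- The facts in `Y` on relation symbols in `r` are those in `I`. -/
structure Agrees (r A I Y : P) : Prop where
  mem : ∀ ⦃Q⦄ (i : P ⇛ Q), ∀ p ∈ i I, tag 0 p ∈ i Y
  of_mem : ∀ ⦃Q⦄ (i : P ⇛ Q) (p : Q), Fact (i r) (i A) p → tag 0 p ∈ i Y → p ∈ i I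

theorem ruleable_agrees {A : P} (hr : IsArity om r) (hI : IsRelInterp r A I)
    (hX : ∀ ⦃Q⦄ (i : P ⇛ Q) (p : Q), Fact (i r) (i A) p → tag 0 p ∈ i X) :
    Ruleable X fun _ i Y => Agrees (i r) (i A) (i I) Y := by
  have hfact := isSet_facts (A := A) hr
  have h₁ := ruleable_all (X := X) (a := I) (C := fun _ _ p Y => tag 0 p ∈ Y)
    (.of (ex fun x => isTagged 0 x 0 ⋏ x ∊ 1) 0 (fun _ => I) fun Q i p Y => by simp)
    fun Q i p hp => (ruleable_mem (hX i p (hI i p hp))).congr fun R j Y _ => by simp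
  have h₂ := ruleable_all (X := X) (a := hfact.set)
    (C := fun Q i p Y => ∀ R (j : Q ⇛ R), tag 0 (j p) ∈ j Y → j p ∈ j (i I))
    (.of ((ex fun x => isTagged 0 x 1 ⋏ x ∊ 2) ⇾ 1 ∊ 0) 1 (I ∷ fun _ => I) fun Q i p Y => by simp)
    fun Q i p hp => by
      have hp := hX i p ((hfact.mem_map i).1 hp)
      -- The set `b` contains the node of `p` just in case p ∈ I. The rule from that node to `b`
      -- thus says that a fact present in `Y` belongs to `I`, without deciding membership in `I`.
      obtain ⟨b, hb⟩ := (small_mem p (i I)).restrict (single (tag 0 p))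
      simp only [map_single, map_tag, mem_single] at hb
      refine (ruleable_rule (b := b) (sub_single.2 hp) fun R j y hy => ?_).congr
        fun R j Y _ => forall₂_congr fun U k => ?_
      · rw [((hb j y).1 hy).1, ← map_tag]
        exact j.mem hp
      · simp only [map_single, sub_single, map_tag]
        refine forall_congr' fun hk => ⟨?_, fun h => ⟨_, (hb (j.trans k) _).2 ⟨rfl, h⟩, hk⟩⟩
        rintro ⟨y, hy, -⟩
        exact ((hb (j.trans k) y).1 hy).2
  refine (h₁.and h₂).congr fun Q i Y _ => ⟨fun h => ⟨fun R j => h.1 R j, fun R j p hp hY =>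
    h.2 R j p ((hfact.mem_map (i.trans j)).2 hp) R (.refl R) hY⟩, fun h => ⟨fun R j => h.mem j,
      fun R j p hp U k hY => h.of_mem (j.trans k) _ ((hfact.mem_map ((i.trans j).trans k)).1
        (k.mem hp)) hY⟩⟩

/-- The sequents in `T` are true under all assignments. -/
def Respects (A T Y : P) : Prop := ∀ ⦃Q⦄ (i : P ⇛ Q) (D φ ψ v : Q), pr D (pr φ ψ) ∈ i T →
  IsFun v D (i A) → tag 1 (pr φ v) ∈ i Y → tag 1 (pr ψ v) ∈ i Y

/-- There is one implication between instances for each sequent and each assignment on its set of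
variables; these assignments form a function set. -/
theorem ruleable_respects (hT : SequentsIn om S T)
    (hX : ∀ ⦃Q⦄ (i : P ⇛ Q) (χ w : Q), Instance (M.up i) (i om) (i S) χ w → tag 1 (pr χ w) ∈ i X) :
    Ruleable X fun _ i Y => Respects (i M.A) (i T) Y := by
  have key := ruleable_all (X := X) (a := T)
    (C := fun Q i s Y => ∃ D φ ψ, s = pr D (pr φ ψ) ∧ ∀ R (j : Q ⇛ R) v,
      IsFun v (j D) (j (i M.A)) ∧ tag 1 (pr (j φ) v) ∈ j Y → tag 1 (pr (j ψ) v) ∈ j Y)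
    (.of (ex fun D => ex fun φ => ex fun ψ => isSequent 1 D φ ψ ⋏ all fun v =>
      isFun v D 0 ⋏ tagMemFm 1 φ v 2 ⇾ tagMemFm 1 ψ v 2) 1 (M.A ∷ fun _ => M.A)
      fun Q i s Y => by simp [ev_all_imp])
    fun Q i s hs => by
      obtain ⟨D, φ, ψ, rfl, hD, hφ, hψ⟩ := hT i s hs
      have := ruleable_all (X := i X) (a := exp D (i M.A))
        (C := fun R j v Y => ∀ U (k : R ⇛ U), tag 1 (pr (k (j φ)) (k v)) ∈ k Y →
          tag 1 (pr (k (j ψ)) (k v)) ∈ k Y)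
        (.of (tagMemFm 1 0 2 3 ⇾ tagMemFm 1 1 2 3) 2 (ψ ∷ φ ∷ fun _ => φ) fun R j v Y => by simp)
        fun R j v hv => by
          rw [map_exp, mem_exp] at hv
          refine (ruleable_imp (hX (i.trans j) _ _ ⟨j D, hD.up j, j.mem_pr hφ, hv⟩)
            (hX (i.trans j) _ _ ⟨j D, hD.up j, j.mem_pr hψ, hv⟩)).congr fun U k Y _ => ?_
          simp [Hom.trans]
      refine this.congr fun R j Y _ => ⟨fun h => ⟨j D, j φ, j ψ, by simp, fun U k v hv => ?_⟩, ?_⟩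
      · exact h U k v (by rw [map_exp, map_exp, mem_exp]; exact hv.1) U (.refl U) hv.2
      · rintro ⟨D', φ', ψ', e, h⟩ U k v hv V l hl
        simp only [map_pr, pr_inj] at e
        obtain ⟨rfl, rfl, rfl⟩ := e
        rw [map_exp, map_exp, mem_exp] at hv
        exact h V (k.trans l) (l v) ⟨hv.up l, hl⟩
  refine key.congr fun Q i Y _ => ⟨fun h R j D φ ψ v hs hv hφ => ?_, fun h R j s hs => ?_⟩
  · obtain ⟨D', φ', ψ', e, h⟩ := h R j _ hs
    simp only [pr_inj] at e
    obtain ⟨rfl, rfl, rfl⟩ := e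
    exact h R (.refl R) v ⟨hv, hφ⟩
  · obtain ⟨D, φ, ψ, rfl, -⟩ := hT (i.trans j) s hs
    refine ⟨D, φ, ψ, rfl, fun U k v hv => h (j.trans k) (k D) (k φ) (k ψ) v ?_ hv.1 hv.2⟩
    have := k.mem hs
    rwa [map_pr, map_pr] at this

end Solutions

end CZF

namespace CZF

section Generation

variable {P Q R : PrimeTheory}

/-! ## The generation of expansions from full NID -/

theorem isSet_untags (G : P) : IsSet fun _ i J => ∃ Y ∈ i G, J = untag 0 Y :=
  isSet_image (r := fun _ i Y J => J = untag 0 Y)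
    (.of (all fun p => p ∊ 1 ⇿ ex fun x => isTagged 0 x p ⋏ x ∊ 0) 0 (fun _ => G) fun Q i Y J => by
      rw [ev_all_iff]
      simp only [ev_mem, ev_ex, ev_conj]
      simp (disch := omega) only [ev_isTagged, lk_old, lk_new, lk_comp]
      simp only [exists_eq_left]
      exact ⟨fun h R j p => by simp [h], fun h => ext fun R j p => by simp [h R j p]⟩)
    fun Q i Y _ => ⟨untag 0 Y, fun R j J => by simp⟩

theorem isSet_subsets (G Y : P) : IsSet fun _ i β => β ∈ i G ∧ Sub β (i Y) :=
  isSet_sep (p := fun _ i β => Sub β (i Y)) (.of (sub 1 0) 1 (Y ∷ fun _ => Y) fun Q i β => by simp)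
    fun Q i β _ => Small.allIn (p := fun _ j x => x ∈ j (i Y))
      (.of (1 ∊ 0) 1 (i Y ∷ fun _ => i Y) fun R j x => by simp) fun R j x _ => small_mem x (j (i Y))

variable {om f r n q A F I T S Y : P}

/-- Disjointness of old and new symbols makes the arities in the union single-valued. -/
theorem ExpansionData.isArity_q (h : ExpansionData om f r n q A F I T) : IsArity om q := by
  rw [h.union]
  refine ⟨fun Q i p hp => ?_, fun Q i x y y' h₁ h₂ => ?_⟩
  · rw [map_cup, mem_cup] at hp
    exact hp.elim (h.arity_r.1 i p) (h.arity_n.1 i p)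
  · rw [map_cup, mem_cup] at h₁ h₂
    rcases h₁ with h₁ | h₁ <;> rcases h₂ with h₂ | h₂
    · exact h.arity_r.2 i x y y' h₁ h₂
    · exact (h.disj_r i x y y' h₁ h₂).elim
    · exact (h.disj_r i x y' y h₂ h₁).elim
    · exact h.arity_n.2 i x y y' h₁ h₂

theorem ExpansionData.sub_q (h : ExpansionData om f r n q A F I T) : Sub r q := fun Q i p hp => by
  rw [h.union, map_cup, mem_cup]
  exact Or.inl hp

theorem Fact.mono {p : P} (h : Fact r A p) (hrq : Sub r q) : Fact q A p :=
  let ⟨R, k, a, h₁, h₂⟩ := h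
  ⟨R, k, a, hrq.mem h₁, h₂⟩

theorem ExpansionData.isExpansion (h : ExpansionData om f r n q A F I T)
    (hY : Coherent ⟨f, q, A, F⟩ om S Y) (hI : Agrees r A I Y) :
    IsExpansion r q A I (untag 0 Y) := by
  refine ⟨fun Q i p hp => ?_, fun Q i R k a hR => ?_⟩
  · rw [map_untag, mem_untag] at hp
    exact (hY.up i).fact hp
  · rw [map_untag, mem_untag]
    refine ⟨fun hp => ?_, hI.mem i _⟩
    obtain ⟨R', k', a', hR', ha', e⟩ := (hY.up i).fact hp
    rw [pr_inj] at e
    obtain ⟨rfl, rfl⟩ := e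
    obtain rfl := (h.isArity_q.2.up i).eq hR' (h.sub_q i _ hR)
    exact hI.of_mem i _ ⟨R, k', a, hR, ha', rfl⟩ hp

theorem isModel_untag {M : Str P} (hS : FormulaSystem M om S) (hT : SequentsIn om S T)
    (hY : Coherent M om S Y) (hr : Respects M.A T Y) : IsModel M (untag 0 Y) T := by
  intro Q i D φ ψ v hs hv hφ
  obtain ⟨D', φ', ψ', e, hD, hφS, hψS⟩ := hT i _ hs
  simp only [pr_inj] at e
  obtain ⟨rfl, rfl, rfl⟩ := e
  rw [map_untag] at hφ ⊢
  rw [(hY.up i).sat_iff (hS.up i) ⟨D, hD, hψS, hv⟩]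
  exact hr i D φ ψ v hs hv (((hY.up i).sat_iff (hS.up i) ⟨D, hD, hφS, hv⟩).1 hφ)

theorem agrees_trueNodes {M : Str P} {J : P} (hS : FormulaSystem M om S) (hrq : Sub r M.q)
    (hI : IsRelInterp r M.A I) (hJ : IsExpansion r M.q M.A I J) :
    Agrees r M.A I (isSet_trueNodes hS J).set := by
  refine ⟨fun Q i p hp => ?_, fun Q i p hp hpY => ?_⟩
  · obtain ⟨R, k, a, hR, ha, rfl⟩ := hI i p hp
    exact ((isSet_trueNodes hS J).mem_map i).2 ⟨Or.inl ⟨_, ⟨R, k, a, hrq i _ hR, ha, rfl⟩, rfl⟩,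
      truth_fact.2 ((hJ.iff i R k a hR).2 hp)⟩
  · have := truth_fact.1 (((isSet_trueNodes hS J).mem_map i).1 hpY).2
    obtain ⟨R, k, a, hR, ha, rfl⟩ := hp
    exact (hJ.iff i R k a hR).1 this

theorem respects_trueNodes {M : Str P} {J : P} (hS : FormulaSystem M om S)
    (hT : SequentsIn om S T) (hJ : IsModel M J T) :
    Respects M.A T (isSet_trueNodes hS J).set := by
  intro Q i D φ ψ v hs hv hφ
  obtain ⟨D', φ', ψ', e, hD, hφS, hψS⟩ := hT i _ hs
  simp only [pr_inj] at e
  obtain ⟨rfl, rfl, rfl⟩ := e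
  refine ((isSet_trueNodes hS J).mem_map i).2 ⟨Or.inr ⟨ψ, v, ⟨D, hD, hψS, hv⟩, rfl⟩, ?_⟩
  exact truth_instance.2 (hJ i D φ ψ v hs hv
    (truth_instance.1 (((isSet_trueNodes hS J).mem_map i).1 hφ).2))

/-- Full NID is applied to the nodes with the rules for coherence, agreement with `I` and validity
of `T`; taking the facts of the generating closed sets yields the generating models. -/
theorem expansionsGenerated_of_fullNID (h : FullNID P) : ExpansionsGenerated P := by
  intro Q i₀ om f r n q A F I T hd
  replace h := h.up i₀
  obtain ⟨S, hS, hT⟩ := exists_gameClosed hd.theory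
  let M : Str Q := ⟨f, q, A, F⟩
  have hM : FormulaSystem M om S := ⟨hd.omega, hd.isArity_q, hd.arity_f.2, hd.funInterp, hS⟩
  have hX := isSet_nodes hM
  obtain ⟨ρ, hρ, hclosed⟩ := ((ruleable_coherent hM fun R i x => hX.mem_map i).and
    (ruleable_agrees hd.arity_r hd.relInterp fun R i p hp =>
      (hX.mem_map i).2 (Or.inl ⟨p, hp.mono (hd.sub_q.up i), rfl⟩))).and
    (ruleable_respects hT fun R i χ w hI => (hX.mem_map i).2 (Or.inr ⟨χ, w, hI, rfl⟩))
  obtain ⟨G, hG, hgen⟩ := h (.refl Q) hX.set ρ hρ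
  refine ⟨(isSet_untags G).set, fun R j J hJ => ?_, fun R j J hJ hmod => ?_⟩
  · obtain ⟨Y, hY, rfl⟩ := ((isSet_untags G).mem_map j).1 hJ
    have hc := hG R j Y hY
    obtain ⟨⟨h₁, h₂⟩, h₃⟩ := (hclosed j Y hc.sub).1 hc
    exact ⟨(hd.up j).isExpansion h₁ h₂,
      isModel_untag (hM.up j) (fun U k => hT (j.trans k)) h₁ h₃⟩
  · have hY := isSet_trueNodes (hM.up j) J
    have hYX : Sub hY.set (j hX.set) := fun U k x hx =>
      (hX.mem_map (j.trans k)).2 ((hY.mem_map k).1 hx).1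
    have hc : IsClosed (j ρ) (j hX.set) hY.set := (hclosed j _ hYX).2
      ⟨⟨coherent_trueNodes (hM.up j) J,
        agrees_trueNodes (hM.up j) (hd.sub_q.up j) (hd.relInterp.up j) hJ⟩,
        respects_trueNodes (hM.up j) (fun U k => hT (j.trans k)) hmod⟩
    -- All members of `G` contained in the set of true nodes are used, so none has to be chosen for
    -- a given fact. Their facts are true in `J`, and generation shows that every fact of `J`
    -- occurs.
    have hG' := isSet_subsets (j G) hY.set
    refine ⟨(isSet_untags hG'.set).set, fun U k K hK => ?_, fun U k s l a hs => ⟨fun hp => ?_, ?_⟩⟩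
    · obtain ⟨β, hβ, rfl⟩ := ((isSet_untags hG'.set).mem_map k).1 hK
      exact ((isSet_untags G).mem_map (j.trans k)).2 ⟨β, ((hG'.mem_map k).1 hβ).1, rfl⟩
    · have hpY : tag 0 (pr s a) ∈ k hY.set :=
        (hY.mem_map k).2 ⟨Or.inl ⟨_, hJ.rel k _ hp, rfl⟩, truth_fact.2 hp⟩
      obtain ⟨β, hβ, hpβ, hsub⟩ := hgen U (j.trans k) _ (hc.up k) _ hpY
      exact ⟨untag 0 β, ((isSet_untags hG'.set).mem_map k).2
        ⟨β, (hG'.mem_map k).2 ⟨hβ, hsub⟩, rfl⟩, mem_untag.2 hpβ⟩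
    · rintro ⟨K, hK, hp⟩
      obtain ⟨β, hβ, rfl⟩ := ((isSet_untags hG'.set).mem_map k).1 hK
      have hpY := ((hG'.mem_map k).1 hβ).2.mem (mem_untag.1 hp)
      exact truth_fact.1 ((hY.mem_map k).1 hpY).2

end Generation

end CZF

/-! ### The equivalence -/

theorem mainTheorem7 : CZF.Proves (CZF.equi CZF.fullNID CZF.expansionsGenerated) := by
  refine CZF.prf_of_holds fun P e => ?_
  change CZF.Ev (CZF.equi CZF.fullNID CZF.expansionsGenerated) 0 e
  rw [CZF.ev_equi]
  exact fun Q i => CZF.ev_fullNID.trans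
    ⟨fun h => CZF.ev_of_expansionsGenerated (CZF.expansionsGenerated_of_fullNID h),
      fun h => CZF.fullNID_of_expansionsGenerated (CZF.expansionsGenerated_of_ev h)⟩
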